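/- Let $G$ be a (finite-dimensional, Hausdorff) Lie group with Lie algebra $\mathfrak g$, basis $J_1,\dots,J_d$, $[J_a,J_b]=f_{ab}{}^cJ_c$, let $n,g\ge 0$ and $\hbar\in\mathbb R$; repeated indices are summed. Write $\mathrm{Ad}(u)J_a=\mathrm{Ad}^*(u)_a{}^{b}J_b$, so that $\mathrm{Ad}^*(uv)_a{}^c=\mathrm{Ad}^*(v)_a{}^b\,\mathrm{Ad}^*(u)_b{}^c$. Points of $G^{n+2g}$ are written $(u_{M_1},\dots,u_{M_n},u_{A_1},u_{B_1},\dots,u_{A_g},u_{B_g})$, the loops are partially ordered by $M_1<\dots<M_n<A_1,B_1<\dots<A_g,B_g$, and $J_a^{R_X}F=\frac{d}{dt}|_0F(\dots,u_Xe^{tJ_a},\dots)$, $J_a^{L_X}F=\frac{d}{dt}|_0F(\dots,e^{-tJ_a}u_X,\dots)$. **Classical algebra.** Let $\mathcal F_{\mathbb C}=S(\bigoplus_{k=1}^{n+2g}\mathfrak g)\otimes C^\infty(G^{n+2g},\mathbb C)$ be the polynomials in generators $j_a^X$ with coefficients in $C^\infty(G^{n+2g},\mathbb C)$, and $\mathcal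 F^{(0)}\oplus\mathcal F^{(1)}$ its part of degree $\le1$ in the $j_a^X$ (over $\mathbb C$). The flower algebra bracket is the Poisson bracket with $\{F,F'\}=0$, $$\{j^X_a,j^X_b\}=-f_{ab}{}^cj^X_c,\qquad \{j_a^{A_i},j_b^{B_i}\}=-f_{ab}{}^cj_c^{B_i},\qquad \{j^X_a,j^Y_b\}=-f_{db}{}^c\,(\delta_a^d-\mathrm{Ad}^*(u_X)_a{}^d)\,j^Y_c\quad(X<Y),$$ $$\{j_a^{M_i},F\}=-(J_a^{R_{M_i}}+J_a^{L_{M_i}})F-(\delta_a^b-\mathrm{Ad}^*(u_{M_i})_a{}^b)\sum_{Y>M_i}(J_b^{R_Y}+J_b^{L_Y})F,$$ $$\{j_a^{A_i},F\}=-(J_a^{R_{A_i}}+J_a^{L_{A_i}})F-(J_a^{R_{B_i}}+J_a^{L_{B_i}})F-\mathrm{Ad}^*(u_{B_i}^{-1}u_{A_i})_a{}^bJ_b^{R_{B_i}}F-(\delta_a^b-\mathrm{Ad}^*(u_{A_i})_a{}^b)\sum_{Y>A_i}(J_b^{R_Y}+J_b^{L_Y})F,$$ $$\{j_a^{B_i},F\}=-J_a^{L_{A_i}}F-(J_a^{R_{B_i}}+J_a^{L_{B_i}})F-(\delta_a^b-\mathrm{Ad}^*(u_{B_i})_a{}^b)\sum_{Y>B_i}(J_b^{R_Y}+J_b^{L_Y})F.\tag{1}$$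 **Decoupling transformation.** Write $(\mathrm{Ad}^*(w)j)_a=\mathrm{Ad}^*(w)_a{}^bj_b$. $K$ is the $C^\infty(G^{n+2g},\mathbb C)$-algebra endomorphism of $\mathcal F_{\mathbb C}$ with $K(j_a^X)=j_a^{X'}$, where, with $u_{K_i}=u_{B_i}u_{A_i}^{-1}u_{B_i}^{-1}u_{A_i}$, $\;j^{H_i}=(1-\mathrm{Ad}^*(u_{A_i}^{-1}u_{B_i}^{-1}u_{A_i}))j^{A_i}+(\mathrm{Ad}^*(u_{A_i}^{-1}u_{B_i}^{-1}u_{A_i})-\mathrm{Ad}^*(u_{B_i}^{-1}u_{A_i}))j^{B_i}$ and $T_i=\sum_{k>i}\mathrm{Ad}^*(u_{K_{k-1}}\cdots u_{K_{i+1}})j^{H_k}$, $$j^{M_i'}=j^{M_i}-(1-\mathrm{Ad}^*(u_{M_i}))\Big(\sum_{k>i}\mathrm{Ad}^*(u_{M_{k-1}}\cdots u_{M_{i+1}})j^{M_k}+\sum_{k=1}^g\mathrm{Ad}^*(u_{K_{k-1}}\cdots u_{K_1}u_{M_n}\cdots u_{M_{i+1}})j^{H_k}\Big),$$ $$j^{A_i'}=j^{A_i}+\mathrm{Ad}^*(u_{A_i}^{-1})(j^{A_i}-j^{B_i})+(\mathrm{Ad}^*(u_{A_i})-\mathrm{Ad}^*(u_{B_i}u_{A_i}^{-1}))T_i,$$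 $$j^{B_i'}=j^{B_i}+\mathrm{Ad}^*(u_{A_i}^{-1})(j^{A_i}-j^{B_i})+(\mathrm{Ad}^*(u_{B_i})-\mathrm{Ad}^*(u_{B_i}u_{A_i}^{-1}))T_i.$$ **Quantum algebra.** Let $\mathfrak e=\bigoplus_X\mathfrak g$ have one copy of $\mathfrak g$ per loop. Let $j_a^{M_i'},\ j_a^{A_i'}-j_a^{B_i'},\ j_a^{B_i'}\in\mathfrak e$ be the element $J_a$ in the copies labelled $M_i,A_i,B_i$. Equip $\mathfrak e$ with $\{\xi,\eta\}=-[\xi,\eta]$ and, for $\xi$ in the copy labelled $X$, with the action $\{\xi,F\}(u)=-\frac{d}{dt}|_0F(u\cdot_Xe^{t\xi})$ on functions, where $\cdot_{M_i}h$ sends $u_{M_i}\mapsto h^{-1}u_{M_i}h$, $\cdot_{A_i}h$ sends $(u_{A_i},u_{B_i})\mapsto(u_{A_i}h,\,u_{A_i}hu_{A_i}^{-1}u_{B_i})$ and $\cdot_{B_i}h$ sends $u_{B_i}\mapsto u_{B_i}h$, all other components being fixed. Let $U(\mathfrak e)$ be the universal enveloping algebra of $\mathfrak e_{\mathbb C}$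 with bracket $i\hbar\{\cdot,\cdot\}$, and let $\hat{\mathcal F}=U(\mathfrak e)\otimes C^\infty(G^{n+2g},\mathbb C)$ be the associative algebra with multiplication determined by $$(\xi\otimes F)(\eta\otimes F')=\xi\cdot_U\eta\otimes FF'+i\hbar\,\eta\otimes F\{\xi,F'\}\qquad(\xi\in\mathfrak e,\ \eta\in U(\mathfrak e)),$$ together with $(1\otimes F)(\eta\otimes F')=\eta\otimes FF'$. Put $\hat{\mathcal F}^{(1)}=(\mathbb C1+\mathfrak e_{\mathbb C})\otimes C^\infty(G^{n+2g},\mathbb C)$. Let $Q:\mathcal F_{\mathbb C}\to\hat{\mathcal F}$ be the linear map sending a monomial $j_{x_1}\cdots j_{x_m}F$ to $j'_{x_1}\cdot_U\cdots\cdot_Uj'_{x_m}\otimes F$, for $x_1\le\dots\le x_m$ in a fixed order of the generators, where $j'_x=j_a^{X'}$ for $x=(X,a)$. Let $Q|_{01}:\mathcal F^{(0)}\oplus\mathcal F^{(1)}\to\hat{\mathcal F}^{(1)}$ be its restriction. **Theorem (quantum decoupling transformation).** $Q|_{01}$ is a linear isomorphism onto $\hat{\mathcal F}^{(1)}$, and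 $K$ restricts to a linear automorphism of $\mathcal F^{(0)}\oplus\mathcal F^{(1)}$. Define $$\hat K=Q|_{01}\circ K\circ Q|_{01}^{-1}:\hat{\mathcal F}^{(1)}\to\hat{\mathcal F}^{(1)},$$ which has the inverse $\hat K^{-1}=Q|_{01}\circ K^{-1}\circ Q|_{01}^{-1}$. Then the commutators of the transformed generators $\hat K^{-1}(j_a^{X'}\otimes1)$ and $\hat K^{-1}(1\otimes F)$ are obtained by applying $i\hbar\,Q|_{01}$ to the right-hand sides of (1), the $j_c^Y$ there being expressed through the decoupled generators by $K^{-1}$: for all $X,Y,a,b,F,F'$, $$[\hat K^{-1}Q(j_a^X),\hat K^{-1}Q(j_b^Y)]=i\hbar\,Q|_{01}(K^{-1}\{j_a^X,j_b^Y\}),\quad[\hat K^{-1}Q(j_a^X),\hat K^{-1}Q(F)]=i\hbar\,Q|_{01}(K^{-1}\{j_a^X,F\}),\quad[\hat K^{-1}Q(F),\hat K^{-1}Q(F')]=0,$$ and more generally $[\hat K^{-1}Q(W),\hat K^{-1}Q(Z)]=i\hbar\,Q|_{01}(K^{-1}\{W,Z\})$ for all $W,Z\in\mathcal F^{(0)}\oplus\mathcal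 F^{(1)}$, with $\{\cdot,\cdot\}$ the undecoupled flower algebra bracket. This is the quantisation of the undecoupled flower algebra in degree $\le 1$. -/

import Mathlib

open scoped Manifold ContDiff TensorProduct

set_option linter.unusedSectionVars false

namespace FlowerAlgebra

open Function

instance lieGroup_minSmoothness {d : ℕ} {G : Type*} [TopologicalSpace G]
    [ChartedSpace (EuclideanSpace ℝ (Fin d)) G] [Group G] [LieGroup (𝓡 d) ∞ G] :
    LieGroup (𝓡 d) (minSmoothness ℝ 3) G :=
  LieGroup.of_le (n := ∞) (by simp only [minSmoothness_of_isRCLikeNormedField]; exact ENat.LEInfty.out)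

section
variable {d : ℕ} {G : Type*} [TopologicalSpace G]
    [ChartedSpace (EuclideanSpace ℝ (Fin d)) G]

theorem contMDiffAt_piMfd {ι : Type*} [Fintype ι] {E' H' N : Type*} [NormedAddCommGroup E'] [NormedSpace ℝ E']
   [TopologicalSpace H'] {J : ModelWithCorners ℝ E' H'} [TopologicalSpace N] [ChartedSpace H' N] (f : N → ι → G) (x : N):
  ContMDiffAt J (ModelWithCorners.pi fun _ : ι => 𝓡 d) ∞ f x ↔ ∀ i, ContMDiffAt J (𝓡 d) ∞ (fun y => f y i) x := by
  simp only [contMDiffAt_iff, continuousAt_pi, forall_and]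
  refine and_congr_right fun _ => ?_
  exact contDiffWithinAt_pi

instance isManifold_pi (ι : Type*) [Fintype ι] [IsManifold (𝓡 d) ∞ G] :
  IsManifold (ModelWithCorners.pi fun _ : ι => 𝓡 d) ∞ (ι → G) := by
  apply isManifold_of_contDiffOn
  rintro _ _ ⟨e, he, rfl⟩ ⟨e', he', rfl⟩
  rw [contDiffOn_pi]
  intro i
  have h := (HasGroupoid.compatible (G := contDiffGroupoid ∞ (𝓡 d)) (he i (Set.mem_univ _)) (he' i (Set.mem_univ _)))
  have h1 := h.1
  simp only [contDiffPregroupoid] at h1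
  have h2 : ContDiff ℝ ∞ (fun x : ι → EuclideanSpace ℝ (Fin d) => x i) := contDiff_apply _ _ i
  refine (h1.comp h2.contDiffOn (s := (ModelWithCorners.pi fun _ : ι => 𝓡 d).symm ⁻¹'
        ((OpenPartialHomeomorph.pi e).symm ≫ₕ OpenPartialHomeomorph.pi e').source ∩
      Set.range (ModelWithCorners.pi fun _ : ι => 𝓡 d)) ?_)
  rintro x ⟨hx, -⟩
  refine ⟨?_, ⟨x i, rfl⟩⟩
  exact ⟨hx.1 i (Set.mem_univ _), hx.2 i (Set.mem_univ _)⟩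
end

section
variable {d : ℕ} {G : Type*} [TopologicalSpace G]
    [ChartedSpace (EuclideanSpace ℝ (Fin d)) G] [Group G] [LieGroup (𝓡 d) ∞ G]
 {E' H' M : Type*} [NormedAddCommGroup E'] [NormedSpace ℝ E']
   [TopologicalSpace H'] (J : ModelWithCorners ℝ E' H') [TopologicalSpace M] [ChartedSpace H' M]

def smoothFun (J : ModelWithCorners ℝ E' H') (M : Type*) [TopologicalSpace M] [ChartedSpace H' M] : Subalgebra ℂ (M → ℂ) where
  carrier := {F | ContMDiff J 𝓘(ℝ, ℂ) ∞ F}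
  mul_mem' hF hK := (contDiff_mul.contMDiff).comp (ContMDiff.prodMk_space hF hK)
  add_mem' hF hK := (contDiff_add.contMDiff).comp (ContMDiff.prodMk_space hF hK)
  algebraMap_mem' _ := contMDiff_const

noncomputable def dOne (f : G → ℂ) (ξ : GroupLieAlgebra (𝓡 d) G) : ℂ := mfderiv (𝓡 d) 𝓘(ℝ, ℂ) f 1 ξ

theorem dOne_eq {f : G → ℂ} (hf : MDifferentiableAt (𝓡 d) 𝓘(ℝ, ℂ) f 1) (ξ : GroupLieAlgebra (𝓡 d) G) :
   dOne f ξ = fderiv ℝ (f ∘ (extChartAt (𝓡 d) (1:G)).symm) (extChartAt (𝓡 d) (1:G) 1) ξ := by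
  unfold dOne
  rw [hf.mfderiv]
  simp [writtenInExtChartAt]
  rfl

theorem inTangentCoordinates_one_left (f : M → ℂ)
    (ϕ : M → (EuclideanSpace ℝ (Fin d) →L[ℝ] ℂ)) (x₀ x : M) :
    inTangentCoordinates (𝓡 d) 𝓘(ℝ, ℂ) (fun _ => (1 : G)) f ϕ x₀ x = ϕ x := by
  rw [inTangentCoordinates_eq (fun _ => (1:G)) f ϕ (x₀ := x₀) (x := x) (hx := mem_chart_source _ (1:G)) (hy := by rw [chartAt_self_eq]; exact Set.mem_univ _)]
  ext v
  have h2 : ∀ v, (tangentBundleCore (𝓡 d) G).coordChange (achart _ (1:G)) (achart _ (1:G)) 1 v = v :=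
   fun v => (tangentBundleCore (𝓡 d) G).coordChange_self _ _ (mem_chart_source _ (1:G)) v
  have h3 : ∀ (a b c : ℂ) v, (tangentBundleCore 𝓘(ℝ, ℂ) ℂ).coordChange (achart _ a) (achart _ b) c v = v := by simp
  simp only [ContinuousLinearMap.comp_apply]
  rw [h3, h2]

theorem inTangentCoordinates_one_one (f : M → G) (hf : ∀ m, f m = 1)
    (ϕ : M → (EuclideanSpace ℝ (Fin d) →L[ℝ] EuclideanSpace ℝ (Fin d))) (x₀ x : M) :
    inTangentCoordinates (𝓡 d) (𝓡 d) (fun _ => (1 : G)) f ϕ x₀ x = ϕ x := by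
  obtain rfl : f = fun _ => 1 := funext hf
  rw [inTangentCoordinates_eq (fun _ => (1:G)) (fun _ => (1:G)) ϕ (hx := mem_chart_source _ (1:G)) (hy := mem_chart_source _ (1:G))]
  ext1 v
  have h2 : ∀ v, (tangentBundleCore (𝓡 d) G).coordChange (achart _ (1:G)) (achart _ (1:G)) 1 v = v :=
   fun v => (tangentBundleCore (𝓡 d) G).coordChange_self _ _ (mem_chart_source _ (1:G)) v
  simp only [ContinuousLinearMap.comp_apply]
  rw [h2, h2]

theorem smooth_deriv [IsManifold J 1 M] (f : M → G → ℂ)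
    (hf : ContMDiff (J.prod (𝓡 d)) 𝓘(ℝ, ℂ) ∞ (uncurry f)) (ξ : GroupLieAlgebra (𝓡 d) G) :
    ContMDiff J 𝓘(ℝ, ℂ) ∞ (fun m => dOne (f m) ξ) := by
  intro m
  let v : EuclideanSpace ℝ (Fin d) := ξ
  have h := ContMDiffAt.mfderiv_apply (J := J) (J' := J) (n := ∞) (m := ∞) (x₀ := m) f (fun _ => (1:G)) id (fun _ => v)
    (hf _) contMDiffAt_const contMDiffAt_id contMDiffAt_const le_rfl
  exact h.congr_of_eventuallyEq (Filter.Eventually.of_forall fun x =>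
    (DFunLike.congr_fun (inTangentCoordinates_one_left (G := G) (fun x => f x 1) (fun x => mfderiv (𝓡 d) 𝓘(ℝ,ℂ) (f x) 1) m x) v).symm)

theorem smooth_derivG [IsManifold J 1 M] (f : M → G → G)
    (hf : ContMDiff (J.prod (𝓡 d)) (𝓡 d) ∞ (uncurry f)) (h1 : ∀ m, f m 1 = 1) (ξ : GroupLieAlgebra (𝓡 d) G) :
    ContMDiff J 𝓘(ℝ, EuclideanSpace ℝ (Fin d)) ∞ (fun m => (show EuclideanSpace ℝ (Fin d) from mfderiv (𝓡 d) (𝓡 d) (f m) 1 ξ)) := by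
  intro m
  let v : EuclideanSpace ℝ (Fin d) := ξ
  have h := ContMDiffAt.mfderiv_apply (J := J) (J' := J) (n := ∞) (m := ∞) (x₀ := m) f (fun _ => (1:G)) id (fun _ => v)
    (hf _) contMDiffAt_const contMDiffAt_id contMDiffAt_const le_rfl
  exact h.congr_of_eventuallyEq (Filter.Eventually.of_forall fun x =>
    (DFunLike.congr_fun (inTangentCoordinates_one_one (G := G) (fun x => f x 1) h1 (fun x => mfderiv (𝓡 d) (𝓡 d) (f x) 1) m x) v).symm)
end

section
open VectorField

theorem fderiv_partial_comm {E F : Type*} [NormedAddCommGroup E] [NormedSpace ℝ E]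
    [NormedAddCommGroup F] [NormedSpace ℝ F] (f : E × E → F) (p : E)
    (hf : ∀ᶠ q in nhds (p, p), ContDiffAt ℝ ∞ f q) (v w : E) :
    fderiv ℝ (fun x => fderiv ℝ (fun y => f (x, y)) p w) p v =
      fderiv ℝ (fun y => fderiv ℝ (fun x => f (x, y)) p v) p w := by
  have hc : ContinuousAt (fun x : E => (x, p)) p := by fun_prop
  have hc' : ContinuousAt (fun y : E => (p, y)) p := by fun_prop
  have hd2 : HasFDerivAt (fderiv ℝ f) (fderiv ℝ (fderiv ℝ f) (p, p)) (p, p) :=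
    ((hf.self_of_nhds.fderiv_right (m := ∞) le_rfl).differentiableAt (by simp)).hasFDerivAt
  have e1 : (fun x => fderiv ℝ (fun y => f (x, y)) p w) =ᶠ[nhds p]
      fun x => fderiv ℝ f (x, p) (0, w) := by
    filter_upwards [hc.eventually hf] with x hx
    have := HasFDerivAt.comp p (hx.differentiableAt (by simp)).hasFDerivAt
      (hasFDerivAt_prodMk_right x p)
    rw [show (fun y => f (x, y)) = f ∘ fun y => (x, y) from rfl, this.fderiv]
    simp
  have e2 : (fun y => fderiv ℝ (fun x => f (x, y)) p v) =ᶠ[nhds p]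
      fun y => fderiv ℝ f (p, y) (v, 0) := by
    filter_upwards [hc'.eventually hf] with y hy
    have := HasFDerivAt.comp (f := fun x => (x, y)) p (hy.differentiableAt (by simp)).hasFDerivAt
      (hasFDerivAt_prodMk_left p y)
    rw [show (fun x => f (x, y)) = f ∘ fun x => (x, y) from rfl, this.fderiv]
    simp
  have h1 := (HasFDerivAt.comp (f := fun x => (x, p)) p hd2 (hasFDerivAt_prodMk_left p p)).clm_apply
    (hasFDerivAt_const ((0 : E), w) p)
  have h2 := (HasFDerivAt.comp (f := fun y => (p, y)) p hd2 (hasFDerivAt_prodMk_right p p)).clm_apply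
    (hasFDerivAt_const (v, (0 : E)) p)
  rw [e1.fderiv_eq, e2.fderiv_eq]
  have h1' := h1.fderiv
  have h2' := h2.fderiv
  simp only [comp_def] at h1' h2'
  rw [h1', h2']
  simpa using (hf.self_of_nhds.isSymmSndFDerivAt
    (by rw [minSmoothness_of_isRCLikeNormedField]; exact ENat.LEInfty.out)).eq (v, 0) (0, w)

section
variable {d : ℕ} {G : Type*} [TopologicalSpace G]
    [ChartedSpace (EuclideanSpace ℝ (Fin d)) G] [Group G] [LieGroup (𝓡 d) ∞ G]

theorem dOne_comm (f : G → G → ℂ) (hf : ContMDiff ((𝓡 d).prod (𝓡 d)) 𝓘(ℝ, ℂ) ∞ (uncurry f))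
    (ξ η : GroupLieAlgebra (𝓡 d) G) :
    dOne (fun h => dOne (f h) η) ξ = dOne (fun k => dOne (fun h => f h k) ξ) η := by
  have hsm : ∀ h, ContMDiff (𝓡 d) 𝓘(ℝ, ℂ) ∞ (f h) := fun h => hf.comp (contMDiff_const.prodMk contMDiff_id)
  have hsm' : ∀ k, ContMDiff (𝓡 d) 𝓘(ℝ, ℂ) ∞ (fun h => f h k) := fun k => hf.comp (contMDiff_id.prodMk contMDiff_const)
  have hf' : ContMDiff ((𝓡 d).prod (𝓡 d)) 𝓘(ℝ, ℂ) ∞ (uncurry fun k h => f h k) := hf.comp (contMDiff_snd.prodMk contMDiff_fst)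
  rw [dOne_eq ((smooth_deriv (𝓡 d) f hf η).mdifferentiableAt (by simp)),
   dOne_eq ((smooth_deriv (𝓡 d) (fun k h => f h k) hf' ξ).mdifferentiableAt (by simp))]
  simp only [comp_def]
  simp_rw [dOne_eq ((hsm _).mdifferentiableAt (by simp)), dOne_eq ((hsm' _).mdifferentiableAt (by simp))]
  refine fderiv_partial_comm (fun q => f ((extChartAt (𝓡 d) (1:G)).symm q.1) ((extChartAt (𝓡 d) (1:G)).symm q.2)) _ ?_ _ _
  have ht := extChartAt_target_mem_nhds (I := 𝓡 d) (1:G)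
  filter_upwards [prod_mem_nhds ht ht] with q hq
  rw [← contMDiffAt_iff_contDiffAt]
  have h1 := ((contMDiffOn_extChartAt_symm (I := 𝓡 d) (n := ∞) (1:G)).contMDiffAt ((isOpen_extChartAt_target (1:G)).mem_nhds hq.1))
  have h2 := ((contMDiffOn_extChartAt_symm (I := 𝓡 d) (n := ∞) (1:G)).contMDiffAt ((isOpen_extChartAt_target (1:G)).mem_nhds hq.2))
  exact (hf.contMDiffAt (x := (_, _))).comp q
      ((h1.comp q (contDiff_fst (𝕜 := ℝ) (n := ∞)).contMDiff.contMDiffAt).prodMk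
       (h2.comp q (contDiff_snd (𝕜 := ℝ) (n := ∞)).contMDiff.contMDiffAt))

theorem dOne_mul_left (f : G → ℂ) (hf : ContMDiff (𝓡 d) 𝓘(ℝ, ℂ) ∞ f) (η : GroupLieAlgebra (𝓡 d) G) (h : G) :
   dOne (fun k => f (h * k)) η = mfderiv (𝓡 d) 𝓘(ℝ, ℂ) f h (mulInvariantVectorField η h) := by
  unfold dOne mulInvariantVectorField
  have h1 : MDifferentiableAt (𝓡 d) (𝓡 d) (fun k : G => h * k) 1 :=
    (contMDiff_mul_left (I := 𝓡 d) (n := ∞) (a := h)).mdifferentiableAt (by simp)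
  have h2 : MDifferentiableAt (𝓡 d) 𝓘(ℝ, ℂ) f (h * 1) := hf.mdifferentiableAt (by simp)
  have := mfderiv_comp (1:G) h2 h1
  rw [show (fun k => f (h * k)) = f ∘ (fun k => h * k) from rfl, this]
  have key : ∀ g (_ : g = h), (mfderiv (𝓡 d) 𝓘(ℝ, ℂ) f g : EuclideanSpace ℝ (Fin d) →L[ℝ] ℂ)
      (mfderiv (𝓡 d) (𝓡 d) (fun k : G => h * k) 1 η) =
      (mfderiv (𝓡 d) 𝓘(ℝ, ℂ) f h : EuclideanSpace ℝ (Fin d) →L[ℝ] ℂ)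
      (mfderiv (𝓡 d) (𝓡 d) (fun k : G => h * k) 1 η) := by
    rintro _ rfl; rfl
  exact key _ (mul_one h)

theorem fderiv_field_comm {E F : Type*} [NormedAddCommGroup E] [NormedSpace ℝ E]
    [NormedAddCommGroup F] [NormedSpace ℝ F] (f : E → F) (p : E)
    (hf : ContDiffAt ℝ ∞ f p) (V W : E → E) (hV : DifferentiableAt ℝ V p) (hW : DifferentiableAt ℝ W p) :
    fderiv ℝ (fun x => fderiv ℝ f x (W x)) p (V p) - fderiv ℝ (fun x => fderiv ℝ f x (V x)) p (W p)
      = fderiv ℝ f p (lieBracket ℝ V W p) := by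
  have hd2 : HasFDerivAt (fderiv ℝ f) (fderiv ℝ (fderiv ℝ f) p) p :=
    ((hf.fderiv_right (m := ∞) le_rfl).differentiableAt (by simp)).hasFDerivAt
  rw [(hd2.clm_apply hW.hasFDerivAt).fderiv, (hd2.clm_apply hV.hasFDerivAt).fderiv]
  have := (hf.isSymmSndFDerivAt
    (by rw [minSmoothness_of_isRCLikeNormedField]; exact ENat.LEInfty.out)).eq (V p) (W p)
  simp [lieBracket, this]

theorem dOne_bracket (f : G → ℂ) (hf : ContMDiff (𝓡 d) 𝓘(ℝ, ℂ) ∞ f) (ξ η : GroupLieAlgebra (𝓡 d) G) :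
    dOne (fun h => dOne (fun k => f (h * k)) η) ξ - dOne (fun h => dOne (fun k => f (h * k)) ξ) η
      = dOne f ⁅ξ, η⁆ := by
  set φ := extChartAt (𝓡 d) (1:G) with hφ
  set p := φ 1 with hp
  have hp1 : φ.symm p = 1 := extChartAt_to_inv _
  let V (ζ : GroupLieAlgebra (𝓡 d) G) : EuclideanSpace ℝ (Fin d) → EuclideanSpace ℝ (Fin d) :=
    mpullbackWithin 𝓘(ℝ, EuclideanSpace ℝ (Fin d)) (𝓡 d) φ.symm (mulInvariantVectorField ζ) (Set.range (𝓡 d))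
  have hV : ∀ ζ, DifferentiableAt ℝ (V ζ) p := by
    intro ζ
    have := (mdifferentiableAt_mulInvariantVectorField (I := 𝓡 d) (G := G) ζ (g := 1)).mdifferentiableWithinAt (s := Set.univ)
    have h2 : DifferentiableWithinAt ℝ (V ζ) (φ.symm ⁻¹' Set.univ ∩ Set.range (𝓡 d)) p :=
      this.differentiableWithinAt_mpullbackWithin_vectorField
    rwa [Set.preimage_univ, Set.univ_inter, ModelWithCorners.range_eq_univ, differentiableWithinAt_univ] at h2
  have hVp : ∀ ζ, V ζ p = ζ := by
    intro ζ
    have h1 := mfderivWithin_extChartAt_symm_inverse_apply (I := 𝓡 d) (x := (1:G)) ζ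
    have h2 : ∀ g : G, g = 1 → (mulInvariantVectorField ζ g : EuclideanSpace ℝ (Fin d)) = ζ := by
      rintro _ rfl
      have h3 : (fun x : G => 1 * x) = id := funext fun x => one_mul x
      have h4 : (mfderiv (𝓡 d) (𝓡 d) (fun x : G => 1 * x) 1 : EuclideanSpace ℝ (Fin d) →L[ℝ] EuclideanSpace ℝ (Fin d))
          = ContinuousLinearMap.id ℝ _ := by
        rw [h3]; exact mfderiv_id
      exact DFunLike.congr_fun h4 ζ
    have h5 : V ζ p = (mfderivWithin 𝓘(ℝ, EuclideanSpace ℝ (Fin d)) (𝓡 d) φ.symm (Set.range (𝓡 d)) p :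
       EuclideanSpace ℝ (Fin d) →L[ℝ] EuclideanSpace ℝ (Fin d)).inverse (mulInvariantVectorField ζ (φ.symm p)) := rfl
    rw [h5, h2 _ hp1]
    exact h1
  have hmul : ContMDiff ((𝓡 d).prod (𝓡 d)) 𝓘(ℝ, ℂ) ∞ (uncurry fun h k : G => f (h * k)) :=
    hf.comp (contMDiff_mul (𝓡 d) ∞)
  have key : ∀ ζ, ((fun h => dOne (fun k => f (h * k)) ζ) ∘ φ.symm) =ᶠ[nhds p]
      fun x => fderiv ℝ (f ∘ φ.symm) x (V ζ x) := by
    intro ζ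
    filter_upwards [extChartAt_target_mem_nhds (I := 𝓡 d) (1:G)] with x hx
    simp only [comp_apply]
    rw [dOne_mul_left f hf]
    have hr : Set.range (𝓡 d) = Set.univ := ModelWithCorners.range_eq_univ _
    have hsx : MDifferentiableAt 𝓘(ℝ, EuclideanSpace ℝ (Fin d)) (𝓡 d) φ.symm x :=
      ((contMDiffOn_extChartAt_symm (I := 𝓡 d) (n := ∞) (1:G)).contMDiffAt
        ((isOpen_extChartAt_target (1:G)).mem_nhds hx)).mdifferentiableAt (by simp)
    have h1 := mfderiv_comp x (hf.mdifferentiableAt (by simp)) hsx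
    have h2 := isInvertible_mfderivWithin_extChartAt_symm (I := 𝓡 d) hx
    rw [hr, mfderivWithin_univ] at h2
    have h3 : V ζ x = (mfderiv 𝓘(ℝ, EuclideanSpace ℝ (Fin d)) (𝓡 d) φ.symm x :
       EuclideanSpace ℝ (Fin d) →L[ℝ] EuclideanSpace ℝ (Fin d)).inverse (mulInvariantVectorField ζ (φ.symm x)) := by
      simp only [V, hr]
      rw [mpullbackWithin_univ]; rfl
    rw [← mfderiv_eq_fderiv, h1, h3]
    have h4 := DFunLike.congr_fun h2.self_comp_inverse (mulInvariantVectorField ζ (φ.symm x))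
    exact (congrArg (mfderiv (𝓡 d) 𝓘(ℝ, ℂ) f (φ.symm x)) h4).symm
  have hfc : ContDiffAt ℝ ∞ (f ∘ φ.symm) p := by
    rw [← contMDiffAt_iff_contDiffAt]
    exact hf.contMDiffAt.comp _ ((contMDiffOn_extChartAt_symm (1:G)).contMDiffAt
      ((isOpen_extChartAt_target (1:G)).mem_nhds (mem_extChartAt_target _)))
  rw [dOne_eq ((smooth_deriv (𝓡 d) _ hmul η).mdifferentiableAt (by simp)),
    dOne_eq ((smooth_deriv (𝓡 d) _ hmul ξ).mdifferentiableAt (by simp)), (key η).fderiv_eq, (key ξ).fderiv_eq]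
  have h1 := fderiv_field_comm (f ∘ φ.symm) p hfc (V ξ) (V η) (hV _) (hV _)
  rw [hVp, hVp] at h1
  refine h1.trans ?_
  rw [dOne_eq (hf.mdifferentiableAt (by simp))]
  have h2 : lieBracket ℝ (V ξ) (V η) p = ⁅ξ, η⁆ := by
    let L : EuclideanSpace ℝ (Fin d) →L[ℝ] EuclideanSpace ℝ (Fin d) :=
      mfderiv (𝓡 d) 𝓘(ℝ, EuclideanSpace ℝ (Fin d)) φ 1
    have hL : L = ContinuousLinearMap.id ℝ _ := mfderiv_extChartAt_self
    have hv : lieBracketWithin ℝ (V ξ) (V η) (φ.symm ⁻¹' Set.univ ∩ Set.range (𝓡 d)) p =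
        lieBracket ℝ (V ξ) (V η) p := by
      rw [Set.preimage_univ, Set.univ_inter, ModelWithCorners.range_eq_univ, lieBracketWithin_univ]
    have h3 : L.inverse
        (lieBracketWithin ℝ (V ξ) (V η) (φ.symm ⁻¹' Set.univ ∩ Set.range (𝓡 d)) p) =
        lieBracket ℝ (V ξ) (V η) p := by
      rw [hL, ContinuousLinearMap.inverse_id, hv]; rfl
    exact h3.symm
  rw [h2]

end

end

noncomputable section
section
variable {d : ℕ} {G : Type*} [TopologicalSpace G]
    [ChartedSpace (EuclideanSpace ℝ (Fin d)) G] [Group G] [LieGroup (𝓡 d) ∞ G]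
 {E' H' M : Type*} [NormedAddCommGroup E'] [NormedSpace ℝ E']
   [TopologicalSpace H'] {J : ModelWithCorners ℝ E' H'} [TopologicalSpace M] [ChartedSpace H' M]

theorem dOne_differentiable {f : G → ℂ} (hf : MDifferentiableAt (𝓡 d) 𝓘(ℝ, ℂ) f 1) :
    DifferentiableAt ℝ (f ∘ (extChartAt (𝓡 d) (1:G)).symm) (extChartAt (𝓡 d) (1:G) 1) := by
  have h : DifferentiableWithinAt ℝ (f ∘ (extChartAt (𝓡 d) (1:G)).symm) (Set.range (𝓡 d))
    (extChartAt (𝓡 d) (1:G) 1) := by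
    have := ((mdifferentiableAt_iff _ _).1 hf).2
    simp only [writtenInExtChartAt, extChartAt_model_space_eq_id, PartialEquiv.refl_coe, id_comp] at this
    exact this
  rw [ModelWithCorners.range_eq_univ] at h
  exact h.differentiableAt Filter.univ_mem

theorem dOne_add' {f k : G → ℂ} (hf : ContMDiff (𝓡 d) 𝓘(ℝ, ℂ) ∞ f) (hk : ContMDiff (𝓡 d) 𝓘(ℝ, ℂ) ∞ k)
    (ξ : GroupLieAlgebra (𝓡 d) G) : dOne (f + k) ξ = dOne f ξ + dOne k ξ := by
  have h1 := hf.mdifferentiableAt (x := 1) (by simp)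
  have h2 := hk.mdifferentiableAt (x := 1) (by simp)
  rw [dOne_eq h1, dOne_eq h2, dOne_eq (h1.add h2)]
  have e1' := dOne_differentiable h1
  have e2' := dOne_differentiable h2
  have := fderiv_add e1' e2'
  exact DFunLike.congr_fun this _

theorem dOne_mul' {f k : G → ℂ} (hf : ContMDiff (𝓡 d) 𝓘(ℝ, ℂ) ∞ f) (hk : ContMDiff (𝓡 d) 𝓘(ℝ, ℂ) ∞ k)
    (ξ : GroupLieAlgebra (𝓡 d) G) : dOne (f * k) ξ = f 1 * dOne k ξ + k 1 * dOne f ξ := by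
  have h1 := hf.mdifferentiableAt (x := 1) (by simp)
  have h2 := hk.mdifferentiableAt (x := 1) (by simp)
  rw [dOne_eq h1, dOne_eq h2, dOne_eq (h1.mul h2)]
  have e1' := dOne_differentiable h1
  have e2' := dOne_differentiable h2
  have := fderiv_mul e1' e2'
  have := DFunLike.congr_fun this (ξ : EuclideanSpace ℝ (Fin d))
  have hp1 : (extChartAt (𝓡 d) (1:G)).symm (extChartAt (𝓡 d) (1:G) 1) = 1 := extChartAt_to_inv _
  simp only [comp_apply, hp1] at this
  exact this

theorem dOne_const (c : ℂ) (ξ : GroupLieAlgebra (𝓡 d) G) : dOne (fun _ : G => c) ξ = 0 := by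
  unfold dOne
  rw [mfderiv_const]
  rfl

theorem dOne_smul_vec (f : G → ℂ) (r : ℝ) (ξ : GroupLieAlgebra (𝓡 d) G) : dOne f (r • ξ) = r • dOne f ξ :=
  (mfderiv (𝓡 d) 𝓘(ℝ, ℂ) f 1).map_smul r ξ

theorem dOne_add_vec (f : G → ℂ) (ξ η : GroupLieAlgebra (𝓡 d) G) : dOne f (ξ + η) = dOne f ξ + dOne f η :=
  (mfderiv (𝓡 d) 𝓘(ℝ, ℂ) f 1).map_add ξ η

variable [IsManifold J 1 M]

theorem smooth_flow {a : M → G → M} (ha : ContMDiff (J.prod (𝓡 d)) J ∞ (uncurry a))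
    (F : smoothFun J M) (m : M) : ContMDiff (𝓡 d) 𝓘(ℝ, ℂ) ∞ (fun h => (F : M → ℂ) (a m h)) :=
  (F.2 : ContMDiff J 𝓘(ℝ, ℂ) ∞ F.1).comp (ha.comp (contMDiff_const.prodMk contMDiff_id))

/-- The derivation `F ↦ (m ↦ d/dt F(a(m, exp(t ξ))))` attached to a smooth family of curves `a`. -/
def flowDer (a : M → G → M) (ha : ContMDiff (J.prod (𝓡 d)) J ∞ (uncurry a)) (h1 : ∀ m, a m 1 = m) :
    GroupLieAlgebra (𝓡 d) G →ₗ[ℝ] Derivation ℂ (smoothFun J M) (smoothFun J M) where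
  toFun ξ := Derivation.mk'
    { toFun := fun F => ⟨fun m => dOne (fun h => F.1 (a m h)) ξ,
        smooth_deriv J _ ((F.2 : ContMDiff J 𝓘(ℝ, ℂ) ∞ F.1).comp ha) ξ⟩
      map_add' := fun F K => Subtype.ext (funext fun m =>
        dOne_add' (smooth_flow ha F m) (smooth_flow ha K m) ξ)
      map_smul' := fun c F => Subtype.ext (funext fun m => by
        have := dOne_mul' (k := fun _ => c) (smooth_flow ha F m) contMDiff_const ξ
        rw [dOne_const, mul_zero, zero_add] at this
        refine Eq.trans ?_ this
        exact congrArg (fun f => dOne f ξ) (funext fun h => mul_comm _ _)) }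
    (fun F K => Subtype.ext (funext fun m => by
      have := dOne_mul' (smooth_flow ha F m) (smooth_flow ha K m) ξ
      rw [h1] at this
      exact this))
  map_add' ξ η := Derivation.ext fun F => Subtype.ext (funext fun m => dOne_add_vec _ ξ η)
  map_smul' r ξ := Derivation.ext fun F => Subtype.ext (funext fun m => dOne_smul_vec _ r ξ)

theorem flowDer_apply {a : M → G → M} (ha : ContMDiff (J.prod (𝓡 d)) J ∞ (uncurry a)) (h1 : ∀ m, a m 1 = m)
    (ξ : GroupLieAlgebra (𝓡 d) G) (F : smoothFun J M) (m : M) :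
    (flowDer a ha h1 ξ F).1 m = dOne (fun h => F.1 (a m h)) ξ := rfl

theorem flowDer_lie {a : M → G → M} (ha : ContMDiff (J.prod (𝓡 d)) J ∞ (uncurry a)) (h1 : ∀ m, a m 1 = m)
    (hmul : ∀ m h k, a (a m h) k = a m (h * k)) (ξ η : GroupLieAlgebra (𝓡 d) G) :
    flowDer a ha h1 ⁅ξ, η⁆ = ⁅flowDer a ha h1 ξ, flowDer a ha h1 η⁆ := by
  refine Derivation.ext fun F => Subtype.ext (funext fun m => ?_)
  rw [Derivation.commutator_apply]
  have := dOne_bracket (fun h => F.1 (a m h)) (smooth_flow ha F m) ξ η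
  refine this.symm.trans ?_
  simp only [← hmul]
  rfl

theorem flowDer_comm {a b : M → G → M} (ha : ContMDiff (J.prod (𝓡 d)) J ∞ (uncurry a)) (ha1 : ∀ m, a m 1 = m)
    (hb : ContMDiff (J.prod (𝓡 d)) J ∞ (uncurry b)) (hb1 : ∀ m, b m 1 = m)
    (hab : ∀ m h k, b (a m h) k = a (b m k) h) (ξ η : GroupLieAlgebra (𝓡 d) G) :
    ⁅flowDer a ha ha1 ξ, flowDer b hb hb1 η⁆ = 0 := by
  refine Derivation.ext fun F => Subtype.ext (funext fun m => ?_)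
  rw [Derivation.commutator_apply]
  refine sub_eq_zero.2 ?_
  have hs : ContMDiff ((𝓡 d).prod (𝓡 d)) 𝓘(ℝ, ℂ) ∞ (uncurry fun h k => F.1 (b (a m h) k)) :=
    (F.2 : ContMDiff J 𝓘(ℝ, ℂ) ∞ F.1).comp (hb.comp
      ((ha.comp (contMDiff_const.prodMk contMDiff_fst)).prodMk contMDiff_snd))
  have := dOne_comm (fun h k => F.1 (b (a m h) k)) hs ξ η
  refine this.trans ?_
  simp only [hab]
  rfl
end
end

noncomputable section Smash
variable {R C L : Type*} [CommRing R] [CommRing C] [Algebra R C] [LieRing L] [LieAlgebra R L]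

attribute [local instance 100] LieRing.ofAssociativeRing

theorem uea_induction (S : Subalgebra R (UniversalEnvelopingAlgebra R L))
    (h : ∀ x, UniversalEnvelopingAlgebra.ι R x ∈ S) (θ : UniversalEnvelopingAlgebra R L) : θ ∈ S := by
  let f : L →ₗ⁅R⁆ S :=
    { toFun := fun x => ⟨UniversalEnvelopingAlgebra.ι R x, h x⟩
      map_add' := fun x y => Subtype.ext (map_add _ x y)
      map_smul' := fun c x => Subtype.ext (map_smul _ c x)
      map_lie' := fun {x y} => Subtype.ext (LieHom.map_lie _ x y) }
  have h1 : S.val.comp (UniversalEnvelopingAlgebra.lift R f) = AlgHom.id R _ := by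
    apply UniversalEnvelopingAlgebra.hom_ext
    ext x
    simp [f]
  have h2 := DFunLike.congr_fun h1 θ
  simp only [AlgHom.comp_apply, AlgHom.id_apply] at h2
  rw [← h2]
  exact Subtype.property _

/-- Left multiplication by `1 ⊗ F`: `θ ⊗ K ↦ θ ⊗ F K`. -/
def opFun : C →ₐ[R] Module.End R (UniversalEnvelopingAlgebra R L ⊗[R] C) where
  toFun F := LinearMap.lTensor (UniversalEnvelopingAlgebra R L) (LinearMap.mulLeft R F)
  map_one' := by
    apply TensorProduct.ext'
    intro x y
    simp
  map_mul' F K := by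
    apply TensorProduct.ext'
    intro x y
    simp
  map_zero' := by
    apply TensorProduct.ext'
    intro x y
    simp
  map_add' F K := by
    apply TensorProduct.ext'
    intro x y
    simp [add_mul, TensorProduct.tmul_add]
  commutes' r := by
    apply TensorProduct.ext'
    intro x y
    simp [Algebra.algebraMap_eq_smul_one]

variable (δ : L →ₗ⁅R⁆ Derivation R C C)

/-- Left multiplication by `ξ ⊗ 1`, `ξ ∈ L`: `θ ⊗ K ↦ ξ θ ⊗ K + θ ⊗ δ(ξ) K`. -/
def opLie : L →ₗ⁅R⁆ Module.End R (UniversalEnvelopingAlgebra R L ⊗[R] C) where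
  toFun ξ := LinearMap.rTensor C (LinearMap.mulLeft R (UniversalEnvelopingAlgebra.ι R ξ)) +
    LinearMap.lTensor (UniversalEnvelopingAlgebra R L) (δ ξ : C →ₗ[R] C)
  map_add' ξ η := by
    apply TensorProduct.ext'
    intro θ F
    simp [add_mul, TensorProduct.add_tmul]
    abel
  map_smul' c ξ := by
    apply TensorProduct.ext'
    intro θ F
    simp [TensorProduct.smul_tmul']
  map_lie' {ξ η} := by
    apply TensorProduct.ext'
    intro θ F
    rw [LieRing.of_associative_ring_bracket]
    simp only [LinearMap.add_apply, LinearMap.sub_apply, Module.End.mul_apply,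
      LinearMap.rTensor_tmul, LinearMap.lTensor_tmul, map_add, LinearMap.mulLeft_apply,
      LieHom.map_lie, Derivation.coeFn_coe, Derivation.commutator_apply,
      LieRing.of_associative_ring_bracket, sub_mul, TensorProduct.sub_tmul,
      TensorProduct.tmul_sub, mul_assoc]
    abel

/-- Left multiplication by `θ ⊗ 1`, `θ ∈ U(L)`. -/
def opU : UniversalEnvelopingAlgebra R L →ₐ[R] Module.End R (UniversalEnvelopingAlgebra R L ⊗[R] C) :=
  UniversalEnvelopingAlgebra.lift R (opLie δ)

theorem opU_ι (ξ : L) : opU δ (UniversalEnvelopingAlgebra.ι R ξ) = opLie δ ξ :=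
  UniversalEnvelopingAlgebra.lift_ι_apply _ _ _

theorem opLie_tmul (ξ : L) (θ : UniversalEnvelopingAlgebra R L) (F : C) :
    opLie δ ξ (θ ⊗ₜ F) = (UniversalEnvelopingAlgebra.ι R ξ * θ) ⊗ₜ F + θ ⊗ₜ δ ξ F := rfl

theorem opFun_tmul (K : C) (θ : UniversalEnvelopingAlgebra R L) (F : C) :
    opFun K (θ ⊗ₜ[R] F) = θ ⊗ₜ (K * F) := rfl

/-- `(θ ⊗ F) · z = (1 ⊗ F) · (θ · z)`. -/
def smashMul : (UniversalEnvelopingAlgebra R L ⊗[R] C) →ₗ[R]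
    Module.End R (UniversalEnvelopingAlgebra R L ⊗[R] C) :=
  TensorProduct.lift ((LinearMap.mul R (Module.End R (UniversalEnvelopingAlgebra R L ⊗[R] C))).flip.compl₁₂
    (opU δ).toLinearMap opFun.toLinearMap)

theorem smashMul_tmul (θ : UniversalEnvelopingAlgebra R L) (F : C) :
    smashMul δ (θ ⊗ₜ F) = opFun F * opU δ θ := by simp [smashMul]

theorem opLie_mul_opFun (ξ : L) (F : C) :
    opLie δ ξ * opFun F = opFun F * opLie δ ξ + opFun (δ ξ F) := by
  apply TensorProduct.ext'
  intro θ K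
  simp only [Module.End.mul_apply, LinearMap.add_apply, opFun_tmul, opLie_tmul, map_add,
    Derivation.leibniz, TensorProduct.tmul_add, smul_eq_mul]
  rw [mul_comm K]
  abel

theorem smashMul_opFun (F : C) (z : UniversalEnvelopingAlgebra R L ⊗[R] C) :
    smashMul δ (opFun F z) = opFun F * smashMul δ z := by
  induction z with
  | zero => simp
  | add a b ha hb => simp only [map_add, mul_add, ha, hb]
  | tmul θ K => rw [opFun_tmul, smashMul_tmul, smashMul_tmul, map_mul, mul_assoc]

theorem smashMul_opLie (ξ : L) (z : UniversalEnvelopingAlgebra R L ⊗[R] C) :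
    smashMul δ (opLie δ ξ z) = opLie δ ξ * smashMul δ z := by
  induction z with
  | zero => simp
  | add a b ha hb => simp only [map_add, mul_add, ha, hb]
  | tmul θ K =>
    rw [opLie_tmul, map_add, smashMul_tmul, smashMul_tmul, smashMul_tmul, map_mul, opU_ι,
      ← mul_assoc (opLie δ ξ), opLie_mul_opFun, add_mul, mul_assoc]

theorem smashMul_opU (θ : UniversalEnvelopingAlgebra R L) : ∀ z : UniversalEnvelopingAlgebra R L ⊗[R] C,
    smashMul δ (opU δ θ z) = opU δ θ * smashMul δ z := by
  let S : Subalgebra R (UniversalEnvelopingAlgebra R L) :=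
    { carrier := {θ | ∀ z, smashMul δ (opU δ θ z) = opU δ θ * smashMul δ z}
      mul_mem' := fun {a b} ha hb z => by rw [map_mul, Module.End.mul_apply, ha, hb, mul_assoc]
      add_mem' := fun {a b} ha hb z => by
        rw [map_add, LinearMap.add_apply, map_add, ha, hb, add_mul]
      algebraMap_mem' := fun r z => by
        rw [AlgHom.commutes, Module.algebraMap_end_apply, map_smul, Algebra.algebraMap_eq_smul_one,
          smul_mul_assoc, one_mul] }
  exact uea_induction S (fun x z => by rw [opU_ι, smashMul_opLie]) θ

theorem smashMul_assoc (a b c : UniversalEnvelopingAlgebra R L ⊗[R] C) :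
    smashMul δ (smashMul δ a b) c = smashMul δ a (smashMul δ b c) := by
  suffices smashMul δ (smashMul δ a b) = smashMul δ a * smashMul δ b from LinearMap.congr_fun this c
  induction a with
  | zero => simp
  | add a b ha hb => simp only [map_add, LinearMap.add_apply, ha, hb, add_mul]
  | tmul θ F =>
    rw [smashMul_tmul, Module.End.mul_apply, smashMul_opFun, smashMul_opU, mul_assoc]

theorem smashMul_one_left (z : UniversalEnvelopingAlgebra R L ⊗[R] C) :
    smashMul δ (1 ⊗ₜ 1) z = z := by
  simp [smashMul_tmul]

theorem smashMul_one_right (z : UniversalEnvelopingAlgebra R L ⊗[R] C) :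
    smashMul δ z (1 ⊗ₜ 1) = z := by
  have key : ∀ θ : UniversalEnvelopingAlgebra R L, ∀ η : UniversalEnvelopingAlgebra R L,
      opU δ θ (η ⊗ₜ[R] (1 : C)) = (θ * η) ⊗ₜ 1 := by
    intro θ
    let S : Subalgebra R (UniversalEnvelopingAlgebra R L) :=
      { carrier := {θ | ∀ η, opU δ θ (η ⊗ₜ[R] (1 : C)) = (θ * η) ⊗ₜ 1}
        mul_mem' := fun {a b} ha hb z => by rw [map_mul, Module.End.mul_apply, hb, ha, mul_assoc]
        add_mem' := fun {a b} ha hb z => by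
          rw [map_add, LinearMap.add_apply, ha, hb, add_mul, TensorProduct.add_tmul]
        algebraMap_mem' := fun r z => by
          rw [AlgHom.commutes, Module.algebraMap_end_apply, Algebra.algebraMap_eq_smul_one,
            smul_mul_assoc, one_mul, TensorProduct.smul_tmul'] }
    exact uea_induction S (fun x z => by
      rw [opU_ι, opLie_tmul, Derivation.map_one_eq_zero, TensorProduct.tmul_zero, add_zero]) θ
  induction z with
  | zero => simp
  | add a b ha hb => rw [map_add, LinearMap.add_apply, ha, hb]
  | tmul θ F => rw [smashMul_tmul, Module.End.mul_apply, key, opFun_tmul, mul_one, mul_one]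

/-- The semidirect (smash) product of the universal enveloping algebra of `L` with a commutative
algebra `C` on which `L` acts by derivations `δ`: the vector space `U(L) ⊗ C`. -/
def SmashProduct (_δ : L →ₗ⁅R⁆ Derivation R C C) : Type _ := UniversalEnvelopingAlgebra R L ⊗[R] C

namespace SmashProduct

instance : AddCommGroup (SmashProduct δ) :=
  inferInstanceAs (AddCommGroup (UniversalEnvelopingAlgebra R L ⊗[R] C))

instance : Module R (SmashProduct δ) :=
  inferInstanceAs (Module R (UniversalEnvelopingAlgebra R L ⊗[R] C))

/-- The element `θ ⊗ F`, linear in both factors. -/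
def mk : UniversalEnvelopingAlgebra R L →ₗ[R] C →ₗ[R] SmashProduct δ :=
  TensorProduct.mk R (UniversalEnvelopingAlgebra R L) C

/-- The multiplication is determined by `(θ ⊗ F) · z = (1 ⊗ F) · (θ · z)`, where `1 ⊗ F` acts from
the left by `θ ⊗ K ↦ θ ⊗ F K` and `ξ ∈ L` by `θ ⊗ K ↦ ξ θ ⊗ K + θ ⊗ δ(ξ) K`. -/
instance : Ring (SmashProduct δ) :=
  { (inferInstance : AddCommGroup (SmashProduct δ)) with
    mul := fun a b => smashMul δ a b
    one := mk δ 1 1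
    mul_assoc := smashMul_assoc δ
    one_mul := smashMul_one_left δ
    mul_one := smashMul_one_right δ
    left_distrib := fun a b c => (smashMul δ a).map_add b c
    right_distrib := fun a b c => LinearMap.congr_fun ((smashMul δ).map_add a b) c
    zero_mul := fun a => LinearMap.congr_fun ((smashMul δ).map_zero) a
    mul_zero := fun a => (smashMul δ a).map_zero }

instance : Algebra R (SmashProduct δ) :=
  Algebra.ofModule (fun r a b => LinearMap.congr_fun ((smashMul δ).map_smul r a) b)
    (fun r a b => (smashMul δ a).map_smul r b)

/-- `(ξ ⊗ F)(η ⊗ K) = ξ η ⊗ F K + η ⊗ F δ(ξ) K` for `ξ ∈ L`. -/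
theorem mk_mul_mk (ξ : L) (η : UniversalEnvelopingAlgebra R L) (F K : C) :
    mk δ (UniversalEnvelopingAlgebra.ι R ξ) F * mk δ η K =
      mk δ (UniversalEnvelopingAlgebra.ι R ξ * η) (F * K) + mk δ η (F * δ ξ K) := by
  change smashMul δ (UniversalEnvelopingAlgebra.ι R ξ ⊗ₜ[R] F) (η ⊗ₜ[R] K) =
    (UniversalEnvelopingAlgebra.ι R ξ * η) ⊗ₜ[R] (F * K) + η ⊗ₜ[R] (F * δ ξ K)
  rw [smashMul_tmul, opU_ι, Module.End.mul_apply, opLie_tmul, map_add, opFun_tmul, opFun_tmul]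

end SmashProduct
end Smash

noncomputable section
section
variable {ι K C : Type*} [LieRing K] [LieAlgebra ℂ K] [CommRing C] [Algebra ℂ C]

/-- The Lie algebra `⊕ K` (one copy of `K` for each index) whose bracket is `iħ` times
the Poisson bracket `{ξ, η} = -[ξ, η]`. -/
@[nolint unusedArguments]
def QLie (ι K : Type*) [LieRing K] [LieAlgebra ℂ K] (_ħ : ℝ) : Type _ := ι → K

namespace QLie
variable (ħ : ℝ)

instance : AddCommGroup (QLie ι K ħ) := inferInstanceAs (AddCommGroup (ι → K))

instance : Module ℂ (QLie ι K ħ) := inferInstanceAs (Module ℂ (ι → K))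

/-- The bracket of one summand. -/
def br (x y : K) : K := (Complex.I * ħ) • -⁅x, y⁆

instance : LieRing (QLie ι K ħ) where
  bracket x y := fun X => br ħ (x X) (y X)
  add_lie x y z := funext fun X => by
    change br ħ (x X + y X) (z X) = br ħ (x X) (z X) + br ħ (y X) (z X)
    simp only [br, add_lie, neg_add, smul_add]
  lie_add x y z := funext fun X => by
    change br ħ (x X) (y X + z X) = br ħ (x X) (y X) + br ħ (x X) (z X)
    simp only [br, lie_add, neg_add, smul_add]
  lie_self x := funext fun X => by
    change br ħ (x X) (x X) = 0
    simp only [br, lie_self, neg_zero, smul_zero]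
  leibniz_lie x y z := funext fun X => by
    change br ħ (x X) (br ħ (y X) (z X)) =
      br ħ (br ħ (x X) (y X)) (z X) + br ħ (y X) (br ħ (x X) (z X))
    simp only [br, lie_smul, smul_lie, lie_neg, neg_lie, neg_neg, smul_neg]
    rw [leibniz_lie (x X), smul_add, smul_add]

instance : LieAlgebra ℂ (QLie ι K ħ) where
  lie_smul c x y := funext fun X => by
    change br ħ (x X) (c • y X) = c • br ħ (x X) (y X)
    simp only [br, lie_smul]
    rw [← smul_neg, smul_comm]

theorem lie_apply (x y : QLie ι K ħ) (X : ι) :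
    ⁅x, y⁆ X = (Complex.I * ħ) • -⁅(x X : K), (y X : K)⁆ := rfl

/-- The element `ξ` of the copy of `K` labelled by `X`. -/
def single [DecidableEq ι] (X : ι) (ξ : K) : QLie ι K ħ := fun Y => if Y = X then ξ else 0

variable [Fintype ι] (D : ι → K →ₗ[ℂ] Derivation ℂ C C)

/-- The derivations `F ↦ iħ {ξ, F}` with `{ξ, F} = -D(ξ) F`, for commuting actions `D X` of the
summands. -/
def der (h1 : ∀ X ξ η, D X ⁅ξ, η⁆ = ⁅D X ξ, D X η⁆)
    (h2 : ∀ X Y, X ≠ Y → ∀ ξ η, ⁅D X ξ, D Y η⁆ = 0) : QLie ι K ħ →ₗ⁅ℂ⁆ Derivation ℂ C C where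
  toFun x := (Complex.I * ħ) • -∑ X, D X (x X)
  map_add' x y := by
    rw [← smul_add, ← neg_add, ← Finset.sum_add_distrib]
    congr 2
    exact Finset.sum_congr rfl fun X _ => (D X).map_add (x X) (y X)
  map_smul' c x := by
    rw [RingHom.id_apply, smul_comm c, smul_neg c, Finset.smul_sum]
    congr 2
    exact Finset.sum_congr rfl fun X _ => (D X).map_smul c (x X)
  map_lie' {x y} := by
    have h3 : ∑ X, D X ⁅(x X : K), (y X : K)⁆ =
        ⁅∑ X, D X (x X), ∑ X, D X (y X)⁆ := by
      rw [sum_lie]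
      refine Finset.sum_congr rfl fun X _ => ?_
      rw [lie_sum, Finset.sum_eq_single X, h1]
      · exact fun Y _ hY => h2 X Y hY.symm _ _
      · exact fun h => absurd (Finset.mem_univ _) h
    rw [smul_lie, lie_smul, neg_lie, lie_neg, neg_neg, ← h3]
    congr 1
    rw [Finset.smul_sum, ← Finset.sum_neg_distrib]
    refine Finset.sum_congr rfl fun X _ => ?_
    rw [lie_apply, map_smul, map_neg, smul_neg, neg_neg]

end QLie
end
end

section
variable {L C : Type*} [LieRing L] [LieAlgebra ℝ L] [CommRing C] [Algebra ℂ C]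

theorem baseChange_lie (E : L →ₗ[ℝ] Derivation ℂ C C) (h : ∀ ξ η, E ⁅ξ, η⁆ = ⁅E ξ, E η⁆)
    (s t : ℂ ⊗[ℝ] L) : E.liftBaseChange ℂ ⁅s, t⁆ = ⁅E.liftBaseChange ℂ s, E.liftBaseChange ℂ t⁆ := by
  induction s with
  | zero => rw [map_zero, zero_lie, zero_lie, map_zero]
  | add a b ha hb => rw [add_lie, map_add, ha, hb, map_add, add_lie]
  | tmul c ξ =>
    induction t with
    | zero =>
      rw [map_zero, lie_zero]
      exact (congrArg (E.liftBaseChange ℂ)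
        (lie_zero (L := ℂ ⊗[ℝ] L) (M := ℂ ⊗[ℝ] L) (c ⊗ₜ[ℝ] ξ))).trans (LinearMap.map_zero _)
    | add a b ha hb => rw [LieRing.lie_add, map_add, ha, hb, map_add, lie_add]
    | tmul e η =>
      rw [LieAlgebra.ExtendScalars.bracket_tmul]
      simp only [LinearMap.liftBaseChange_tmul, smul_lie, lie_smul, mul_smul, h]
      exact smul_comm _ _ _

theorem baseChange_comm (E E' : L →ₗ[ℝ] Derivation ℂ C C) (h : ∀ ξ η, ⁅E ξ, E' η⁆ = 0)
    (s t : ℂ ⊗[ℝ] L) : ⁅E.liftBaseChange ℂ s, E'.liftBaseChange ℂ t⁆ = 0 := by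
  induction s with
  | zero => simp
  | add a b ha hb => simp only [add_lie, map_add, ha, hb, add_zero]
  | tmul c ξ =>
    induction t with
    | zero => simp
    | add a b ha hb => simp only [lie_add, map_add, ha, hb, add_zero]
    | tmul e η => simp only [LinearMap.liftBaseChange_tmul, smul_lie, lie_smul, h, smul_zero]
end

/-- The loops `m₁,…,mₙ` around the punctures and `aᵢ, bᵢ` around the handles. -/
inductive Loop (n g : ℕ)
  | M (i : Fin n)
  | A (i : Fin g)
  | B (i : Fin g)
  deriving DecidableEq, Fintype

noncomputable section
section
variable {d : ℕ} {G : Type*} [TopologicalSpace G]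
    [ChartedSpace (EuclideanSpace ℝ (Fin d)) G] [Group G] [LieGroup (𝓡 d) ∞ G] {n g : ℕ}

/-- The product manifold structure on `G^(n+2g)`. -/
abbrev powModel (d n g : ℕ) := ModelWithCorners.pi fun _ : Loop n g => 𝓡 d

instance isManifold_pow_one : IsManifold (powModel d n g) 1 (Loop n g → G) :=
  IsManifold.of_le (n := ∞) ENat.LEInfty.out

/-- `C^∞(G^(n+2g), ℂ)`. -/
def CoeffAlg (d : ℕ) (G : Type*) [TopologicalSpace G] [ChartedSpace (EuclideanSpace ℝ (Fin d)) G]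
    (n g : ℕ) : Type _ := smoothFun (powModel d n g) (Loop n g → G)

instance : CommRing (CoeffAlg d G n g) :=
  inferInstanceAs (CommRing (smoothFun (powModel d n g) (Loop n g → G)))

instance : Algebra ℂ (CoeffAlg d G n g) :=
  inferInstanceAs (Algebra ℂ (smoothFun (powModel d n g) (Loop n g → G)))

theorem contMDiff_piMfd {E' H' N : Type*} [NormedAddCommGroup E'] [NormedSpace ℝ E']
   [TopologicalSpace H'] {J : ModelWithCorners ℝ E' H'} [TopologicalSpace N] [ChartedSpace H' N]
   (f : N → Loop n g → G) :
   ContMDiff J (powModel d n g) ∞ f ↔ ∀ X, ContMDiff J (𝓡 d) ∞ (fun y => f y X) :=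
  ⟨fun h X x => (contMDiffAt_piMfd f x).1 (h x) X, fun h x => (contMDiffAt_piMfd f x).2 fun X => h X x⟩

theorem contMDiff_coord (X : Loop n g) :
    ContMDiff (powModel d n g) (𝓡 d) ∞ (fun u : Loop n g → G => u X) :=
  (contMDiff_piMfd (J := powModel d n g) (N := Loop n g → G) id).1 contMDiff_id X

/-- The right action of the copy of `G` labelled by `X` on `G^(n+2g)` in the decoupled flower
algebra: conjugation for a puncture, and `(u_A, u_B) ↦ (u_A h, u_A h u_A⁻¹ u_B)`, respectively
`(u_A, u_B) ↦ (u_A, u_B h)`, for a handle. -/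
def slotAct : Loop n g → (Loop n g → G) → G → Loop n g → G
  | .M i, u, h => fun Y => if Y = .M i then h⁻¹ * u (.M i) * h else u Y
  | .A i, u, h => fun Y => if Y = .A i then u (.A i) * h else
      if Y = .B i then u (.A i) * h * (u (.A i))⁻¹ * u (.B i) else u Y
  | .B i, u, h => fun Y => if Y = .B i then u (.B i) * h else u Y

theorem slotAct_one (X : Loop n g) (u : Loop n g → G) : slotAct X u 1 = u := by
  funext Y
  cases X <;> simp only [slotAct] <;> split_ifs <;> simp_all

theorem slotAct_mul (X : Loop n g) (u : Loop n g → G) (h k : G) :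
    slotAct X (slotAct X u h) k = slotAct X u (h * k) := by
  funext Y
  cases X <;> simp only [slotAct] <;> split_ifs <;> simp_all [mul_assoc]

theorem slotAct_comm {X X' : Loop n g} (hX : X ≠ X') (u : Loop n g → G) (h k : G) :
    slotAct X' (slotAct X u h) k = slotAct X (slotAct X' u k) h := by
  funext Y
  cases X <;> cases X' <;> cases Y <;>
    simp only [slotAct, Loop.M.injEq, Loop.A.injEq, Loop.B.injEq, reduceCtorEq, if_false, ne_eq,
      not_false_eq_true] at hX ⊢ <;>
    grind

theorem slotAct_smooth (X : Loop n g) :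
    ContMDiff ((powModel d n g).prod (𝓡 d)) (powModel d n g) ∞
      (uncurry (slotAct (G := G) X)) := by
  have hc : ∀ Y : Loop n g, ContMDiff ((powModel d n g).prod (𝓡 d)) (𝓡 d) ∞
      (fun p : (Loop n g → G) × G => p.1 Y) := fun Y => (contMDiff_coord Y).comp contMDiff_fst
  have hs : ContMDiff ((powModel d n g).prod (𝓡 d)) (𝓡 d) ∞
      (fun p : (Loop n g → G) × G => p.2) := contMDiff_snd
  rw [contMDiff_piMfd]
  intro Y
  cases X with
  | M i =>
    by_cases h : Y = .M i
    · exact ((hs.inv.mul (hc (.M i))).mul hs).congr fun p => by simp [uncurry, slotAct, h]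
    · exact (hc Y).congr fun p => by simp [uncurry, slotAct, h]
  | A i =>
    by_cases h : Y = .A i
    · exact ((hc (.A i)).mul hs).congr fun p => by simp [uncurry, slotAct, h]
    · by_cases h' : Y = .B i
      · exact ((((hc (.A i)).mul hs).mul (hc (.A i)).inv).mul (hc (.B i))).congr fun p => by
          simp [uncurry, slotAct, h']
      · exact (hc Y).congr fun p => by simp [uncurry, slotAct, h, h']
  | B i =>
    by_cases h : Y = .B i
    · exact ((hc (.B i)).mul hs).congr fun p => by simp [uncurry, slotAct, h]
    · exact (hc Y).congr fun p => by simp [uncurry, slotAct, h]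

/-- The infinitesimal action `F ↦ d/dt F(u · exp(t ξ))` of the copy of the Lie algebra labelled
by `X`. -/
def slotDer (X : Loop n g) :
    GroupLieAlgebra (𝓡 d) G →ₗ[ℝ] Derivation ℂ (CoeffAlg d G n g) (CoeffAlg d G n g) :=
  flowDer (slotAct X) (slotAct_smooth X) (slotAct_one X)

end
end

attribute [local instance 100] LieRing.ofAssociativeRing

noncomputable section
section
variable {d : ℕ} {G : Type*} [TopologicalSpace G]
    [ChartedSpace (EuclideanSpace ℝ (Fin d)) G] [Group G] [LieGroup (𝓡 d) ∞ G] {n g : ℕ}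

/-! Functions on `G^(n+2g)` -/

/-- Smooth `G`-valued functions on `G^(n+2g)`. -/
abbrev Word (d : ℕ) (G : Type*) [TopologicalSpace G] [ChartedSpace (EuclideanSpace ℝ (Fin d)) G]
    (n g : ℕ) := ContMDiffMap (powModel d n g) (𝓡 d) (Loop n g → G) G ∞

/-- The coordinate function `u_X`. -/
def hol (X : Loop n g) : Word d G n g := ⟨fun u => u X, contMDiff_coord X⟩

/-- `u_{K_i} = u_{B_i} u_{A_i}⁻¹ u_{B_i}⁻¹ u_{A_i}`. -/
def holK (i : Fin g) : Word d G n g := hol (.B i) * (hol (.A i))⁻¹ * (hol (.B i))⁻¹ * hol (.A i)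

/-- `w_{k-1} ⋯ w_l`, the product over the indices `l ≤ m < k` in decreasing order. -/
def descProd {Γ : Type*} [Monoid Γ] {N : ℕ} (w : Fin N → Γ) (k l : ℕ) : Γ :=
  (((List.finRange N).reverse.filter fun m => l ≤ m.1 ∧ m.1 < k).map w).prod

/-- The adjoint action of `G` on its Lie algebra: the derivative at `1` of `h ↦ w h w⁻¹`. -/
def Ad (w : G) (ξ : GroupLieAlgebra (𝓡 d) G) : EuclideanSpace ℝ (Fin d) :=
  mfderiv (𝓡 d) (𝓡 d) (fun h : G => w * h * w⁻¹) 1 ξ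

end

section
variable {d : ℕ} {G : Type*} [TopologicalSpace G]
    [ChartedSpace (EuclideanSpace ℝ (Fin d)) G] [Group G] [LieGroup (𝓡 d) ∞ G] {n g : ℕ}
    (b : Module.Basis (Fin d) ℝ (GroupLieAlgebra (𝓡 d) G))

/-- The matrix elements `Ad*(w)_a^c = ⟨P^c, Ad(w) J_a⟩` of a word `w`, as functions on
`G^(n+2g)`, where `J_a` is the basis `b` and `P^c` the dual basis. -/
def adStar (w : Word d G n g) : Matrix (Fin d) (Fin d) (CoeffAlg d G n g) :=
  Matrix.of fun a c => ⟨fun u => ((b.coord c (Ad (w u) (b a)) : ℝ) : ℂ), by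
    have h1 := smooth_derivG (G := G) (powModel d n g)
      (fun u : Loop n g → G => fun h : G => w u * h * (w u)⁻¹) (by
        have hw : ContMDiff ((powModel d n g).prod (𝓡 d)) (𝓡 d) ∞
            (fun p : (Loop n g → G) × G => w p.1) := w.contMDiff.comp contMDiff_fst
        exact (hw.mul contMDiff_snd).mul hw.inv) (fun u => by simp) (b a)
    let l : EuclideanSpace ℝ (Fin d) →ₗ[ℝ] ℝ := b.coord c
    have h2 : ContDiff ℝ ∞ fun v => ((l v : ℝ) : ℂ) :=
      Complex.ofRealCLM.contDiff.comp (LinearMap.toContinuousLinearMap l).contDiff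
    exact h2.contMDiff.comp h1⟩

/-- The structure constants `[J_a, J_b] = f_ab^c J_c`. -/
def structConst (a a' c : Fin d) : ℝ := b.coord c ⁅b a, b a'⁆

theorem updR_smooth (X : Loop n g) :
    ContMDiff ((powModel d n g).prod (𝓡 d)) (powModel d n g) ∞
      (uncurry fun (u : Loop n g → G) (h : G) => update u X (u X * h)) := by
  rw [contMDiff_piMfd]
  intro Y
  by_cases h : Y = X
  · subst h
    exact (((contMDiff_coord Y).comp contMDiff_fst).mul contMDiff_snd).congr fun p => by
      simp [uncurry]
  · exact ((contMDiff_coord Y).comp contMDiff_fst).congr fun p => by simp [uncurry, h]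

theorem updL_smooth (X : Loop n g) :
    ContMDiff ((powModel d n g).prod (𝓡 d)) (powModel d n g) ∞
      (uncurry fun (u : Loop n g → G) (h : G) => update u X (h⁻¹ * u X)) := by
  rw [contMDiff_piMfd]
  intro Y
  by_cases h : Y = X
  · subst h
    exact (contMDiff_snd.inv.mul ((contMDiff_coord Y).comp contMDiff_fst)).congr fun p => by
      simp [uncurry]
  · exact ((contMDiff_coord Y).comp contMDiff_fst).congr fun p => by simp [uncurry, h]

/-- The left-invariant vector field `J^R_a F = d/dt F(…, u_X exp(t J_a), …)`. -/
def vecR (X : Loop n g) (a : Fin d) : Derivation ℂ (CoeffAlg d G n g) (CoeffAlg d G n g) :=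
  flowDer (fun u h => update u X (u X * h)) (updR_smooth X) (fun u => by simp) (b a)

/-- The right-invariant vector field `J^L_a F = d/dt F(…, exp(-t J_a) u_X, …)`. -/
def vecL (X : Loop n g) (a : Fin d) : Derivation ℂ (CoeffAlg d G n g) (CoeffAlg d G n g) :=
  flowDer (fun u h => update u X (h⁻¹ * u X)) (updL_smooth X) (fun u => by simp) (b a)

variable (d G n g) in
/-- The complexified commutative algebra `S(⊕ 𝔤) ⊗ C^∞(G^(n+2g))` as the algebra of polynomials in
the generators `j_a^X` with coefficients in `C^∞(G^(n+2g), ℂ)`. -/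
abbrev Flower := MvPolynomial (Loop n g × Fin d) (CoeffAlg d G n g)

variable (d G n g) in
/-- The part `𝓕^(0) ⊕ 𝓕^(1)` of degree at most one in the generators. -/
def Flower01 : Submodule (CoeffAlg d G n g) (Flower d G n g) :=
  MvPolynomial.homogeneousSubmodule _ _ 0 ⊔ MvPolynomial.homogeneousSubmodule _ _ 1

instance : AddCommGroup (Flower01 d G n g) := Submodule.addCommGroup _

instance : Module (CoeffAlg d G n g) (Flower01 d G n g) := Submodule.module _

instance : Module ℂ (Flower01 d G n g) := Submodule.module' _

/-- The generator `j_a^X ⊗ 1`. -/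
def gen (X : Loop n g) (a : Fin d) : Flower01 d G n g :=
  ⟨MvPolynomial.X (X, a), Submodule.mem_sup_right (MvPolynomial.isHomogeneous_X _ _)⟩

/-- The element `1 ⊗ F`. -/
def fn (F : CoeffAlg d G n g) : Flower01 d G n g :=
  ⟨MvPolynomial.C F, Submodule.mem_sup_left (MvPolynomial.isHomogeneous_C _ _)⟩

theorem flower01_induction {p : Flower d G n g → Prop} (hC : ∀ F, p (MvPolynomial.C F))
    (hX : ∀ (F : CoeffAlg d G n g) x, p (F • MvPolynomial.X x)) (hadd : ∀ P P', p P → p P' → p (P + P'))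
    (P : Flower d G n g) (hP : P ∈ Flower01 d G n g) : p P := by
  obtain ⟨P0, h0, P1, h1, rfl⟩ := Submodule.mem_sup.1 hP
  refine hadd _ _ ?_ ?_
  · rw [MvPolynomial.homogeneousSubmodule_zero] at h0
    obtain ⟨F, rfl⟩ := Submodule.mem_one.1 h0
    exact hC F
  · rw [MvPolynomial.homogeneousSubmodule_one_eq_span_X] at h1
    clear hP
    induction h1 using Submodule.closure_induction with
    | zero => simpa using hC 0
    | add x y _ _ hx hy => exact hadd _ _ hx hy
    | smul_mem r x hx =>
      obtain ⟨y, rfl⟩ := hx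
      exact hX r y

/-- Multiplication of an index vector by a matrix of functions: `(m v)_a = m_a^c v_c`. -/
def ixAct (m : Matrix (Fin d) (Fin d) (CoeffAlg d G n g)) (v : Fin d → Flower01 d G n g)
    (a : Fin d) : Flower01 d G n g := ∑ c, m a c • v c

/-- `j_a^{H_i}`. -/
def genH (i : Fin g) : Fin d → Flower01 d G n g :=
  let A : Word d G n g := hol (.A i)
  let B : Word d G n g := hol (.B i)
  ixAct (1 - adStar b (A⁻¹ * B⁻¹ * A)) (gen (.A i)) +
    ixAct (adStar b (A⁻¹ * B⁻¹ * A) - adStar b (B⁻¹ * A)) (gen (.B i))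

/-- The sum over the later handles in the transformation of the handle generators. -/
def tailH (i : Fin g) : Fin d → Flower01 d G n g :=
  ∑ k ∈ Finset.Ioi i, ixAct (adStar b (descProd holK k (i + 1))) (genH b k)

/-- The transformed generators `j_a^{X'}` of the decoupling transformation. -/
def genPrime : Loop n g → Fin d → Flower01 d G n g
  | .M i => gen (.M i) - ixAct (1 - adStar b (hol (.M i)))
      (∑ k ∈ Finset.Ioi i,
          ixAct (adStar b (descProd (fun m => hol (.M m)) k (i + 1))) (gen (.M k)) +
        ∑ k : Fin g, ixAct (adStar b (descProd holK k 0 * descProd (fun m => hol (.M m)) n (i + 1)))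
          (genH b k))
  | .A i => gen (.A i) + ixAct (adStar b (hol (.A i))⁻¹) (gen (.A i) - gen (.B i)) +
      ixAct (adStar b (hol (.A i)) - adStar b (hol (.B i) * (hol (.A i))⁻¹)) (tailH b i)
  | .B i => gen (.B i) + ixAct (adStar b (hol (.A i))⁻¹) (gen (.A i) - gen (.B i)) +
      ixAct (adStar b (hol (.B i)) - adStar b (hol (.B i) * (hol (.A i))⁻¹)) (tailH b i)

/-- The decoupling transformation `K`: the algebra homomorphism with `K(1 ⊗ F) = 1 ⊗ F` and
`K(j_a^X ⊗ 1) = j_a^{X'}`. -/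
def decouple : Flower d G n g →ₐ[CoeffAlg d G n g] Flower d G n g :=
  MvPolynomial.aeval fun x => (genPrime b x.1 x.2 : Flower d G n g)

theorem decouple_mem (P : Flower d G n g) (hP : P ∈ Flower01 d G n g) :
    decouple b P ∈ Flower01 d G n g := by
  refine flower01_induction (p := fun P => decouple b P ∈ Flower01 d G n g) ?_ ?_ ?_ P hP
  · intro F
    rw [decouple, MvPolynomial.aeval_C]
    exact (fn F).2
  · intro F x
    rw [map_smul, decouple, MvPolynomial.aeval_X]
    exact Submodule.smul_mem _ _ (genPrime b x.1 x.2).2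
  · intro P P' h h'
    rw [map_add]
    exact Submodule.add_mem _ h h'

/-- The restriction of `K` to the part of degree at most one. -/
def decouple01 : Flower01 d G n g →ₗ[ℂ] Flower01 d G n g :=
  ((decouple b).toLinearMap.restrict (decouple_mem b)).restrictScalars ℂ

/-! The Poisson brackets of the (undecoupled) flower algebra -/

/-- The position of a loop in the order `M₁ < … < Mₙ < A₁, B₁ < … < A_g, B_g`. -/
def Loop.pos : Loop n g → ℕ
  | .M i => i
  | .A i => n + i
  | .B i => n + i

/-- The loop whose generators occur in the bracket of the generators of the two loops `A_i`, `B_i`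
of a handle: `{j_a^{A_i}, j_b^{B_i}} = -f_ab^c j_c^{B_i}`. -/
def Loop.partner : Loop n g → Loop n g
  | .A i => .B i
  | Z => Z

/-- The bracket `{j_a^X ⊗ 1, j_b^Y ⊗ 1}`. -/
def brGenGen (X : Loop n g) (a : Fin d) (Y : Loop n g) (a' : Fin d) : Flower01 d G n g :=
  if X.pos < Y.pos then
    -∑ c, ∑ e, ((structConst b e a' c : ℂ) • (1 - adStar b (hol X)) a e) • gen Y c
  else if Y.pos < X.pos then
    ∑ c, ∑ e, ((structConst b e a c : ℂ) • (1 - adStar b (hol Y)) a' e) • gen X c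
  else
    -∑ c, (structConst b a a' c : ℂ) • gen (if X = Y then X else X.partner) c

/-- The vector field `F ↦ Σ_{Y > X} (J_b^{R_Y} + J_b^{L_Y}) F`. -/
def vecAfter (X : Loop n g) (a : Fin d) : Derivation ℂ (CoeffAlg d G n g) (CoeffAlg d G n g) :=
  ∑ Y with X.pos < Y.pos, (vecR b Y a + vecL b Y a)

/-- The bracket `F ↦ {j_a^X ⊗ 1, 1 ⊗ F}`. -/
def brGenFn (X : Loop n g) (a : Fin d) : Derivation ℂ (CoeffAlg d G n g) (CoeffAlg d G n g) :=
  (match X with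
  | .M i => -(vecR b (.M i) a + vecL b (.M i) a)
  | .A i => -(vecR b (.A i) a + vecL b (.A i) a) - (vecR b (.B i) a + vecL b (.B i) a) -
      ∑ c, adStar b ((hol (.B i) : Word d G n g)⁻¹ * hol (.A i)) a c • vecR b (.B i) c
  | .B i => -vecL b (.A i) a - (vecR b (.B i) a + vecL b (.B i) a)) -
  ∑ c, (1 - adStar b (hol X)) a c • vecAfter b X c

/-- A derivation of the coefficients, applied to each coefficient of a polynomial in the `j_a^X`. -/
def coeffDer (D : Derivation ℂ (CoeffAlg d G n g) (CoeffAlg d G n g)) :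
    Flower d G n g →ₗ[ℂ] Flower d G n g :=
  ((MvPolynomial.basisMonomials _ _).repr.symm.toLinearMap.restrictScalars ℂ) ∘ₗ
    Finsupp.mapRange.linearMap (D : CoeffAlg d G n g →ₗ[ℂ] CoeffAlg d G n g) ∘ₗ
      ((MvPolynomial.basisMonomials _ _).repr.toLinearMap.restrictScalars ℂ)

/-- The Poisson bracket of the flower algebra: the biderivation with
`{1 ⊗ F, 1 ⊗ F'} = 0` and the above brackets of the generators. -/
def flowerBracket (W Z : Flower d G n g) : Flower d G n g :=
  ∑ x : Loop n g × Fin d, ∑ y : Loop n g × Fin d, MvPolynomial.pderiv x W * MvPolynomial.pderiv y Z *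
      (brGenGen b x.1 x.2 y.1 y.2 : Flower d G n g) +
    ∑ x : Loop n g × Fin d, (MvPolynomial.pderiv x W * coeffDer (brGenFn b x.1 x.2) Z -
      MvPolynomial.pderiv x Z * coeffDer (brGenFn b x.1 x.2) W)

theorem coeffDer_monomial (D : Derivation ℂ (CoeffAlg d G n g) (CoeffAlg d G n g))
    (m : Loop n g × Fin d →₀ ℕ) (F : CoeffAlg d G n g) :
    coeffDer D (MvPolynomial.monomial m F) = MvPolynomial.monomial m (D F) := by
  have h : ∀ F : CoeffAlg d G n g, (MvPolynomial.basisMonomials (Loop n g × Fin d)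
      (CoeffAlg d G n g)).repr (MvPolynomial.monomial m F) = Finsupp.single m F := fun F => by
    rw [← LinearEquiv.eq_symm_apply, Module.Basis.repr_symm_single,
      MvPolynomial.coe_basisMonomials, MvPolynomial.smul_monomial, smul_eq_mul, mul_one]
  simp only [coeffDer, LinearMap.comp_apply, LinearMap.restrictScalars_apply,
    LinearEquiv.coe_coe, h, Finsupp.mapRange.linearMap_apply]
  rw [LinearEquiv.symm_apply_eq, h]
  exact Finsupp.mapRange_single

theorem coeffDer_mem (D : Derivation ℂ (CoeffAlg d G n g) (CoeffAlg d G n g)) (P : Flower d G n g)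
    (hP : P ∈ Flower01 d G n g) : coeffDer D P ∈ Flower01 d G n g := by
  refine flower01_induction (p := fun P => coeffDer D P ∈ Flower01 d G n g) ?_ ?_ ?_ P hP
  · intro F
    rw [MvPolynomial.C_apply, coeffDer_monomial]
    exact (fn (D F)).2
  · intro F x
    rw [MvPolynomial.X, MvPolynomial.smul_monomial, coeffDer_monomial, smul_eq_mul, mul_one]
    have := Submodule.smul_mem _ (D F) (gen x.1 x.2 : Flower01 d G n g).2
    have h : D F • (gen x.1 x.2 : Flower01 d G n g).1 =
        MvPolynomial.monomial (Finsupp.single x 1) (D F) :=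
      (MvPolynomial.smul_monomial _).trans (by rw [smul_eq_mul, mul_one])
    rwa [h] at this
  · intro P P' h h'
    rw [map_add]
    exact Submodule.add_mem _ h h'

theorem pderiv_const (x : Loop n g × Fin d) (P : Flower d G n g) (hP : P ∈ Flower01 d G n g) :
    ∃ c : CoeffAlg d G n g, MvPolynomial.pderiv x P = MvPolynomial.C c := by
  refine flower01_induction
    (p := fun P => ∃ c : CoeffAlg d G n g, MvPolynomial.pderiv x P = MvPolynomial.C c)
    ?_ ?_ ?_ P hP
  · intro F
    exact ⟨0, by rw [MvPolynomial.pderiv_C, map_zero]⟩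
  · intro F y
    rw [Derivation.map_smul, MvPolynomial.pderiv_X]
    by_cases h : y = x
    · subst h
      exact ⟨F, by rw [Pi.single_eq_same, MvPolynomial.smul_eq_C_mul, mul_one]⟩
    · exact ⟨0, by rw [Pi.single_eq_of_ne h, smul_zero, map_zero]⟩
  · rintro P P' ⟨c, hc⟩ ⟨c', hc'⟩
    exact ⟨c + c', by rw [map_add, hc, hc', map_add]⟩

theorem flowerBracket_mem (W Z : Flower01 d G n g) : flowerBracket b W Z ∈ Flower01 d G n g := by
  rw [flowerBracket]
  refine Submodule.add_mem _ (Submodule.sum_mem _ fun x _ => Submodule.sum_mem _ fun y _ => ?_)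
    (Submodule.sum_mem _ fun x _ => ?_) <;> obtain ⟨c, hc⟩ := pderiv_const x W.1 W.2
  · obtain ⟨c', hc'⟩ := pderiv_const y Z.1 Z.2
    rw [hc, hc', ← map_mul, ← MvPolynomial.smul_eq_C_mul]
    exact Submodule.smul_mem _ _ (brGenGen b x.1 x.2 y.1 y.2).2
  · obtain ⟨c', hc'⟩ := pderiv_const x Z.1 Z.2
    rw [hc, hc', ← MvPolynomial.smul_eq_C_mul, ← MvPolynomial.smul_eq_C_mul]
    exact Submodule.sub_mem _ (Submodule.smul_mem _ _ (coeffDer_mem _ _ Z.2))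
      (Submodule.smul_mem _ _ (coeffDer_mem _ _ W.2))

/-- The Poisson bracket of the flower algebra on the part of degree at most one. -/
def flowerBracket01 (W Z : Flower01 d G n g) : Flower01 d G n g :=
  ⟨flowerBracket b W Z, flowerBracket_mem b W Z⟩

/-! The quantum algebra -/

variable (d G n g) in
/-- The complexification of `⊕ 𝔤` with bracket multiplied by `iħ`. The summand `M_i` is spanned by
the `j_a^{M'_i}`, the summand `A_i` by the `j_a^{A'_i} - j_a^{B'_i}` and the summand `B_i` by the
`j_a^{B'_i}`. -/
abbrev DecLie (ħ : ℝ) := QLie (Loop n g) (ℂ ⊗[ℝ] GroupLieAlgebra (𝓡 d) G) ħ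

variable (d G n g) in
/-- `ξ ↦ iħ {ξ, ·}` with `{ξ, F}(u) = -d/dt F(u · exp(t ξ))` for the right action `slotAct`. -/
def decAction (ħ : ℝ) :
    DecLie d G n g ħ →ₗ⁅ℂ⁆ Derivation ℂ (CoeffAlg d G n g) (CoeffAlg d G n g) :=
  QLie.der ħ (fun X => (slotDer X).liftBaseChange ℂ)
    (fun X => baseChange_lie _ (flowDer_lie _ _ (slotAct_mul X)))
    (fun _ _ h => baseChange_comm _ _ (flowDer_comm _ _ _ _ (slotAct_comm h)))

variable (d G n g) in
/-- The quantised decoupled flower algebra `U(⊕ 𝔤) ⋉ C^∞(G^(n+2g), ℂ)`. -/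
def QFlower (ħ : ℝ) : Type _ := SmashProduct (decAction d G n g ħ)

instance (ħ : ℝ) : Ring (QFlower d G n g ħ) :=
  inferInstanceAs (Ring (SmashProduct (decAction d G n g ħ)))

instance (ħ : ℝ) : Algebra ℂ (QFlower d G n g ħ) :=
  inferInstanceAs (Algebra ℂ (SmashProduct (decAction d G n g ħ)))

/-- The element `θ ⊗ F` of the quantum algebra, linear in both factors. -/
def qmk (ħ : ℝ) : UniversalEnvelopingAlgebra ℂ (DecLie d G n g ħ) →ₗ[ℂ]
    CoeffAlg d G n g →ₗ[ℂ] QFlower d G n g ħ :=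
  SmashProduct.mk (decAction d G n g ħ)

variable (ħ : ℝ)

/-- The generator `j_a^{X'}` of `⊕ 𝔤`. -/
def decGen : Loop n g → Fin d → DecLie d G n g ħ
  | .M i, a => QLie.single ħ (.M i) (1 ⊗ₜ[ℝ] b a)
  | .A i, a => QLie.single ħ (.A i) (1 ⊗ₜ[ℝ] b a) + QLie.single ħ (.B i) (1 ⊗ₜ[ℝ] b a)
  | .B i, a => QLie.single ħ (.B i) (1 ⊗ₜ[ℝ] b a)

/-- The loops in the order `M₁, …, Mₙ, A₁, B₁, …, A_g, B_g`. -/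
def loopList (n g : ℕ) : List (Loop n g) :=
  (List.finRange n).map .M ++ (List.finRange g).flatMap fun i => [.A i, .B i]

/-- The ordered monomial in the universal enveloping algebra attached to a multi-index. -/
def ordMonomial (m : Loop n g × Fin d →₀ ℕ) : UniversalEnvelopingAlgebra ℂ (DecLie d G n g ħ) :=
  (((loopList n g).product (List.finRange d)).map fun x =>
    UniversalEnvelopingAlgebra.ι ℂ (decGen b ħ x.1 x.2) ^ m x).prod

/-- The quantisation map `Q(j_{x₁} ⋯ j_{xₘ} ⊗ F) = j_{x₁} ·_U ⋯ ·_U j_{xₘ} ⊗ F`, for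
`x₁ ≤ ⋯ ≤ xₘ`. -/
def quantise : Flower d G n g →ₗ[ℂ] QFlower d G n g ħ :=
  Finsupp.lsum ℂ (fun m => qmk ħ (ordMonomial b ħ m)) ∘ₗ
    ((MvPolynomial.basisMonomials _ _).repr.toLinearMap.restrictScalars ℂ)

variable (d G n g) in
/-- The part `U^(1)(⊕ 𝔤) ⊗ C^∞(G^(n+2g), ℂ)` of filtration degree one, where
`U^(1)(⊕ 𝔤) = ℂ 1 + ⊕ 𝔤`. -/
def QFlower1 : Submodule ℂ (QFlower d G n g ħ) :=
  Submodule.map₂ (qmk ħ)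
    (Submodule.span ℂ {1} ⊔
      LinearMap.range (UniversalEnvelopingAlgebra.ι ℂ (L := DecLie d G n g ħ) :
        DecLie d G n g ħ →ₗ[ℂ] UniversalEnvelopingAlgebra ℂ (DecLie d G n g ħ))) ⊤

instance : AddCommGroup (QFlower1 d G n g ħ) := Submodule.addCommGroup _

instance : Module ℂ (QFlower1 d G n g ħ) := Submodule.module _

/-- The commutator of two elements of `QFlower1`. -/
def qcomm (θ χ : QFlower1 d G n g ħ) : QFlower d G n g ħ := θ.1 * χ.1 - χ.1 * θ.1

theorem mem_loopList (X : Loop n g) : X ∈ loopList n g := by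
  cases X <;> simp [loopList]

theorem nodup_loopList : (loopList n g).Nodup := by
  rw [loopList, List.nodup_append']
  refine ⟨(List.nodup_finRange n).map fun i j h => by simpa using h, ?_, ?_⟩
  · rw [List.nodup_flatMap]
    refine ⟨fun i _ => by simp, (List.nodup_finRange g).imp fun {i j} h => ?_⟩
    simp [Function.onFun, Ne.symm h]
  · simp [List.Disjoint]

theorem ordMonomial_zero : ordMonomial b ħ (0 : Loop n g × Fin d →₀ ℕ) = 1 := by
  simp [ordMonomial]

theorem ordMonomial_single (x : Loop n g × Fin d) : ordMonomial b ħ (Finsupp.single x 1) =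
    UniversalEnvelopingAlgebra.ι ℂ (decGen b ħ x.1 x.2) := by
  have hnd : ((loopList n g).product (List.finRange d)).Nodup :=
    nodup_loopList.product (List.nodup_finRange d)
  have hmem : x ∈ (loopList n g).product (List.finRange d) :=
    List.pair_mem_product.2 ⟨mem_loopList x.1, List.mem_finRange x.2⟩
  rw [ordMonomial, List.prod_map_eq_pow_single x]
  · have := List.count_eq_one_of_mem hnd hmem
    simp only [Finsupp.single_eq_same, pow_one]
    convert pow_one _
    convert this
  · intro y hy _
    rw [Finsupp.single_eq_of_ne hy, pow_zero]

theorem quantise_monomial (m : Loop n g × Fin d →₀ ℕ) (F : CoeffAlg d G n g) :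
    quantise b ħ (MvPolynomial.monomial m F) =
      qmk ħ (ordMonomial b ħ m) F := by
  have : (MvPolynomial.basisMonomials (Loop n g × Fin d) (CoeffAlg d G n g)).repr
      (MvPolynomial.monomial m F) = Finsupp.single m F := by
    rw [← LinearEquiv.eq_symm_apply, Module.Basis.repr_symm_single,
      MvPolynomial.coe_basisMonomials, MvPolynomial.smul_monomial, smul_eq_mul, mul_one]
  simp only [quantise, LinearMap.comp_apply, LinearMap.restrictScalars_apply,
    LinearEquiv.coe_coe, this]
  simp

theorem quantise_mem (P : Flower d G n g) (hP : P ∈ Flower01 d G n g) :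
    quantise b ħ P ∈ QFlower1 d G n g ħ := by
  refine flower01_induction (p := fun P => quantise b ħ P ∈ QFlower1 d G n g ħ) ?_ ?_ ?_ P hP
  · intro F
    rw [MvPolynomial.C_apply, quantise_monomial, ordMonomial_zero]
    exact Submodule.apply_mem_map₂ _
      (Submodule.mem_sup_left (Submodule.mem_span_singleton_self _)) Submodule.mem_top
  · intro F x
    rw [MvPolynomial.X, MvPolynomial.smul_monomial, quantise_monomial, ordMonomial_single]
    exact Submodule.apply_mem_map₂ _
      (Submodule.mem_sup_right ⟨_, rfl⟩) Submodule.mem_top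
  · intro P P' h h'
    rw [map_add]
    exact Submodule.add_mem _ h h'

/-- The restriction of `Q` to the part of degree at most one. -/
def quantise01 : Flower01 d G n g →ₗ[ℂ] QFlower1 d G n g ħ :=
  (quantise b ħ).restrict (p := (Flower01 d G n g).restrictScalars ℂ) (quantise_mem b ħ)

end
end

end FlowerAlgebra

open FlowerAlgebra

/-! ### Calculus at the identity of `G`. -/

namespace FlowerAlgebra
open Function

section
variable {d : ℕ} {G : Type*} [TopologicalSpace G]
    [ChartedSpace (EuclideanSpace ℝ (Fin d)) G] [Group G] [LieGroup (𝓡 d) ∞ G]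

/-! An element of degree at most one is a function plus a sum of functions with values in the copies
of the Lie algebra. These sums are sections of the action Lie algebroid of the decoupled algebra. In
the smash product the commutator of two such elements has no ordering corrections: functions
commute, and ξη - ηξ collapses to the bracket of the Lie algebra. Hence the commutator is exactly iħ
times the image under Q of the decoupled classical bracket, given by `anchor` on functions and
`sectBr` on sections (`commutator_qembed`, `qcomm_quantise01`). What remains is the classical claim
that K⁻¹ carries the flower bracket to the decoupled bracket in degree at most one.

For this K⁻¹ is made explicit. The preimage of the generator of the loop X in direction v is
`genSect b X v`: a local term at the puncture or handle of X, plus the generator of the simultaneous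
conjugation of everything behind X in direction m = v - Ad(u_X)v. In decoupled terms this
conjugation has component m - psi_Z m in the copy Z (`anchor_tailSect`). Applying K to it telescopes
to the sums that occur in the definition of K (`decoupleC_tailSect_handle`,
`decoupleC_tailSect_puncture`, `decoupleC_genSect`). So K is surjective, and a surjective
endomorphism of a finitely generated module over a commutative ring is bijective.

The brackets rest on two symmetries. The operator psi_Z is changed only by the copy Z, and there by
a left multiplication of its group argument (`anchor_psi`). The vector field of `genSect b X v` acts
on all holonomies behind X as conjugation with generator m, so operators built from those holonomies
commute with D - ad m (`IsEquivariant`). With the action on functions (`anchor_genSect`) this gives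
the brackets of generators at different positions (`sectBr_genSect_of_pos_lt`) and at the same
position (`sectBr_genSect_of_pos_eq`). Coefficients are then restored by comparing the Leibniz rules
`flowerBracket01_gen_gen` and `sectBr_smul_smul`.

That Q is bijective in degree at most one needs the Poincaré-Birkhoff-Witt theorem only in degree
one, `smul_one_add_ι_eq_zero`. It follows from an explicit representation: left-invariant vector
fields for ħ ≠ 0, and a nilpotent representation of the abelian Lie algebra for ħ = 0. -/

theorem dOne_comp {f : G → ℂ} (hf : ContMDiff (𝓡 d) 𝓘(ℝ, ℂ) ∞ f) {φ : G → G}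
    (hφ : ContMDiff (𝓡 d) (𝓡 d) ∞ φ) (h1 : φ 1 = 1) (ξ : GroupLieAlgebra (𝓡 d) G) :
    dOne (fun h => f (φ h)) ξ =
      dOne f (show EuclideanSpace ℝ (Fin d) from mfderiv (𝓡 d) (𝓡 d) φ 1 ξ) := by
  unfold dOne
  have := mfderiv_comp (1 : G) (hf.mdifferentiableAt (x := φ 1) (by simp))
    (hφ.mdifferentiableAt (x := 1) (by simp))
  rw [show (fun h => f (φ h)) = f ∘ φ from rfl, this]
  -- The chain rule yields the derivative of f at φ 1. The base point is generalised so that φ 1 = 1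
  -- can be substituted although the tangent space depends on it.
  have key : ∀ g (_ : g = (1 : G)) (v : EuclideanSpace ℝ (Fin d)),
      (mfderiv (𝓡 d) 𝓘(ℝ, ℂ) f g : EuclideanSpace ℝ (Fin d) →L[ℝ] ℂ) v =
      (mfderiv (𝓡 d) 𝓘(ℝ, ℂ) f 1 : EuclideanSpace ℝ (Fin d) →L[ℝ] ℂ) v := by
    rintro _ rfl _; rfl
  exact key _ h1 _

theorem contMDiff_conj (w : G) : ContMDiff (𝓡 d) (𝓡 d) ∞ fun h : G => w * h * w⁻¹ :=
  (contMDiff_const.mul contMDiff_id).mul contMDiff_const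

/-- The adjoint action of a group element, as a linear map of the Lie algebra. -/
noncomputable def adMap (w : G) : GroupLieAlgebra (𝓡 d) G →ₗ[ℝ] GroupLieAlgebra (𝓡 d) G where
  toFun ξ := Ad w ξ
  map_add' := (mfderiv (𝓡 d) (𝓡 d) (fun h : G => w * h * w⁻¹) 1).map_add
  map_smul' := (mfderiv (𝓡 d) (𝓡 d) (fun h : G => w * h * w⁻¹) 1).map_smul

/-- Turns the adjoint action into a conjugation of the argument, so that identities for `adMap`
become identities of functions on `G`. -/
theorem dOne_adMap {f : G → ℂ} (hf : ContMDiff (𝓡 d) 𝓘(ℝ, ℂ) ∞ f) (w : G)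
    (ξ : GroupLieAlgebra (𝓡 d) G) :
    dOne f (adMap w ξ) = dOne (fun h => f (w * h * w⁻¹)) ξ :=
  (dOne_comp hf (contMDiff_conj w) (by simp) ξ).symm

/-- Product rule along the diagonal. -/
theorem dOne_diag {F : G → G → ℂ} (hF : ContMDiff ((𝓡 d).prod (𝓡 d)) 𝓘(ℝ, ℂ) ∞ (uncurry F))
    (ξ : GroupLieAlgebra (𝓡 d) G) :
    dOne (fun h => F h h) ξ = dOne (fun h => F h 1) ξ + dOne (fun h => F 1 h) ξ := by
  have h0 : MDifferentiableAt ((𝓡 d).prod (𝓡 d)) 𝓘(ℝ, ℂ) (uncurry F) ((1 : G), (1 : G)) :=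
    hF.mdifferentiableAt (by simp)
  have hd : MDifferentiableAt (𝓡 d) ((𝓡 d).prod (𝓡 d)) (fun h : G => (h, h)) 1 :=
    mdifferentiableAt_id.prodMk mdifferentiableAt_id
  have h1 := mfderiv_comp (f := fun h : G => (h, h)) (1 : G) h0 hd
  have h2 : mfderiv (𝓡 d) ((𝓡 d).prod (𝓡 d)) (fun h : G => (h, h)) 1 ξ = (ξ, ξ) := by
    have := (mdifferentiableAt_id (I := 𝓡 d) (x := (1 : G))).mfderiv_prod mdifferentiableAt_id
    exact (DFunLike.congr_fun this ξ).trans (by simp; rfl)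
  have h3 := mfderiv_prod_eq_add_apply (v := show TangentSpace ((𝓡 d).prod (𝓡 d))
    ((1 : G), (1 : G)) from (show EuclideanSpace ℝ (Fin d) × EuclideanSpace ℝ (Fin d) from (ξ, ξ))) h0
  unfold dOne
  rw [show (fun h => F h h) = uncurry F ∘ fun h => (h, h) from rfl, h1]
  refine Eq.trans ?_ h3
  exact congrArg (mfderiv ((𝓡 d).prod (𝓡 d)) 𝓘(ℝ, ℂ) (uncurry F) ((1 : G), (1 : G))) h2

/-- The function f(h k⁻¹) is constant along the diagonal, so its two partial derivatives at the
identity cancel. -/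
theorem dOne_inv {f : G → ℂ} (hf : ContMDiff (𝓡 d) 𝓘(ℝ, ℂ) ∞ f) (ξ : GroupLieAlgebra (𝓡 d) G) :
    dOne (fun h => f h⁻¹) ξ = -dOne f ξ := by
  have := dOne_diag (F := fun h k : G => f (h * k⁻¹))
    (hf.comp (contMDiff_fst.mul contMDiff_snd.inv)) ξ
  simp only [mul_inv_cancel, inv_one, mul_one, one_mul, dOne_const] at this
  exact (neg_eq_of_add_eq_zero_right this.symm).symm

theorem dOne_expand (b : Module.Basis (Fin d) ℝ (GroupLieAlgebra (𝓡 d) G)) (f : G → ℂ)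
    (ξ : GroupLieAlgebra (𝓡 d) G) :
    dOne f ξ = ∑ c, ((b.coord c ξ : ℝ) : ℂ) * dOne f (b c) := by
  let l : GroupLieAlgebra (𝓡 d) G →ₗ[ℝ] ℂ :=
    { toFun := dOne f, map_add' := dOne_add_vec f, map_smul' := dOne_smul_vec f }
  change l ξ = ∑ c, ((b.coord c ξ : ℝ) : ℂ) * l (b c)
  conv_lhs => rw [← b.sum_repr ξ, map_sum]
  exact Finset.sum_congr rfl fun c _ => by rw [map_smul, Complex.real_smul]; rfl

/-- There are smooth functions on `G` whose derivatives at `1` form the dual basis. -/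
theorem exists_dual_functions [T2Space G] (b : Module.Basis (Fin d) ℝ (GroupLieAlgebra (𝓡 d) G)) :
    ∃ f : Fin d → G → ℂ, (∀ c, ContMDiff (𝓡 d) 𝓘(ℝ, ℂ) ∞ (f c)) ∧
      ∀ c ξ, dOne (f c) ξ = ((b.coord c ξ : ℝ) : ℂ) := by
  have hne : Nonempty (SmoothBumpFunction (𝓡 d) (1 : G)) := inferInstance
  obtain ⟨ρ⟩ := hne
  let L (c : Fin d) : EuclideanSpace ℝ (Fin d) →L[ℝ] ℂ := Complex.ofRealCLM.comp
    (LinearMap.toContinuousLinearMap (show EuclideanSpace ℝ (Fin d) →ₗ[ℝ] ℝ from b.coord c))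
  let e := extChartAt (𝓡 d) (1 : G)
  -- Multiplying by the bump function makes the chart coordinates globally smooth, where the
  -- Hausdorff property enters. Near 1 the bump is 1, so the derivative there is that of the chart.
  have hs : ContMDiff (𝓡 d) 𝓘(ℝ, EuclideanSpace ℝ (Fin d)) ∞ fun x => ρ x • e x :=
    ρ.contMDiff_smul (contMDiffOn_extChartAt (I := 𝓡 d) (x := (1 : G)) (n := ∞))
  refine ⟨fun c x => L c (ρ x • e x), fun c => (L c).contDiff.contMDiff.comp hs, fun c ξ => ?_⟩
  have hev : (fun x => L c (ρ x • e x)) =ᶠ[nhds (1 : G)] L c ∘ e := by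
    filter_upwards [ρ.eventuallyEq_one] with x hx
    simp [hx]
  unfold dOne
  rw [hev.mfderiv_eq]
  have h1 := mfderiv_comp (1 : G) (I := 𝓡 d) (I' := 𝓘(ℝ, EuclideanSpace ℝ (Fin d)))
    (I'' := 𝓘(ℝ, ℂ)) (f := e) (g := L c)
    ((L c).contDiff (n := 1) |>.contMDiff.mdifferentiableAt (by simp))
    (mdifferentiableAt_extChartAt (mem_chart_source _ _))
  rw [h1]
  have h2 : mfderiv (𝓡 d) 𝓘(ℝ, EuclideanSpace ℝ (Fin d)) e 1 = ContinuousLinearMap.id ℝ _ :=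
    mfderiv_extChartAt_self
  have h3 : mfderiv 𝓘(ℝ, EuclideanSpace ℝ (Fin d)) 𝓘(ℝ, ℂ) (L c) (e 1) = L c := by
    rw [mfderiv_eq_fderiv]; exact (L c).fderiv
  have h4 : (mfderiv (𝓡 d) 𝓘(ℝ, EuclideanSpace ℝ (Fin d)) e 1 :
    EuclideanSpace ℝ (Fin d) →L[ℝ] EuclideanSpace ℝ (Fin d)) ξ = ξ := DFunLike.congr_fun h2 ξ
  refine Eq.trans (congrArg (mfderiv 𝓘(ℝ, EuclideanSpace ℝ (Fin d)) 𝓘(ℝ, ℂ) (L c) (e 1)) h4) ?_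
  exact DFunLike.congr_fun h3 ξ

end
end FlowerAlgebra

/-! ### The adjoint action on the Lie algebra. -/

namespace FlowerAlgebra
open Function

section
variable {d : ℕ} {G : Type*} [TopologicalSpace G]
    [ChartedSpace (EuclideanSpace ℝ (Fin d)) G] [Group G] [LieGroup (𝓡 d) ∞ G] [T2Space G]
    (b : Module.Basis (Fin d) ℝ (GroupLieAlgebra (𝓡 d) G))

/-- Smooth functions separate tangent vectors at the identity, by the dual functions of any basis;
the rules for `adMap` are therefore checked under `dOne`. -/
theorem eq_of_dOne_eq {ξ η : GroupLieAlgebra (𝓡 d) G}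
    (h : ∀ f : G → ℂ, ContMDiff (𝓡 d) 𝓘(ℝ, ℂ) ∞ f → dOne f ξ = dOne f η) : ξ = η := by
  let b : Module.Basis (Fin d) ℝ (GroupLieAlgebra (𝓡 d) G) :=
    (EuclideanSpace.basisFun (Fin d) ℝ).toBasis
  obtain ⟨f, hf, hd⟩ := exists_dual_functions b
  refine b.ext_elem fun c => ?_
  have := h (f c) (hf c)
  rw [hd, hd] at this
  exact Complex.ofReal_injective this

theorem adMap_mul (u v : G) (ξ : GroupLieAlgebra (𝓡 d) G) :
    adMap (u * v) ξ = adMap u (adMap v ξ) := by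
  refine eq_of_dOne_eq fun f hf => ?_
  have hc : ContMDiff (𝓡 d) 𝓘(ℝ, ℂ) ∞ fun h : G => f (u * h * u⁻¹) := hf.comp (contMDiff_conj u)
  rw [dOne_adMap hf, dOne_adMap hf, dOne_adMap hc]
  congr 1
  funext h
  simp [mul_assoc]

theorem adMap_one (ξ : GroupLieAlgebra (𝓡 d) G) : adMap (1 : G) ξ = ξ := by
  refine eq_of_dOne_eq fun f hf => ?_
  rw [dOne_adMap hf]
  congr 1
  funext h
  simp

/-- The bracket is the antisymmetrised second derivative of f(hk) at the identity. Conjugating both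
variables by u replaces the directions ξ and η by Ad(u)ξ and Ad(u)η in each iterated derivative. -/
theorem adMap_lie (u : G) (ξ η : GroupLieAlgebra (𝓡 d) G) :
    adMap u ⁅ξ, η⁆ = ⁅adMap u ξ, adMap u η⁆ := by
  refine eq_of_dOne_eq fun f hf => ?_
  have key : ∀ ξ η : GroupLieAlgebra (𝓡 d) G,
      dOne (fun h => dOne (fun k => f (u * (h * k) * u⁻¹)) η) ξ =
        dOne (fun h => dOne (fun k => f (h * k)) (adMap u η)) (adMap u ξ) := by
    intro ξ η
    have hs : ContMDiff (𝓡 d) 𝓘(ℝ, ℂ) ∞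
        fun h : G => dOne (fun k => f (h * k)) (adMap u η) :=
      smooth_deriv (𝓡 d) _ (hf.comp (contMDiff_mul (𝓡 d) ∞)) _
    rw [dOne_adMap hs]
    congr 1
    funext h
    have hc : ContMDiff (𝓡 d) 𝓘(ℝ, ℂ) ∞ fun k : G => f (u * h * u⁻¹ * k) :=
      hf.comp (contMDiff_const.mul contMDiff_id)
    rw [dOne_adMap hc]
    congr 1
    funext k
    simp [mul_assoc]
  have hc : ContMDiff (𝓡 d) 𝓘(ℝ, ℂ) ∞ fun h : G => f (u * h * u⁻¹) := hf.comp (contMDiff_conj u)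
  rw [dOne_adMap hf, ← dOne_bracket f hf, ← dOne_bracket _ hc]
  exact congrArg₂ _ (key ξ η) (key η ξ)

/-- The derivative at `1` of `h ↦ ⟨f, Ad (u h) η⟩`. -/
theorem dOne_dOne_conj {f : G → ℂ} (hf : ContMDiff (𝓡 d) 𝓘(ℝ, ℂ) ∞ f)
    (ξ η : GroupLieAlgebra (𝓡 d) G) :
    dOne (fun h => dOne (fun k => f (h * k * h⁻¹)) η) ξ = dOne f ⁅ξ, η⁆ := by
  -- The two occurrences of h are made independent, as h and l. The diagonal rule then gives a
  -- derivative of f(hk) minus one of f(kl), which is the bracket once the order of differentiation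
  -- in the second is exchanged.
  have hs : ContMDiff ((𝓡 d).prod (𝓡 d)) 𝓘(ℝ, ℂ) ∞
      (uncurry fun h l : G => dOne (fun k => f (h * k * l⁻¹)) η) :=
    smooth_deriv ((𝓡 d).prod (𝓡 d)) (fun p : G × G => fun k : G => f (p.1 * k * p.2⁻¹))
      (hf.comp (((contMDiff_fst.comp contMDiff_fst).mul contMDiff_snd).mul
        (contMDiff_snd.comp contMDiff_fst).inv)) η
  have hm : ContMDiff ((𝓡 d).prod (𝓡 d)) 𝓘(ℝ, ℂ) ∞ (uncurry fun k l : G => f (k * l)) :=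
    hf.comp (contMDiff_mul (𝓡 d) ∞)
  have hm' : ContMDiff ((𝓡 d).prod (𝓡 d)) 𝓘(ℝ, ℂ) ∞ (uncurry fun l k : G => f (k * l)) :=
    hf.comp (contMDiff_snd.mul contMDiff_fst)
  rw [dOne_diag hs]
  simp only [inv_one, mul_one, one_mul]
  rw [dOne_inv (f := fun l : G => dOne (fun k => f (k * l)) η) (smooth_deriv (𝓡 d) _ hm' η),
    ← dOne_bracket f hf, dOne_comm (fun l k => f (k * l)) hm', sub_eq_add_neg]

end

/-! ### Matrix elements of Ad and vector fields on G^(n+2g). -/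

noncomputable section
variable {d : ℕ} {G : Type*} [TopologicalSpace G]
    [ChartedSpace (EuclideanSpace ℝ (Fin d)) G] [Group G] [LieGroup (𝓡 d) ∞ G] [T2Space G]
    {n g : ℕ} (b : Module.Basis (Fin d) ℝ (GroupLieAlgebra (𝓡 d) G))

/-- The value of a coefficient function at a point. -/
def evalAt (u : Loop n g → G) : CoeffAlg d G n g →ₐ[ℂ] ℂ where
  toFun F := F.1 u
  map_one' := rfl
  map_mul' _ _ := rfl
  map_zero' := rfl
  map_add' _ _ := rfl
  commutes' _ := rfl

theorem evalAt_ext {F F' : CoeffAlg d G n g} (h : ∀ u, evalAt u F = evalAt u F') : F = F' :=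
  Subtype.ext (funext h)

theorem evalAt_adStar (w : Word d G n g) (a c : Fin d) (u : Loop n g → G) :
    evalAt u (adStar b w a c) = ((b.coord c (adMap (w u) (b a)) : ℝ) : ℂ) := rfl

theorem evalAt_vecR (X : Loop n g) (a : Fin d) (F : CoeffAlg d G n g) (u : Loop n g → G) :
    evalAt u (vecR b X a F) = dOne (fun h => evalAt (update u X (u X * h)) F) (b a) := rfl

theorem evalAt_vecL (X : Loop n g) (a : Fin d) (F : CoeffAlg d G n g) (u : Loop n g → G) :
    evalAt u (vecL b X a F) = dOne (fun h => evalAt (update u X (h⁻¹ * u X)) F) (b a) := rfl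

theorem evalAt_slotDer (X : Loop n g) (ξ : GroupLieAlgebra (𝓡 d) G) (F : CoeffAlg d G n g)
    (u : Loop n g → G) :
    evalAt u (slotDer X ξ F) = dOne (fun h => evalAt (slotAct X u h) F) ξ := rfl

theorem coord_adMap (u : G) (ξ : GroupLieAlgebra (𝓡 d) G) (c : Fin d) :
    b.coord c (adMap u ξ) = ∑ e, b.coord e ξ * b.coord c (adMap u (b e)) := by
  conv_lhs => rw [← b.sum_repr ξ, map_sum, map_sum]
  exact Finset.sum_congr rfl fun e _ => by rw [map_smul, map_smul]; rfl

/-- Rows hold the images of the basis vectors, so composition of adjoint actions multiplies the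
matrices in the opposite order. -/
theorem adStar_mul (w w' : Word d G n g) : adStar b (w * w') = adStar b w' * adStar b w := by
  ext a c
  refine evalAt_ext fun u => ?_
  rw [Matrix.mul_apply, map_sum]
  simp only [map_mul, evalAt_adStar]
  rw [show (w * w') u = w u * w' u from rfl, adMap_mul, coord_adMap]
  push_cast
  rfl

theorem adStar_one : adStar b (1 : Word d G n g) = 1 := by
  ext a c
  refine evalAt_ext fun u => ?_
  rw [evalAt_adStar, show (1 : Word d G n g) u = 1 from rfl, adMap_one, Matrix.one_apply, Module.Basis.coord_apply, Module.Basis.repr_self,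
    Finsupp.single_apply]
  split_ifs <;> simp

theorem structConst_skew (a a' c : Fin d) : structConst b a a' c = -structConst b a' a c := by
  rw [structConst, structConst, ← lie_skew, map_neg]

theorem coord_lie (ξ η : GroupLieAlgebra (𝓡 d) G) (c : Fin d) :
    b.coord c ⁅ξ, η⁆ = ∑ a, ∑ a', b.coord a ξ * b.coord a' η * structConst b a a' c := by
  conv_lhs => rw [← b.sum_repr ξ, ← b.sum_repr η]
  simp only [sum_lie, lie_sum, map_sum, smul_lie, lie_smul, map_smul, structConst,
    Module.Basis.coord_apply, smul_eq_mul]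
  simp only [Finset.mul_sum]
  rw [Finset.sum_comm]
  exact Finset.sum_congr rfl fun a _ => Finset.sum_congr rfl fun a' _ => by ring

/-- `Ad*(w)` preserves the structure constants. -/
theorem adStar_lie (w : Word d G n g) (a a' c : Fin d) :
    ∑ e, (structConst b a a' e : ℂ) • adStar b w e c =
      ∑ p, ∑ q, (structConst b p q c : ℂ) • (adStar b w a p * adStar b w a' q) := by
  refine evalAt_ext fun u => ?_
  have h := congrArg (b.coord c) (adMap_lie (w u) (b a) (b a'))
  have h2 := coord_lie b (adMap (w u) (b a)) (adMap (w u) (b a')) c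
  rw [coord_adMap] at h
  have h3 := h.trans h2
  simp only [map_sum, map_smul, map_mul, evalAt_adStar, smul_eq_mul]
  have h4 := congrArg (fun x : ℝ => (x : ℂ)) h3
  push_cast at h4
  simp only [structConst]
  refine h4.trans (Finset.sum_congr rfl fun p _ => Finset.sum_congr rfl fun q _ => ?_)
  exact mul_comm _ _

/-- To first order Ad(u_X exp(tJ_a)) = Ad(u_X)(1 + t ad J_a). In terms of a dual function the matrix
element is a derivative of a conjugation, so `dOne_dOne_conj` produces the bracket. -/
theorem vecR_adStar_self (X : Loop n g) (a a' c : Fin d) :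
    vecR b X a (adStar b (hol X) a' c) = ∑ e, (structConst b a a' e : ℂ) • adStar b (hol X) e c := by
  refine evalAt_ext fun u => ?_
  obtain ⟨f, hf, hd⟩ := exists_dual_functions b
  rw [evalAt_vecR, map_sum]
  simp only [map_smul, evalAt_adStar, smul_eq_mul]
  have h1 : ∀ h : G, ((b.coord c (adMap ((hol X : Word d G n g) (update u X (u X * h))) (b a')) : ℝ) : ℂ) =
      dOne (fun k => f c (u X * (h * k * h⁻¹) * (u X)⁻¹)) (b a') := fun h => by
    rw [← hd]
    refine (dOne_adMap (hf c) _ _).trans ?_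
    congr 1
    funext k
    simp [hol, mul_assoc]
  simp only [h1]
  rw [dOne_dOne_conj (f := fun x => f c (u X * x * (u X)⁻¹)) ((hf c).comp (contMDiff_conj _)),
    ← dOne_adMap (hf c), hd, coord_adMap]
  push_cast
  rfl

theorem vecR_adStar_of_ne {X Y : Loop n g} (h : X ≠ Y) (a a' c : Fin d) :
    vecR b X a (adStar b (hol Y) a' c) = 0 := by
  refine evalAt_ext fun u => ?_
  rw [evalAt_vecR]
  simp only [evalAt_adStar]
  have : ∀ k : G, (hol Y : Word d G n g) (update u X (u X * k)) = u Y := fun k : G => update_of_ne h.symm _ _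
  simp only [this, dOne_const, map_zero]

theorem smooth_along (F : CoeffAlg d G n g) {f : G → Loop n g → G}
    (hf : ContMDiff (𝓡 d) (powModel d n g) ∞ f) :
    ContMDiff (𝓡 d) 𝓘(ℝ, ℂ) ∞ fun h => evalAt (f h) F :=
  (show ContMDiff (powModel d n g) 𝓘(ℝ, ℂ) ∞ F.1 from F.2).comp hf

theorem smooth_update (u : Loop n g → G) (X : Loop n g) :
    ContMDiff (𝓡 d) (powModel d n g) ∞ fun h => update u X h := by
  rw [contMDiff_piMfd]
  intro Y
  by_cases h : Y = X
  · subst h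
    exact contMDiff_id.congr fun h => update_self Y h u
  · simpa [h] using contMDiff_const

theorem derivation_sum_apply {ι C : Type*} [CommRing C] [Algebra ℂ C] (s : Finset ι)
    (D : ι → Derivation ℂ C C) (F : C) : (∑ i ∈ s, D i) F = ∑ i ∈ s, D i F := by
  rw [← Derivation.coeFnAddMonoidHom_apply, map_sum, Finset.sum_apply]
  rfl

/-- exp(-tJ_a)u_X = u_X · (u_X⁻¹ exp(-tJ_a) u_X): a left translation is a right translation in the
direction -Ad(u_X⁻¹)J_a. -/
theorem vecL_eq (X : Loop n g) (a : Fin d) :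
    vecL b X a = -∑ c, adStar b (hol X)⁻¹ a c • vecR b X c := by
  refine Derivation.ext fun F => evalAt_ext fun u => ?_
  have hs : ContMDiff (𝓡 d) 𝓘(ℝ, ℂ) ∞ fun h => evalAt (update u X (u X * h)) F :=
    (smooth_along F (smooth_update u X)).comp (contMDiff_const.mul contMDiff_id)
  rw [evalAt_vecL, Derivation.neg_apply, derivation_sum_apply, map_neg, map_sum]
  simp only [Derivation.smul_apply, smul_eq_mul, map_mul, evalAt_adStar, evalAt_vecR]
  have h1 := dOne_expand b (fun h => evalAt (update u X (u X * h)) F)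
    (adMap ((hol X : Word d G n g)⁻¹ u) (b a))
  refine Eq.trans ?_ (congrArg Neg.neg h1)
  rw [dOne_adMap hs]
  refine Eq.trans ?_ (dOne_inv (hs.comp (contMDiff_conj ((hol X : Word d G n g)⁻¹ u))) (b a))
  congr 1
  funext h
  have hX : (hol X : Word d G n g)⁻¹ u = (u X)⁻¹ := rfl
  simp [hX, mul_assoc]

/-- Conjugation is a right and a left translation along the same curve; the diagonal rule
differentiates them separately. -/
theorem slotDer_M (i : Fin n) (a : Fin d) :
    slotDer (.M i : Loop n g) (b a) = vecR b (.M i) a + vecL b (.M i) a := by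
  refine Derivation.ext fun F => evalAt_ext fun u => ?_
  have hs : ContMDiff ((𝓡 d).prod (𝓡 d)) 𝓘(ℝ, ℂ) ∞
      (uncurry fun h k : G => evalAt (update u (.M i) (k⁻¹ * u (.M i) * h)) F) :=
    (smooth_along F (smooth_update u (.M i))).comp
      ((contMDiff_snd.inv.mul contMDiff_const).mul contMDiff_fst)
  rw [Derivation.add_apply, map_add, evalAt_slotDer, evalAt_vecR, evalAt_vecL]
  have := dOne_diag hs (b a)
  simp only [inv_one, one_mul, mul_one] at this
  rw [← this]
  congr 1
  funext h
  congr 2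
  funext Y
  by_cases hY : Y = .M i <;> simp [slotAct, hY]

theorem slotDer_B (i : Fin g) (a : Fin d) : slotDer (.B i : Loop n g) (b a) = vecR b (.B i) a := by
  refine Derivation.ext fun F => evalAt_ext fun u => ?_
  rw [evalAt_slotDer, evalAt_vecR]
  congr 1
  funext h
  congr 2
  funext Y
  by_cases hY : Y = .B i <;> simp [slotAct, hY]

/-- The action multiplies u_A by h on the right and u_B by u_A h u_A⁻¹ on the left. Making the two
occurrences of h independent yields the two terms; the minus sign appears because `vecL` translates
by the inverse. -/
theorem slotDer_A (i : Fin g) (a : Fin d) :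
    slotDer (.A i : Loop n g) (b a) =
      vecR b (.A i) a - ∑ c, adStar b (hol (.A i) : Word d G n g) a c • vecL b (.B i) c := by
  refine Derivation.ext fun F => evalAt_ext fun u => ?_
  let U (h k : G) : Loop n g → G :=
    update (update u (.A i) (u (.A i) * h)) (.B i) (u (.A i) * k * (u (.A i))⁻¹ * u (.B i))
  have hU : ContMDiff ((𝓡 d).prod (𝓡 d)) (powModel d n g) ∞ (uncurry U) := by
    rw [contMDiff_piMfd]
    intro Y
    by_cases hB : Y = .B i
    · subst hB
      exact (((contMDiff_const.mul contMDiff_snd).mul contMDiff_const).mul contMDiff_const).congr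
        fun p => update_self ..
    · by_cases hA : Y = .A i
      · subst hA
        exact (contMDiff_const.mul contMDiff_fst).congr fun p => by simp [U, uncurry]; rfl
      · simpa [U, uncurry, hA, hB] using contMDiff_const
  have hs : ContMDiff ((𝓡 d).prod (𝓡 d)) 𝓘(ℝ, ℂ) ∞ (uncurry fun h k => evalAt (U h k) F) :=
    (show ContMDiff (powModel d n g) 𝓘(ℝ, ℂ) ∞ F.1 from F.2).comp hU
  have hB : ContMDiff (𝓡 d) 𝓘(ℝ, ℂ) ∞ fun h => evalAt (update u (.B i) (h * u (.B i))) F :=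
    (smooth_along F (smooth_update u (.B i))).comp (contMDiff_id.mul contMDiff_const)
  rw [Derivation.sub_apply, map_sub, evalAt_slotDer, evalAt_vecR, derivation_sum_apply, map_sum]
  simp only [Derivation.smul_apply, smul_eq_mul, map_mul, evalAt_adStar, evalAt_vecL,
    dOne_inv hB, mul_neg, Finset.sum_neg_distrib, sub_neg_eq_add]
  have h1 := dOne_expand b (fun h => evalAt (update u (.B i) (h * u (.B i))) F)
    (adMap ((hol (.A i) : Word d G n g) u) (b a))
  have h2 := dOne_diag hs (b a)
  refine Eq.trans ?_ (h2.trans (congrArg₂ (· + ·) ?_ (Eq.trans ?_ h1)))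
  · congr 1
    funext h
    congr 2
    funext Y
    by_cases hY : Y = .A i
    · simp [slotAct, U, hY]
    · by_cases hY' : Y = .B i <;> simp [slotAct, U, hY, hY']
  · congr 1
    funext h
    congr 2
    funext Y
    by_cases hY' : Y = .B i <;> simp [U, hY', update_apply]
  · rw [dOne_adMap hB]
    congr 1
    funext h
    congr 2
    funext Y
    by_cases hY' : Y = .B i
    · simp [U, hY', hol]
    · by_cases hY : Y = .A i <;> simp [U, hY, hY']

end
end FlowerAlgebra

/-! ### Vectors over a commutative algebra with derivations. -/

namespace FlowerAlgebra
open Function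

noncomputable section
variable {d : ℕ} {C : Type*} [CommRing C] [Algebra ℂ C]

/-- A derivation applied to each component of a vector. -/
def derVec (D : Derivation ℂ C C) : (Fin d → C) →ₗ[ℂ] (Fin d → C) :=
  (D : C →ₗ[ℂ] C).compLeft (Fin d)

theorem derVec_apply (D : Derivation ℂ C C) (v : Fin d → C) (a : Fin d) :
    derVec D v a = D (v a) := rfl

theorem derVec_smul (D : Derivation ℂ C C) (F : C) (v : Fin d → C) :
    derVec D (F • v) = F • derVec D v + D F • v := by
  funext a
  simp [derVec_apply, mul_comm]

theorem derVec_vecMul (D : Derivation ℂ C C) (v : Fin d → C) (m : Matrix (Fin d) (Fin d) C) :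
    derVec D (Matrix.vecMul v m) = Matrix.vecMul (derVec D v) m + Matrix.vecMul v (m.map D) := by
  funext a
  simp only [derVec_apply, Matrix.vecMul, dotProduct, map_sum, Derivation.leibniz, Pi.add_apply,
    Finset.sum_add_distrib, Matrix.map_apply, smul_eq_mul]
  rw [add_comm]
  congr 1
  exact Finset.sum_congr rfl fun _ _ => mul_comm _ _

theorem derVec_add_left (D D' : Derivation ℂ C C) (v : Fin d → C) :
    derVec (D + D') v = derVec D v + derVec D' v := rfl

theorem derVec_sub_left (D D' : Derivation ℂ C C) (v : Fin d → C) :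
    derVec (D - D') v = derVec D v - derVec D' v := rfl

theorem derVec_neg_left (D : Derivation ℂ C C) (v : Fin d → C) :
    derVec (-D) v = -derVec D v := rfl

theorem derVec_sum_left {ι : Type*} (s : Finset ι) (D : ι → Derivation ℂ C C) (v : Fin d → C) :
    derVec (∑ i ∈ s, D i) v = ∑ i ∈ s, derVec (D i) v := by
  funext a
  rw [derVec_apply, derivation_sum_apply, Finset.sum_apply]
  rfl

theorem derVec_single (D : Derivation ℂ C C) (a : Fin d) :
    derVec D (Pi.single a 1) = 0 := by
  funext c
  rw [derVec_apply, Pi.single_apply]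
  split_ifs <;> simp

/-- The contraction `v ↦ v^a p_a` of a vector with a family of elements of a module. -/
def contract {M : Type*} [AddCommGroup M] [Module C M] (p : Fin d → M) :
    (Fin d → C) →ₗ[C] M := Fintype.linearCombination C p

theorem contract_apply {M : Type*} [AddCommGroup M] [Module C M] (p : Fin d → M)
    (v : Fin d → C) : contract p v = ∑ a, v a • p a := Fintype.linearCombination_apply C p v

theorem contract_single {M : Type*} [AddCommGroup M] [Module C M] (p : Fin d → M) (a : Fin d) :
    contract p (Pi.single a (1 : C)) = p a := by
  simp [contract]

theorem contract_vecMul {M : Type*} [AddCommGroup M] [Module C M] (p : Fin d → M)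
    (v : Fin d → C) (m : Matrix (Fin d) (Fin d) C) :
    contract p (Matrix.vecMul v m) = contract (fun a => ∑ c, m a c • p c) v := by
  simp only [contract_apply, Matrix.vecMul, dotProduct, Finset.sum_smul, Finset.smul_sum, smul_smul]
  exact Finset.sum_comm

theorem linearMap_ext_single {M : Type*} [AddCommGroup M] [Module C M]
    {l l' : (Fin d → C) →ₗ[C] M} (h : ∀ a, l (Pi.single a 1) = l' (Pi.single a 1)) : l = l' := by
  refine (Pi.basisFun C (Fin d)).ext fun a => ?_
  simpa using h a

/-- The `C`-bilinear extension of the bracket with structure constants `f`. -/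
def lieVec (f : Fin d → Fin d → Fin d → ℝ) :
    (Fin d → C) →ₗ[C] (Fin d → C) →ₗ[C] (Fin d → C) :=
  contract fun a => contract fun a' c => algebraMap ℂ C (f a a' c)

theorem lieVec_apply (f : Fin d → Fin d → Fin d → ℝ) (v w : Fin d → C) (c : Fin d) :
    lieVec f v w c = ∑ a, ∑ a', (f a a' c : ℂ) • (v a * w a') := by
  simp only [lieVec, contract_apply, LinearMap.sum_apply, LinearMap.smul_apply, Finset.sum_apply,
    Pi.smul_apply, smul_eq_mul, Finset.mul_sum]
  simp only [Algebra.smul_def]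
  exact Finset.sum_congr rfl fun a _ => Finset.sum_congr rfl fun a' _ => by ring

theorem lieVec_skew {f : Fin d → Fin d → Fin d → ℝ} (hf : ∀ a a' c, f a a' c = -f a' a c)
    (v w : Fin d → C) : lieVec f v w = -lieVec f w v := by
  funext c
  rw [Pi.neg_apply, lieVec_apply, lieVec_apply, Finset.sum_comm, ← Finset.sum_neg_distrib]
  refine Finset.sum_congr rfl fun a _ => ?_
  rw [← Finset.sum_neg_distrib]
  refine Finset.sum_congr rfl fun a' _ => ?_
  rw [hf a' a, mul_comm]
  simp

/-- If `D ∘ φ = φ ∘ D + T`, then `D ∘ φ⁻¹ = φ⁻¹ ∘ D - φ⁻¹ ∘ T ∘ φ⁻¹`. -/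
theorem derVec_inverse {D : Derivation ℂ C C} {φ ψ : (Fin d → C) →ₗ[C] (Fin d → C)}
    (h1 : ∀ w, φ (ψ w) = w) (h2 : ∀ w, ψ (φ w) = w) {T : (Fin d → C) → Fin d → C}
    (h : ∀ w, derVec D (φ w) = φ (derVec D w) + T w) (w : Fin d → C) :
    derVec D (ψ w) = ψ (derVec D w) - ψ (T (ψ w)) := by
  have := h (ψ w)
  rw [h1] at this
  rw [this, map_add, h2, add_sub_cancel_right]

end

/-! ### Lie algebra valued functions on G^(n+2g). -/

noncomputable section
variable {d : ℕ} {G : Type*} [TopologicalSpace G]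
    [ChartedSpace (EuclideanSpace ℝ (Fin d)) G] [Group G] [LieGroup (𝓡 d) ∞ G] [T2Space G]
    {n g : ℕ} (b : Module.Basis (Fin d) ℝ (GroupLieAlgebra (𝓡 d) G))

variable (d G n g) in
/-- Lie algebra valued functions on `G^(n+2g)`, in terms of a basis. -/
abbrev VecAlg := Fin d → CoeffAlg d G n g

/-- The adjoint action of a word on Lie algebra valued functions. -/
def adV (w : Word d G n g) : VecAlg d G n g →ₗ[CoeffAlg d G n g] VecAlg d G n g :=
  Matrix.vecMulLinear (adStar b w)

theorem adV_apply (w : Word d G n g) (v : VecAlg d G n g) :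
    adV b w v = Matrix.vecMul v (adStar b w) := rfl

/-- Coefficient vectors are multiplied by Ad* from the right, which undoes the reversal in
`adStar_mul`: `adV` is a left action. -/
theorem adV_mul (w w' : Word d G n g) (v : VecAlg d G n g) :
    adV b (w * w') v = adV b w (adV b w' v) := by
  rw [adV_apply, adV_apply, adV_apply, adStar_mul, Matrix.vecMul_vecMul]

theorem adV_one (v : VecAlg d G n g) : adV b 1 v = v := by
  rw [adV_apply, adStar_one, Matrix.vecMul_one]

theorem adV_adV_inv (w : Word d G n g) (v : VecAlg d G n g) : adV b w (adV b w⁻¹ v) = v := by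
  rw [← adV_mul, mul_inv_cancel, adV_one]

theorem adV_inv_adV (w : Word d G n g) (v : VecAlg d G n g) : adV b w⁻¹ (adV b w v) = v := by
  rw [← adV_mul, inv_mul_cancel, adV_one]

/-- The bracket of Lie algebra valued functions. -/
def lieV : VecAlg d G n g →ₗ[CoeffAlg d G n g] VecAlg d G n g →ₗ[CoeffAlg d G n g] VecAlg d G n g :=
  lieVec (structConst b)

theorem lieV_skew (v w : VecAlg d G n g) : lieV b v w = -lieV b w v :=
  lieVec_skew (structConst_skew b) v w

/-- Both sides are bilinear over the functions, so constant basis vectors suffice, and there the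
claim is `adStar_lie`. -/
theorem adV_lieV (w : Word d G n g) (v v' : VecAlg d G n g) :
    adV b w (lieV b v v') = lieV b (adV b w v) (adV b w v') := by
  suffices (lieV b).compr₂ (adV b w) = (lieV b).compl₁₂ (adV b w) (adV b w) from
    LinearMap.congr_fun₂ this v v'
  refine linearMap_ext_single fun a => linearMap_ext_single fun a' => ?_
  simp only [LinearMap.compr₂_apply, LinearMap.compl₁₂_apply]
  funext c
  have h : ∀ e, adV b w (Pi.single e 1) = fun c => adStar b w e c := fun e => by
    rw [adV_apply, Matrix.single_one_vecMul]; rfl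
  have h2 : ∀ e, lieV b (Pi.single a 1) (Pi.single a' 1) e =
      algebraMap ℂ (CoeffAlg d G n g) (structConst b a a' e) := fun e => by
    rw [lieV, lieVec, contract_single, contract_single]
  rw [h, h, lieV, lieVec_apply, ← adStar_lie, adV_apply, Matrix.vecMul, dotProduct]
  exact Finset.sum_congr rfl fun e _ => by rw [← lieV, h2, Algebra.smul_def]

/-- The left-invariant vector fields in the directions of Lie algebra valued functions. -/
def derR (X : Loop n g) : VecAlg d G n g →ₗ[CoeffAlg d G n g]
    Derivation ℂ (CoeffAlg d G n g) (CoeffAlg d G n g) := contract (vecR b X)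

/-- The right-invariant vector fields in the directions of Lie algebra valued functions. -/
def derL (X : Loop n g) : VecAlg d G n g →ₗ[CoeffAlg d G n g]
    Derivation ℂ (CoeffAlg d G n g) (CoeffAlg d G n g) := contract (vecL b X)

/-- The action of the copy labelled by `X` in the decoupled flower algebra, extended to Lie algebra
valued functions. -/
def derSlot (X : Loop n g) : VecAlg d G n g →ₗ[CoeffAlg d G n g]
    Derivation ℂ (CoeffAlg d G n g) (CoeffAlg d G n g) := contract fun a => slotDer X (b a)

theorem derL_eq (X : Loop n g) (v : VecAlg d G n g) :
    derL b X v = -derR b X (adV b (hol X)⁻¹ v) := by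
  rw [adV_apply, derR, contract_vecMul, derL, contract_apply, contract_apply,
    ← Finset.sum_neg_distrib]
  exact Finset.sum_congr rfl fun a _ => by rw [vecL_eq, smul_neg]

/-- Leibniz rule, the derivative of Ad(u_X) itself being Ad(u_X) ∘ ad v. The direction v may be an
arbitrary function because no derivative falls on it. -/
theorem derR_adV_self (X : Loop n g) (v w : VecAlg d G n g) :
    derVec (derR b X v) (adV b (hol X) w) =
      adV b (hol X) (derVec (derR b X v) w) + adV b (hol X) (lieV b v w) := by
  rw [adV_apply, derVec_vecMul, adV_apply]
  congr 1
  funext c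
  rw [adV_apply]
  simp only [Matrix.vecMul, dotProduct, Matrix.map_apply, derR, contract_apply,
    derivation_sum_apply, Derivation.smul_apply, vecR_adStar_self, lieV, lieVec_apply, smul_eq_mul,
    Finset.mul_sum, Finset.sum_mul]
  rw [Finset.sum_comm]
  conv_rhs => rw [Finset.sum_comm]
  refine Finset.sum_congr rfl fun a _ => ?_
  conv_rhs => rw [Finset.sum_comm]
  refine Finset.sum_congr rfl fun a' _ => Finset.sum_congr rfl fun e _ => ?_
  simp only [Algebra.smul_def]
  ring

theorem derR_adV_of_ne {X Y : Loop n g} (h : X ≠ Y) (v w : VecAlg d G n g) :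
    derVec (derR b X v) (adV b (hol Y) w) = adV b (hol Y) (derVec (derR b X v) w) := by
  rw [adV_apply, derVec_vecMul, adV_apply, add_eq_left]
  have : (adStar b (hol Y)).map (derR b X v) = 0 := by
    ext a c : 1
    simp only [Matrix.map_apply, derR, contract_apply, derivation_sum_apply,
      Derivation.smul_apply, vecR_adStar_of_ne b h, smul_zero, Finset.sum_const_zero,
      Matrix.zero_apply]
  rw [this, Matrix.vecMul_zero]

/-- The previous rule in the direction -Ad(u_X⁻¹)v; since Ad(u_X) preserves brackets, the bracket
moves to its left. -/
theorem derL_adV_self (X : Loop n g) (v w : VecAlg d G n g) :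
    derVec (derL b X v) (adV b (hol X) w) =
      adV b (hol X) (derVec (derL b X v) w) - lieV b v (adV b (hol X) w) := by
  rw [derL_eq, derVec_neg_left, derR_adV_self, adV_lieV, adV_adV_inv, derVec_neg_left, map_neg]
  abel

theorem derL_adV_of_ne {X Y : Loop n g} (h : X ≠ Y) (v w : VecAlg d G n g) :
    derVec (derL b X v) (adV b (hol Y) w) = adV b (hol Y) (derVec (derL b X v) w) := by
  rw [derL_eq, derVec_neg_left, derR_adV_of_ne b h, derVec_neg_left, map_neg]

theorem derSlot_M (i : Fin n) (v : VecAlg d G n g) :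
    derSlot b (.M i) v = derR b (.M i) v + derL b (.M i) v := by
  simp only [derSlot, derR, derL, contract_apply, slotDer_M, smul_add, Finset.sum_add_distrib]

theorem derSlot_B (i : Fin g) (v : VecAlg d G n g) :
    derSlot b (.B i) v = derR b (.B i) v := by
  simp only [derSlot, derR, contract_apply, slotDer_B]

theorem derSlot_A (i : Fin g) (v : VecAlg d G n g) :
    derSlot b (.A i) v = derR b (.A i) v - derL b (.B i) (adV b (hol (.A i)) v) := by
  rw [adV_apply, derL, contract_vecMul]
  simp only [derSlot, derR, contract_apply, slotDer_A, smul_sub, Finset.sum_sub_distrib]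

end
end FlowerAlgebra

/-! ### The undecoupled generators as sections of the decoupled action Lie algebroid. -/

namespace FlowerAlgebra
open Function

noncomputable section
variable {d : ℕ} {G : Type*} [TopologicalSpace G]
    [ChartedSpace (EuclideanSpace ℝ (Fin d)) G] [Group G] [LieGroup (𝓡 d) ∞ G] [T2Space G]
    {n g : ℕ} (b : Module.Basis (Fin d) ℝ (GroupLieAlgebra (𝓡 d) G))

theorem Loop.sum_eq {M : Type*} [AddCommMonoid M] (f : Loop n g → M) :
    ∑ X, f X = ∑ i, f (.M i) + ∑ i, (f (.A i) + f (.B i)) := by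
  let e : Fin n ⊕ (Fin g ⊕ Fin g) ≃ Loop n g :=
    { toFun := Sum.elim .M (Sum.elim .A .B)
      invFun := fun | .M i => .inl i | .A i => .inr (.inl i) | .B i => .inr (.inr i)
      left_inv := by rintro (i | i | i) <;> rfl
      right_inv := by rintro (i | i | i) <;> rfl }
  rw [← e.sum_comp, Fintype.sum_sum_type, Fintype.sum_sum_type, Finset.sum_add_distrib]
  rfl

theorem derSlot_adV_of_pos_ne {X Y : Loop n g} (h : X.pos ≠ Y.pos) (v w : VecAlg d G n g) :
    derVec (derSlot b X v) (adV b (hol Y) w) = adV b (hol Y) (derVec (derSlot b X v) w) := by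
  have hne : X ≠ Y := fun e => h (congrArg _ e)
  cases X with
  | M i => rw [derSlot_M, derVec_add_left, derVec_add_left, derR_adV_of_ne b hne,
      derL_adV_of_ne b hne, map_add]
  | A i =>
    have hne' : (.B i : Loop n g) ≠ Y := by rintro rfl; exact h rfl
    rw [derSlot_A, derVec_sub_left, derVec_sub_left, derR_adV_of_ne b hne,
      derL_adV_of_ne b hne', map_sub]
  | B i => rw [derSlot_B, derR_adV_of_ne b hne]

theorem derSlot_A_adV_A (i : Fin g) (v w : VecAlg d G n g) :
    derVec (derSlot b (.A i) v) (adV b (hol (.A i)) w) =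
      adV b (hol (.A i)) (derVec (derSlot b (.A i) v) w) + adV b (hol (.A i)) (lieV b v w) := by
  rw [derSlot_A, derVec_sub_left, derVec_sub_left, derR_adV_self, derL_adV_of_ne b (by simp),
    map_sub]
  abel

/-- The copy A_i translates u_B on the left by u_A h u_A⁻¹, so the bracket with Ad(u_A)v stands to
the left of Ad(u_B). -/
theorem derSlot_A_adV_B (i : Fin g) (v w : VecAlg d G n g) :
    derVec (derSlot b (.A i) v) (adV b (hol (.B i)) w) =
      adV b (hol (.B i)) (derVec (derSlot b (.A i) v) w) +
        lieV b (adV b (hol (.A i)) v) (adV b (hol (.B i)) w) := by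
  rw [derSlot_A, derVec_sub_left, derVec_sub_left, derL_adV_self, derR_adV_of_ne b (by simp),
    map_sub]
  abel

theorem derSlot_B_adV_A (i : Fin g) (v w : VecAlg d G n g) :
    derVec (derSlot b (.B i) v) (adV b (hol (.A i)) w) =
      adV b (hol (.A i)) (derVec (derSlot b (.B i) v) w) := by
  rw [derSlot_B, derR_adV_of_ne b (by simp)]

theorem derSlot_B_adV_B (i : Fin g) (v w : VecAlg d G n g) :
    derVec (derSlot b (.B i) v) (adV b (hol (.B i)) w) =
      adV b (hol (.B i)) (derVec (derSlot b (.B i) v) w) + adV b (hol (.B i)) (lieV b v w) := by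
  rw [derSlot_B, derR_adV_self]

/-- The operators `0`, `Ad(u_A⁻¹)`, `Ad(u_B⁻¹ u_A)` on Lie algebra valued functions, attached to the
loops `M_i`, `A_i`, `B_i`. In terms of the decoupled generators, `1 - psi` describes the generator of
the simultaneous conjugation of the components of a puncture or handle. -/
def psi : Loop n g → VecAlg d G n g →ₗ[CoeffAlg d G n g] VecAlg d G n g
  | .M _ => 0
  | .A i => adV b (hol (.A i))⁻¹
  | .B i => adV b ((hol (.B i))⁻¹ * hol (.A i))

theorem psi_lieV (Z : Loop n g) (v w : VecAlg d G n g) :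
    psi b Z (lieV b v w) = lieV b (psi b Z v) (psi b Z w) := by
  cases Z <;> simp only [psi, adV_lieV, LinearMap.zero_apply, map_zero]

theorem derVec_adV_inv {D : Derivation ℂ (CoeffAlg d G n g) (CoeffAlg d G n g)} {w : Word d G n g}
    {T : VecAlg d G n g → VecAlg d G n g}
    (h : ∀ v, derVec D (adV b w v) = adV b w (derVec D v) + T v) (v : VecAlg d G n g) :
    derVec D (adV b w⁻¹ v) = adV b w⁻¹ (derVec D v) - adV b w⁻¹ (T (adV b w⁻¹ v)) :=
  derVec_inverse (adV_adV_inv b w) (adV_inv_adV b w) h v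

theorem derVec_adV_inv_of_comm {D : Derivation ℂ (CoeffAlg d G n g) (CoeffAlg d G n g)}
    {w : Word d G n g} (h : ∀ v, derVec D (adV b w v) = adV b w (derVec D v))
    (v : VecAlg d G n g) : derVec D (adV b w⁻¹ v) = adV b w⁻¹ (derVec D v) := by
  rw [derVec_adV_inv b (T := 0) (fun v => by rw [h, Pi.zero_apply, add_zero]), Pi.zero_apply,
    map_zero, sub_zero]

theorem derVec_psi_of_comm {D : Derivation ℂ (CoeffAlg d G n g) (CoeffAlg d G n g)} {Z : Loop n g}
    (h : ∀ Y : Loop n g, Y.pos = Z.pos → ∀ v, derVec D (adV b (hol Y) v) =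
      adV b (hol Y) (derVec D v)) (v : VecAlg d G n g) :
    derVec D (psi b Z v) = psi b Z (derVec D v) := by
  cases Z with
  | M i => simp only [psi, LinearMap.zero_apply, map_zero]
  | A i => exact derVec_adV_inv_of_comm b (h _ rfl) v
  | B i =>
    rw [psi, adV_mul, derVec_adV_inv_of_comm b (h _ rfl), h (.A i) rfl, adV_mul]

/-- Under the copy Z the group argument of `psi` is multiplied by h⁻¹ from the left: u_A⁻¹ becomes
h⁻¹u_A⁻¹, and u_B⁻¹u_A becomes h⁻¹u_B⁻¹u_A. -/
theorem derSlot_psi_self (Z : Loop n g) (v m : VecAlg d G n g) :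
    derVec (derSlot b Z v) (psi b Z m) =
      psi b Z (derVec (derSlot b Z v) m) - lieV b v (psi b Z m) := by
  cases Z with
  | M i => simp only [psi, LinearMap.zero_apply, map_zero, sub_zero]
  | A i =>
    simp only [psi]
    rw [derVec_adV_inv b (derSlot_A_adV_A b i v), adV_inv_adV]
  | B i =>
    simp only [psi, adV_mul]
    rw [derVec_adV_inv b (derSlot_B_adV_B b i v), adV_inv_adV, derSlot_B_adV_A]

/-- The group argument of `psi` is invariant under all other copies. The one case with a genuine
cancellation is A_i acting on u_B⁻¹u_A: the factor u_A h⁻¹u_A⁻¹ coming from u_B⁻¹ cancels the h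
coming from u_A. -/
theorem derSlot_psi_of_ne {X Z : Loop n g} (h : X ≠ Z) (v m : VecAlg d G n g) :
    derVec (derSlot b X v) (psi b Z m) = psi b Z (derVec (derSlot b X v) m) := by
  by_cases hp : X.pos = Z.pos
  · cases X with
    | M i =>
      cases Z with
      | M j => simp only [psi, LinearMap.zero_apply, map_zero]
      | A j => simp only [Loop.pos] at hp; omega
      | B j => simp only [Loop.pos] at hp; omega
    | A i =>
      cases Z with
      | M j => simp only [psi, LinearMap.zero_apply, map_zero]
      | A j => simp only [Loop.pos] at hp; exact absurd (congrArg Loop.A (Fin.ext (by omega))) h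
      | B j =>
        obtain rfl : i = j := by simp only [Loop.pos] at hp; exact Fin.ext (by omega)
        simp only [psi, adV_mul]
        rw [derVec_adV_inv b (derSlot_A_adV_B b i v), derSlot_A_adV_A, adV_adV_inv, map_add,
          ← adV_lieV, add_sub_cancel_right]
    | B i =>
      cases Z with
      | M j => simp only [psi, LinearMap.zero_apply, map_zero]
      | A j =>
        obtain rfl : i = j := by simp only [Loop.pos] at hp; exact Fin.ext (by omega)
        exact derVec_adV_inv_of_comm b (derSlot_B_adV_A b i v) m
      | B j => simp only [Loop.pos] at hp; exact absurd (congrArg Loop.B (Fin.ext (by omega))) h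
  · exact derVec_psi_of_comm b (fun Y hY w => derSlot_adV_of_pos_ne b (hY ▸ hp) v w) m

variable (d G n g) in
/-- The sections `Σ_X ξ_X` of the action Lie algebroid of the decoupled flower algebra, where `ξ_X`
is a function with values in the copy of the Lie algebra labelled by `X`. -/
abbrev Sect := Loop n g → VecAlg d G n g

/-- The bracket of a section with functions in the decoupled flower algebra. -/
def anchor : Sect d G n g →ₗ[CoeffAlg d G n g]
    Derivation ℂ (CoeffAlg d G n g) (CoeffAlg d G n g) :=
  -∑ X, derSlot b X ∘ₗ LinearMap.proj X

theorem anchor_apply (s : Sect d G n g) : anchor b s = -∑ X, derSlot b X (s X) := by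
  simp [anchor, LinearMap.sum_apply]

/-- The bracket of two sections in the decoupled flower algebra. -/
def sectBr (s s' : Sect d G n g) : Sect d G n g := fun Z =>
  -lieV b (s Z) (s' Z) + derVec (anchor b s) (s' Z) - derVec (anchor b s') (s Z)

/-- Only the summand X = Z of the anchor sees `psi b Z`, and the sign in the anchor turns the -[s_Z,
·] of `derSlot_psi_self` into +[s_Z, ·]. -/
theorem anchor_psi (s : Sect d G n g) (Z : Loop n g) (m : VecAlg d G n g) :
    derVec (anchor b s) (psi b Z m) =
      psi b Z (derVec (anchor b s) m) + lieV b (s Z) (psi b Z m) := by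
  rw [anchor_apply, derVec_neg_left, derVec_sum_left, derVec_neg_left, derVec_sum_left, map_neg,
    map_sum]
  have h : ∀ X, derVec (derSlot b X (s X)) (psi b Z m) =
      psi b Z (derVec (derSlot b X (s X)) m) - if X = Z then lieV b (s Z) (psi b Z m) else 0 := by
    intro X
    split_ifs with h
    · rw [← h, derSlot_psi_self]
    · rw [derSlot_psi_of_ne b h, sub_zero]
  rw [Finset.sum_congr rfl fun X _ => h X, Finset.sum_sub_distrib, Finset.sum_ite_eq' Finset.univ Z]
  simp only [Finset.mem_univ, if_true]
  abel

/-- The coefficient of the decoupled generators labelled by `Z` in the undecoupled generator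
labelled by the first loop, without the contribution of the punctures and handles behind it. -/
def localCoeff : Loop n g → Loop n g → VecAlg d G n g →ₗ[CoeffAlg d G n g] VecAlg d G n g
  | .M i, Z => if Z = .M i then LinearMap.id else 0
  | .A i, Z => if Z = .A i then LinearMap.id - adV b (hol (.A i))⁻¹ else
      if Z = .B i then LinearMap.id else 0
  | .B i, Z => if Z = .A i then -adV b (hol (.A i))⁻¹ else
      if Z = .B i then LinearMap.id else 0

/-- The coefficients of the generator of the simultaneous conjugation of all components at position
at least `N`. -/
def tailCoeff (N : ℕ) (Z : Loop n g) : VecAlg d G n g →ₗ[CoeffAlg d G n g] VecAlg d G n g :=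
  if N ≤ Z.pos then LinearMap.id - psi b Z else 0

/-- The generator of the simultaneous conjugation of all components at position at least `N`. -/
def tailSect (N : ℕ) : VecAlg d G n g →ₗ[CoeffAlg d G n g] Sect d G n g :=
  LinearMap.pi (tailCoeff b N)

/-- The coefficients of the undecoupled generators with respect to the decoupled ones. -/
def genCoeff (X Z : Loop n g) : VecAlg d G n g →ₗ[CoeffAlg d G n g] VecAlg d G n g :=
  localCoeff b X Z + tailCoeff b (X.pos + 1) Z ∘ₗ (LinearMap.id - adV b (hol X))

/-- The undecoupled generators in terms of the decoupled ones. -/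
def genSect (X : Loop n g) : VecAlg d G n g →ₗ[CoeffAlg d G n g] Sect d G n g :=
  LinearMap.pi (genCoeff b X)

/-- The bracket of the undecoupled generators with functions. -/
def genDer (X : Loop n g) : VecAlg d G n g →ₗ[CoeffAlg d G n g]
    Derivation ℂ (CoeffAlg d G n g) (CoeffAlg d G n g) := contract (brGenFn b X)

/-- The derivation `F ↦ -Σ_Y (J^{R_Y} + J^{L_Y}) F`, the sum being over the loops at position at
least `N`. -/
def conjDer (N : ℕ) : VecAlg d G n g →ₗ[CoeffAlg d G n g]
    Derivation ℂ (CoeffAlg d G n g) (CoeffAlg d G n g) :=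
  -∑ Y : Loop n g with N ≤ Y.pos, (derR b Y + derL b Y)

theorem conjDer_apply (N : ℕ) (v : VecAlg d G n g) :
    conjDer b N v = -∑ Y : Loop n g with N ≤ Y.pos, (derR b Y v + derL b Y v) := by
  simp [conjDer, LinearMap.sum_apply]

/-- On a puncture the copy M_i already acts by conjugation. On a handle the terms with `psi` are
left translations in disguise, by `derL_eq`. They complete the right translations of u_A and u_B in
direction v to conjugations, the unwanted left translation of u_B in direction Ad(u_A)v cancelling
between the copies A_i and B_i. -/
theorem anchor_tailSect (N : ℕ) (v : VecAlg d G n g) :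
    anchor b (tailSect b N v) = conjDer b N v := by
  have hL : ∀ (i : Fin g) (v : VecAlg d G n g),
      derR b (.B i) (adV b (hol (.B i))⁻¹ v) = -derL b (.B i) v := fun i v => by
    rw [derL_eq, neg_neg]
  rw [anchor_apply, conjDer_apply, Finset.sum_filter, Loop.sum_eq, Loop.sum_eq]
  congr 2
  · refine Finset.sum_congr rfl fun i _ => ?_
    simp only [tailSect, LinearMap.pi_apply, tailCoeff]
    split_ifs with h
    · simp [psi, derSlot_M]
    · simp
  · refine Finset.sum_congr rfl fun i _ => ?_
    simp only [tailSect, LinearMap.pi_apply, tailCoeff]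
    by_cases h : N ≤ (.A i : Loop n g).pos
    · have h' : N ≤ (.B i : Loop n g).pos := h
      simp only [h, h', if_true, psi, LinearMap.sub_apply, LinearMap.id_apply, map_sub, derSlot_A, derSlot_B,
        adV_mul, adV_adV_inv, hL, derL_eq b (.A i)]
      abel
    · have h' : ¬N ≤ (.B i : Loop n g).pos := h
      simp [h, h']

theorem genSect_eq (X : Loop n g) (v : VecAlg d G n g) :
    genSect b X v = (fun Z => localCoeff b X Z v) + tailSect b (X.pos + 1) (v - adV b (hol X) v) :=
  rfl

theorem genDer_eq (X : Loop n g) (v : VecAlg d G n g) : genDer b X v = (match X with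
  | .M i => -(derR b (.M i) v + derL b (.M i) v)
  | .A i => -(derR b (.A i) v + derL b (.A i) v) - (derR b (.B i) v + derL b (.B i) v) -
      derR b (.B i) (adV b ((hol (.B i))⁻¹ * hol (.A i)) v)
  | .B i => -derL b (.A i) v - (derR b (.B i) v + derL b (.B i) v)) +
    conjDer b (X.pos + 1) (v - adV b (hol X) v) := by
  have h1 : conjDer b (X.pos + 1) (v - adV b (hol X) v) =
      -contract (fun a => ∑ c, (1 - adStar b (hol X)) a c • vecAfter b X c) v := by
    rw [← contract_vecMul, Matrix.vecMul_sub, Matrix.vecMul_one, ← adV_apply, conjDer_apply]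
    congr 1
    have h : ∀ w : VecAlg d G n g, contract (vecAfter b X) w =
        ∑ Y : Loop n g with X.pos + 1 ≤ Y.pos, (derR b Y w + derL b Y w) := fun w => by
      simp only [contract_apply, vecAfter, derR, derL, Finset.smul_sum, smul_add,
        ← Finset.sum_add_distrib]
      exact Finset.sum_comm
    rw [h]
  rw [h1]
  cases X with
  | M i =>
    simp only [genDer, derR, derL, contract_apply, brGenFn, smul_sub, smul_neg, smul_add,
      Finset.sum_sub_distrib, Finset.sum_neg_distrib, Finset.sum_add_distrib]
    abel
  | A i =>
    have h2 : derR b (.B i) (adV b ((hol (.B i))⁻¹ * hol (.A i)) v) = contract (fun a => ∑ c,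
        adStar b ((hol (.B i) : Word d G n g)⁻¹ * hol (.A i)) a c • vecR b (.B i) c) v := by
      rw [adV_apply, derR, contract_vecMul]
    dsimp only
    rw [h2]
    simp only [genDer, derR, derL, contract_apply, brGenFn, smul_sub, smul_neg, smul_add,
      Finset.sum_sub_distrib, Finset.sum_neg_distrib, Finset.sum_add_distrib]
    abel
  | B i =>
    simp only [genDer, derR, derL, contract_apply, brGenFn, smul_sub, smul_neg, smul_add,
      Finset.sum_sub_distrib, Finset.sum_neg_distrib, Finset.sum_add_distrib]
    abel

/-- The undecoupled generators act on functions by the brackets of the flower algebra. -/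
theorem anchor_genSect (X : Loop n g) (v : VecAlg d G n g) :
    anchor b (genSect b X v) = genDer b X v := by
  rw [genSect_eq, map_add, anchor_tailSect, genDer_eq, anchor_apply]
  congr 1
  rw [Loop.sum_eq]
  cases X with
  | M i =>
    simp only [localCoeff, Loop.M.injEq, reduceCtorEq, if_false]
    rw [Finset.sum_eq_single i]
    · simp [derSlot_M]
    · intro j _ hj; simp [hj]
    · simp
  | A i =>
    simp only [localCoeff, Loop.A.injEq, Loop.B.injEq, reduceCtorEq, if_false]
    rw [Finset.sum_eq_single i (fun j _ hj => by simp [hj]) (by simp)]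
    -- The right translation of u_B in direction Ad(u_B⁻¹u_A)v in the flower bracket is minus the
    -- left translation in direction Ad(u_A)v, which is what the copy A_i contributes on u_B.
    simp [derSlot_A, derSlot_B, adV_mul, adV_adV_inv, derL_eq]
    abel
  | B i =>
    simp only [localCoeff, Loop.A.injEq, Loop.B.injEq, reduceCtorEq, if_false]
    rw [Finset.sum_eq_single i (fun j _ hj => by simp [hj]) (by simp)]
    simp [derSlot_A, derSlot_B, adV_adV_inv, derL_eq]
    abel

end
end FlowerAlgebra

/-! ### Variation of the holonomies under the undecoupled generators. -/

namespace FlowerAlgebra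
open Function

noncomputable section
variable {d : ℕ} {G : Type*} [TopologicalSpace G]
    [ChartedSpace (EuclideanSpace ℝ (Fin d)) G] [Group G] [LieGroup (𝓡 d) ∞ G] [T2Space G]
    {n g : ℕ} (b : Module.Basis (Fin d) ℝ (GroupLieAlgebra (𝓡 d) G))

/-- The derivative of the adjoint action of a word along a derivation. -/
def adVDer (D : Derivation ℂ (CoeffAlg d G n g) (CoeffAlg d G n g)) (w : Word d G n g)
    (v : VecAlg d G n g) : VecAlg d G n g := derVec D (adV b w v) - adV b w (derVec D v)

theorem derVec_adV (D : Derivation ℂ (CoeffAlg d G n g) (CoeffAlg d G n g)) (w : Word d G n g)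
    (v : VecAlg d G n g) : derVec D (adV b w v) = adV b w (derVec D v) + adVDer b D w v := by
  rw [adVDer, add_sub_cancel]

theorem adVDer_add (D D' : Derivation ℂ (CoeffAlg d G n g) (CoeffAlg d G n g)) (w : Word d G n g)
    (v : VecAlg d G n g) : adVDer b (D + D') w v = adVDer b D w v + adVDer b D' w v := by
  simp only [adVDer, derVec_add_left, map_add]
  abel

theorem adVDer_sub (D D' : Derivation ℂ (CoeffAlg d G n g) (CoeffAlg d G n g)) (w : Word d G n g)
    (v : VecAlg d G n g) : adVDer b (D - D') w v = adVDer b D w v - adVDer b D' w v := by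
  simp only [adVDer, derVec_sub_left, map_sub]
  abel

theorem adVDer_neg (D : Derivation ℂ (CoeffAlg d G n g) (CoeffAlg d G n g)) (w : Word d G n g)
    (v : VecAlg d G n g) : adVDer b (-D) w v = -adVDer b D w v := by
  simp only [adVDer, derVec_neg_left, map_neg]
  abel

theorem adVDer_sum {ι : Type*} (s : Finset ι)
    (D : ι → Derivation ℂ (CoeffAlg d G n g) (CoeffAlg d G n g)) (w : Word d G n g)
    (v : VecAlg d G n g) : adVDer b (∑ i ∈ s, D i) w v = ∑ i ∈ s, adVDer b (D i) w v := by
  simp only [adVDer, derVec_sum_left, map_sum, Finset.sum_sub_distrib]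

theorem adVDer_derR_self (X : Loop n g) (v w : VecAlg d G n g) :
    adVDer b (derR b X v) (hol X) w = adV b (hol X) (lieV b v w) := by
  rw [adVDer, derR_adV_self, add_sub_cancel_left]

theorem adVDer_derL_self (X : Loop n g) (v w : VecAlg d G n g) :
    adVDer b (derL b X v) (hol X) w = -lieV b v (adV b (hol X) w) := by
  rw [adVDer, derL_adV_self, sub_sub_cancel_left]

theorem adVDer_derR_of_ne {X Y : Loop n g} (h : X ≠ Y) (v w : VecAlg d G n g) :
    adVDer b (derR b X v) (hol Y) w = 0 := by
  rw [adVDer, derR_adV_of_ne b h, sub_self]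

theorem adVDer_derL_of_ne {X Y : Loop n g} (h : X ≠ Y) (v w : VecAlg d G n g) :
    adVDer b (derL b X v) (hol Y) w = 0 := by
  rw [adVDer, derL_adV_of_ne b h, sub_self]

/-- `conjDer` differentiates u_Z along conjugation by exp(tm), so Ad(u_Z) changes by its commutator
with ad m; loops in front of position N are fixed. -/
theorem adVDer_conjDer (N : ℕ) (Z : Loop n g) (m w : VecAlg d G n g) :
    adVDer b (conjDer b N m) (hol Z) w =
      if N ≤ Z.pos then lieV b m (adV b (hol Z) w) - adV b (hol Z) (lieV b m w) else 0 := by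
  have h : ∀ Y : Loop n g, adVDer b (derR b Y m + derL b Y m) (hol Z) w =
        if Y = Z then adV b (hol Z) (lieV b m w) - lieV b m (adV b (hol Z) w) else 0 := fun Y => by
    split_ifs with hY
    · rw [hY, adVDer_add, adVDer_derR_self, adVDer_derL_self, sub_eq_add_neg]
    · rw [adVDer_add, adVDer_derR_of_ne b hY, adVDer_derL_of_ne b hY, add_zero]
  rw [conjDer_apply, adVDer_neg, adVDer_sum, Finset.sum_congr rfl fun Y _ => h Y,
    Finset.sum_ite_eq']
  simp only [Finset.mem_filter, Finset.mem_univ, true_and]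
  split_ifs <;> abel

theorem adVDer_conjDer_succ {X Z : Loop n g} (h : Z.pos ≤ X.pos) (m w : VecAlg d G n g) :
    adVDer b (conjDer b (X.pos + 1) m) (hol Z) w = 0 := by
  rw [adVDer_conjDer, if_neg (by omega)]

/-- The local part of the generator moves only the components at the position of X, so elsewhere the
conjugation of the later components is all that is left. -/
theorem adVDer_genDer_of_pos_ne {X Z : Loop n g} (h : X.pos ≠ Z.pos) (v w : VecAlg d G n g) :
    adVDer b (genDer b X v) (hol Z) w =
      adVDer b (conjDer b (X.pos + 1) (v - adV b (hol X) v)) (hol Z) w := by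
  have hne : ∀ Y : Loop n g, Y.pos = X.pos → Y ≠ Z := by rintro Y hY rfl; exact h hY.symm
  rw [genDer_eq, adVDer_add, add_eq_right]
  cases X with
  | M i =>
    simp only [adVDer_neg, adVDer_add, adVDer_derR_of_ne b (hne (.M i) rfl),
      adVDer_derL_of_ne b (hne (.M i) rfl), add_zero, neg_zero]
  | A i =>
    simp only [adVDer_neg, adVDer_sub, adVDer_add, adVDer_derR_of_ne b (hne (.A i) rfl),
      adVDer_derL_of_ne b (hne (.A i) rfl), adVDer_derR_of_ne b (hne (.B i) rfl),
      adVDer_derL_of_ne b (hne (.B i) rfl), add_zero, neg_zero, sub_zero]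
  | B i =>
    simp only [adVDer_neg, adVDer_sub, adVDer_add,
      adVDer_derL_of_ne b (hne (.A i) rfl), adVDer_derR_of_ne b (hne (.B i) rfl),
      adVDer_derL_of_ne b (hne (.B i) rfl), add_zero, neg_zero, sub_zero]

theorem adVDer_genDer_of_pos_lt {X Z : Loop n g} (h : Z.pos < X.pos) (v w : VecAlg d G n g) :
    adVDer b (genDer b X v) (hol Z) w = 0 := by
  rw [adVDer_genDer_of_pos_ne b h.ne', adVDer_conjDer_succ b h.le]

theorem adVDer_genDer_of_lt_pos {X Z : Loop n g} (h : X.pos < Z.pos) (v w : VecAlg d G n g) :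
    adVDer b (genDer b X v) (hol Z) w = lieV b (v - adV b (hol X) v) (adV b (hol Z) w) -
        adV b (hol Z) (lieV b (v - adV b (hol X) v) w) := by
  rw [adVDer_genDer_of_pos_ne b h.ne, adVDer_conjDer, if_pos (Nat.succ_le_of_lt h)]

theorem adVDer_genDer_M_M (i : Fin n) (v w : VecAlg d G n g) :
    adVDer b (genDer b (.M i) v) (hol (.M i)) w =
      lieV b v (adV b (hol (.M i)) w) - adV b (hol (.M i)) (lieV b v w) := by
  rw [genDer_eq, adVDer_add, adVDer_conjDer_succ b le_rfl, adVDer_neg, adVDer_add,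
    adVDer_derR_self, adVDer_derL_self]
  abel

theorem adVDer_genDer_A_A (i : Fin g) (v w : VecAlg d G n g) :
    adVDer b (genDer b (.A i) v) (hol (.A i)) w =
      lieV b v (adV b (hol (.A i)) w) - adV b (hol (.A i)) (lieV b v w) := by
  have hne : (.B i : Loop n g) ≠ .A i := by simp
  rw [genDer_eq, adVDer_add, adVDer_conjDer_succ b le_rfl]
  simp only [adVDer_neg, adVDer_add, adVDer_sub,
    adVDer_derR_self, adVDer_derL_self, adVDer_derR_of_ne b hne, adVDer_derL_of_ne b hne]
  abel

/-- The generator of B_i translates u_A on the left only, so no term with the bracket inside Ad(u_A)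
occurs. -/
theorem adVDer_genDer_B_A (i : Fin g) (v w : VecAlg d G n g) :
    adVDer b (genDer b (.B i) v) (hol (.A i)) w = lieV b v (adV b (hol (.A i)) w) := by
  have hne : (.B i : Loop n g) ≠ .A i := by simp
  rw [genDer_eq, adVDer_add, adVDer_conjDer_succ b (Z := .A i) (X := .B i) le_rfl]
  simp only [adVDer_neg, adVDer_add, adVDer_sub,
    adVDer_derL_self, adVDer_derR_of_ne b hne, adVDer_derL_of_ne b hne]
  abel

theorem adVDer_genDer_B_B (i : Fin g) (v w : VecAlg d G n g) :
    adVDer b (genDer b (.B i) v) (hol (.B i)) w =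
      lieV b v (adV b (hol (.B i)) w) - adV b (hol (.B i)) (lieV b v w) := by
  have hne : (.A i : Loop n g) ≠ .B i := by simp
  rw [genDer_eq, adVDer_add, adVDer_conjDer_succ b le_rfl]
  simp only [adVDer_neg, adVDer_add, adVDer_sub,
    adVDer_derR_self, adVDer_derL_self, adVDer_derL_of_ne b hne]
  abel

/-- Besides conjugating u_B, the generator of A_i translates it on the right in direction
Ad(u_B⁻¹u_A)v. Moving Ad(u_B) into the bracket turns this into the last term. -/
theorem adVDer_genDer_A_B (i : Fin g) (v w : VecAlg d G n g) :
    adVDer b (genDer b (.A i) v) (hol (.B i)) w =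
      lieV b v (adV b (hol (.B i)) w) - adV b (hol (.B i)) (lieV b v w) -
          lieV b (adV b (hol (.A i)) v) (adV b (hol (.B i)) w) := by
  have hne : (.A i : Loop n g) ≠ .B i := by simp
  rw [genDer_eq, adVDer_add, adVDer_conjDer_succ b (Z := .B i) (X := .A i) le_rfl]
  simp only [adVDer_neg, adVDer_add, adVDer_sub, adVDer_derR_self, adVDer_derL_self,
    adVDer_derR_of_ne b hne, adVDer_derL_of_ne b hne]
  rw [adV_lieV b _ (adV b _ v), adV_mul, adV_adV_inv]
  abel

end
end FlowerAlgebra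

/-! ### Brackets of the undecoupled generators. -/

namespace FlowerAlgebra
open Function

noncomputable section
variable {d : ℕ} {G : Type*} [TopologicalSpace G]
    [ChartedSpace (EuclideanSpace ℝ (Fin d)) G] [Group G] [LieGroup (𝓡 d) ∞ G] [T2Space G]
    {n g : ℕ} (b : Module.Basis (Fin d) ℝ (GroupLieAlgebra (𝓡 d) G))

theorem Loop.pos_eq_cases {X Z : Loop n g} (h : X.pos = Z.pos) :
    (∃ i, X = .M i ∧ Z = .M i) ∨ ∃ i, (X = .A i ∨ X = .B i) ∧ (Z = .A i ∨ Z = .B i) := by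
  rcases X with i | i | i <;> rcases Z with j | j | j <;> simp only [Loop.pos] at h
  · exact .inl ⟨i, rfl, congrArg _ (Fin.ext (by omega))⟩
  · omega
  · omega
  · omega
  · exact .inr ⟨i, .inl rfl, .inl (congrArg _ (Fin.ext (by omega)))⟩
  · exact .inr ⟨i, .inl rfl, .inr (congrArg _ (Fin.ext (by omega)))⟩
  · omega
  · exact .inr ⟨i, .inr rfl, .inl (congrArg _ (Fin.ext (by omega)))⟩
  · exact .inr ⟨i, .inr rfl, .inr (congrArg _ (Fin.ext (by omega)))⟩

theorem localCoeff_of_pos_ne {X Z : Loop n g} (h : X.pos ≠ Z.pos) : localCoeff b X Z = 0 := by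
  have hne : ∀ Y : Loop n g, Y.pos = X.pos → Z ≠ Y := by rintro Y hY rfl; exact h hY.symm
  cases X with
  | M i => exact if_neg (hne (.M i) rfl)
  | A i => exact (if_neg (hne (.A i) rfl)).trans (if_neg (hne (.B i) rfl))
  | B i => exact (if_neg (hne (.A i) rfl)).trans (if_neg (hne (.B i) rfl))

/-- The coefficients are block triangular in the position: they vanish in front of X, are local at
the position of X, and factor as (1 - psi_Z)(1 - Ad(u_X)) behind it. -/
theorem genCoeff_of_pos_lt {X Z : Loop n g} (h : Z.pos < X.pos) : genCoeff b X Z = 0 := by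
  rw [genCoeff, localCoeff_of_pos_ne b h.ne', tailCoeff, if_neg (by omega), LinearMap.zero_comp,
    add_zero]

theorem genCoeff_of_lt_pos {X Z : Loop n g} (h : X.pos < Z.pos) : genCoeff b X Z =
    (LinearMap.id - psi b Z) ∘ₗ (LinearMap.id - adV b (hol X)) := by
  rw [genCoeff, localCoeff_of_pos_ne b h.ne, tailCoeff, if_pos (by omega), zero_add]

theorem genCoeff_of_pos_eq {X Z : Loop n g} (h : X.pos = Z.pos) :
    genCoeff b X Z = localCoeff b X Z := by
  rw [genCoeff, tailCoeff, if_neg (by omega), LinearMap.zero_comp, add_zero]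

theorem genCoeff_M_M (i : Fin n) :
    genCoeff b (.M i : Loop n g) (.M i) = LinearMap.id := by
  rw [genCoeff_of_pos_eq b rfl]
  exact if_pos rfl

theorem genCoeff_A_A (i : Fin g) : genCoeff b (.A i : Loop n g) (.A i) =
    LinearMap.id - adV b (hol (.A i))⁻¹ := by
  rw [genCoeff_of_pos_eq b rfl]
  exact if_pos rfl

theorem genCoeff_A_B (i : Fin g) : genCoeff b (.A i : Loop n g) (.B i) = LinearMap.id := by
  rw [genCoeff_of_pos_eq b (by rfl)]
  simp [localCoeff]

theorem genCoeff_B_A (i : Fin g) : genCoeff b (.B i : Loop n g) (.A i) =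
    -adV b (hol (.A i))⁻¹ := by
  rw [genCoeff_of_pos_eq b (by rfl)]
  exact if_pos rfl

theorem genCoeff_B_B (i : Fin g) : genCoeff b (.B i : Loop n g) (.B i) = LinearMap.id := by
  rw [genCoeff_of_pos_eq b (by rfl)]
  simp [localCoeff]

/-- The operator `φ` commutes with `D - ad m`. -/
def IsEquivariant (D : Derivation ℂ (CoeffAlg d G n g) (CoeffAlg d G n g)) (m : VecAlg d G n g)
    (φ : VecAlg d G n g →ₗ[CoeffAlg d G n g] VecAlg d G n g) : Prop :=
  ∀ w, derVec D (φ w) - lieV b m (φ w) = φ (derVec D w - lieV b m w)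

namespace IsEquivariant
variable {b} {D : Derivation ℂ (CoeffAlg d G n g) (CoeffAlg d G n g)} {m : VecAlg d G n g}
  {φ φ' : VecAlg d G n g →ₗ[CoeffAlg d G n g] VecAlg d G n g}

theorem zero : IsEquivariant b D m 0 := fun w => by
  simp only [LinearMap.zero_apply, map_zero, sub_zero]

theorem id : IsEquivariant b D m LinearMap.id := fun _ => rfl

theorem sub (h : IsEquivariant b D m φ) (h' : IsEquivariant b D m φ') :
    IsEquivariant b D m (φ - φ') := fun w => by
  rw [LinearMap.sub_apply, map_sub, map_sub, sub_sub_sub_comm, h, h', LinearMap.sub_apply]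

theorem comp (h : IsEquivariant b D m φ) (h' : IsEquivariant b D m φ') :
    IsEquivariant b D m (φ ∘ₗ φ') := fun w => by
  rw [LinearMap.comp_apply, h, h', LinearMap.comp_apply]

theorem adV_inv {w : Word d G n g} (h : IsEquivariant b D m (adV b w)) :
    IsEquivariant b D m (adV b w⁻¹) := fun v => by
  have := congrArg (adV b w⁻¹) (h (adV b w⁻¹ v))
  rw [adV_inv_adV, adV_adV_inv] at this
  exact this.symm

theorem adV_mul {w w' : Word d G n g} (h : IsEquivariant b D m (adV b w))
    (h' : IsEquivariant b D m (adV b w')) : IsEquivariant b D m (adV b (w * w')) := fun v => by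
  rw [FlowerAlgebra.adV_mul, h, h', FlowerAlgebra.adV_mul]

end IsEquivariant

/-- The generator of X conjugates every later holonomy infinitesimally with m = v - Ad(u_X)v.
Subtracting ad m compensates exactly for this. -/
theorem isEquivariant_hol {X Z : Loop n g} (h : X.pos < Z.pos) (v : VecAlg d G n g) :
    IsEquivariant b (genDer b X v) (v - adV b (hol X) v) (adV b (hol Z)) := fun w => by
  rw [derVec_adV, adVDer_genDer_of_lt_pos b h, map_sub (adV b (hol Z))]
  abel

theorem isEquivariant_psi {X Z : Loop n g} (h : X.pos < Z.pos) (v : VecAlg d G n g) :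
    IsEquivariant b (genDer b X v) (v - adV b (hol X) v) (psi b Z) := by
  cases Z with
  | M i => exact .zero
  | A i => exact (isEquivariant_hol b h v).adV_inv
  | B i => exact (isEquivariant_hol b h v).adV_inv.adV_mul (isEquivariant_hol b (Z := .A i) h v)

/-- For Y behind X, the coefficients of the generator of Y involve only holonomies behind X, and
equivariance passes to differences, compositions and inverses. -/
theorem isEquivariant_genCoeff {X Y : Loop n g} (h : X.pos < Y.pos) (v : VecAlg d G n g)
    (Z : Loop n g) :
    IsEquivariant b (genDer b X v) (v - adV b (hol X) v) (genCoeff b Y Z) := by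
  have hY := isEquivariant_hol b h v
  rcases lt_trichotomy Y.pos Z.pos with hZ | hZ | hZ
  · rw [genCoeff_of_lt_pos b hZ]
    exact (IsEquivariant.id.sub (isEquivariant_psi b (h.trans hZ) v)).comp (.sub .id hY)
  · obtain ⟨i, rfl, rfl⟩ | ⟨i, rfl | rfl, rfl | rfl⟩ := Loop.pos_eq_cases hZ
    · rw [genCoeff_M_M]; exact .id
    · rw [genCoeff_A_A]; exact .sub .id hY.adV_inv
    · rw [genCoeff_A_B]; exact .id
    · rw [genCoeff_B_A, ← zero_sub]
      exact .sub .zero (isEquivariant_hol b (X := X) (Z := .A i) h v).adV_inv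
    · rw [genCoeff_B_B]; exact .id
  · rw [genCoeff_of_pos_lt b hZ]; exact .zero

theorem genDer_psi (X Z : Loop n g) (v m : VecAlg d G n g) :
    derVec (genDer b X v) (psi b Z m) =
      psi b Z (derVec (genDer b X v) m) + lieV b (genCoeff b X Z v) (psi b Z m) := by
  rw [← anchor_genSect, anchor_psi]
  rfl

theorem sectBr_genSect_apply (X Y Z : Loop n g) (v w : VecAlg d G n g) :
    sectBr b (genSect b X v) (genSect b Y w) Z =
      -lieV b (genCoeff b X Z v) (genCoeff b Y Z w) + derVec (genDer b X v) (genCoeff b Y Z w) -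
        derVec (genDer b Y w) (genCoeff b X Z v) := by
  simp only [sectBr, anchor_genSect]
  rfl

/-- The bracket of two undecoupled generators attached to different punctures or handles. -/
theorem sectBr_genSect_of_pos_lt {X Y : Loop n g} (h : X.pos < Y.pos) {v w : VecAlg d G n g}
    (hv : ∀ D, derVec D v = 0) (hw : ∀ D, derVec D w = 0) :
    sectBr b (genSect b X v) (genSect b Y w) =
      -genSect b Y (lieV b (v - adV b (hol X) v) w) := by
  funext Z
  rw [sectBr_genSect_apply]
  change _ = -genCoeff b Y Z (lieV b (v - adV b (hol X) v) w)
  have hY : ∀ Z : Loop n g, Z.pos < Y.pos → ∀ x, derVec (genDer b Y w) (adV b (hol Z) x) =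
      adV b (hol Z) (derVec (genDer b Y w) x) := fun Z hZ x => by
    rw [derVec_adV, adVDer_genDer_of_pos_lt b hZ, add_zero]
  rcases lt_or_ge X.pos Z.pos with hZ | hZ
  · have h1 := isEquivariant_genCoeff b h v Z w
    -- Since w is constant, equivariance of φ = `genCoeff b Y Z` reads D(φw) = [m, φw] - φ[m, w].
    have h2 : derVec (genDer b X v) (genCoeff b Y Z w) =
        lieV b (v - adV b (hol X) v) (genCoeff b Y Z w) -
          genCoeff b Y Z (lieV b (v - adV b (hol X) v) w) := by
      rw [hw, zero_sub, map_neg, sub_eq_iff_eq_add] at h1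
      rw [h1]
      abel
    have h3 : derVec (genDer b Y w) (v - adV b (hol X) v) = 0 := by
      rw [map_sub, hY X h, hv, map_zero, sub_zero]
    rw [h2, genCoeff_of_lt_pos b hZ]
    simp only [LinearMap.comp_apply, LinearMap.sub_apply, LinearMap.id_apply]
    -- From here v enters only through m, which the generator of Y does not move. The terms [m, φw]
    -- and [psi_Z m, φw] cancel against those of -[(1 - psi_Z)m, φw], and -φ[m, w] is left.
    generalize v - adV b (hol X) v = m at *
    rw [map_sub (derVec _), genDer_psi, h3, map_zero, map_sub (lieV b), LinearMap.sub_apply,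
      lieV_skew b (psi b Z m)]
    abel
  -- At or in front of X the generator of Y has no component, and that of X involves at most the u_A
  -- at its own position, which Y does not move.
  · have h1 : genCoeff b Y Z = 0 := genCoeff_of_pos_lt b (hZ.trans_lt h)
    have h2 : derVec (genDer b Y w) (genCoeff b X Z v) = 0 := by
      rcases hZ.lt_or_eq with hZ | hZ
      · rw [genCoeff_of_pos_lt b hZ, LinearMap.zero_apply, map_zero]
      · have hA : ∀ i, (Loop.A i : Loop n g).pos = X.pos → derVec (genDer b Y w)
            (adV b (hol (.A i))⁻¹ v) = 0 := fun i hi => by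
          rw [derVec_adV_inv_of_comm b (hY _ (hi ▸ h)), hv, map_zero]
        obtain ⟨i, rfl, rfl⟩ | ⟨i, rfl | rfl, rfl | rfl⟩ := Loop.pos_eq_cases hZ.symm
        · rw [genCoeff_M_M, LinearMap.id_apply, hv]
        · rw [genCoeff_A_A, LinearMap.sub_apply, LinearMap.id_apply, map_sub, hA i rfl, hv,
            sub_zero]
        · rw [genCoeff_A_B, LinearMap.id_apply, hv]
        · rw [genCoeff_B_A, LinearMap.neg_apply, map_neg, hA i rfl, neg_zero]
        · rw [genCoeff_B_B, LinearMap.id_apply, hv]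
    rw [h2, h1]
    simp only [LinearMap.zero_apply, map_zero, neg_zero, add_zero, sub_zero]

/-- The contribution of the later punctures and handles to the bracket of two undecoupled generators
attached to the same puncture or handle. -/
theorem sectBr_genSect_apply_of_lt_pos {X Y Z : Loop n g} (hX : X.pos < Z.pos) (hY : Y.pos < Z.pos)
    {v w : VecAlg d G n g} (hv : ∀ D, derVec D v = 0) (hw : ∀ D, derVec D w = 0) :
    sectBr b (genSect b X v) (genSect b Y w) Z =
      (LinearMap.id - psi b Z : VecAlg d G n g →ₗ[CoeffAlg d G n g] VecAlg d G n g) (adVDer b (genDer b Y w) (hol X) v -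
        adVDer b (genDer b X v) (hol Y) w -
          lieV b (v - adV b (hol X) v) (w - adV b (hol Y) w)) := by
  have h1 : derVec (genDer b X v) (w - adV b (hol Y) w) = -adVDer b (genDer b X v) (hol Y) w := by
    rw [map_sub, derVec_adV, hw, map_zero, zero_add, zero_sub]
  have h2 : derVec (genDer b Y w) (v - adV b (hol X) v) = -adVDer b (genDer b Y w) (hol X) v := by
    rw [map_sub, derVec_adV, hv, map_zero, zero_add, zero_sub]
  have h3 := genDer_psi b X Z v (w - adV b (hol Y) w)
  have h4 := genDer_psi b Y Z w (v - adV b (hol X) v)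
  rw [h1, genCoeff_of_lt_pos b hX] at h3
  rw [h2, genCoeff_of_lt_pos b hY] at h4
  rw [sectBr_genSect_apply, genCoeff_of_lt_pos b hX, genCoeff_of_lt_pos b hY]
  simp only [LinearMap.comp_apply, LinearMap.sub_apply, LinearMap.id_apply] at h3 h4 ⊢
  -- With m and k the two directions and ψ = `psi b Z`, each derivative of ψk or ψm is ψ of a
  -- derivative plus a bracket with (1 - ψ)m or (1 - ψ)k. All mixed brackets cancel, leaving -[m, k]
  -- + [ψm, ψk], which is -(1 - ψ)[m, k] because ψ preserves brackets.
  generalize v - adV b (hol X) v = m at *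
  generalize w - adV b (hol Y) w = k at *
  rw [map_sub (derVec _), map_sub (derVec _), h1, h2, h3, h4]
  simp only [map_sub, map_neg, LinearMap.sub_apply, psi_lieV]
  rw [lieV_skew b k, lieV_skew b (psi b Z k)]
  abel

/-- The bracket of two undecoupled generators attached to the same puncture or handle is determined
by its components there and by its action on the later punctures and handles. -/
theorem sectBr_genSect_of_tail {X Y W : Loop n g} (hXY : X.pos = Y.pos) (hXW : X.pos = W.pos)
    {v w : VecAlg d G n g}
    (hv : ∀ D, derVec D v = 0) (hw : ∀ D, derVec D w = 0)
    (hloc : ∀ Z, X.pos = Z.pos → sectBr b (genSect b X v) (genSect b Y w) Z =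
      -genCoeff b W Z (lieV b v w))
    (htail : adVDer b (genDer b Y w) (hol X) v - adVDer b (genDer b X v) (hol Y) w -
          lieV b (v - adV b (hol X) v) (w - adV b (hol Y) w) =
        -(lieV b v w - adV b (hol W) (lieV b v w))) :
    sectBr b (genSect b X v) (genSect b Y w) = -genSect b W (lieV b v w) := by
  funext Z
  change _ = -genCoeff b W Z (lieV b v w)
  rcases lt_trichotomy X.pos Z.pos with hZ | hZ | hZ
  · rw [sectBr_genSect_apply_of_lt_pos b hZ (hXY ▸ hZ) hv hw, htail, map_neg,
      genCoeff_of_lt_pos b (hXW ▸ hZ)]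
    rfl
  · exact hloc Z hZ
  · rw [sectBr_genSect_apply, genCoeff_of_pos_lt b hZ, genCoeff_of_pos_lt b (hXY ▸ hZ),
      genCoeff_of_pos_lt b (hXW ▸ hZ)]
    simp only [LinearMap.zero_apply, map_zero, neg_zero, add_zero, sub_zero]

theorem Loop.eq_M_of_pos_eq {i : Fin n} {Z : Loop n g} (h : (Loop.M i : Loop n g).pos = Z.pos) :
    Z = .M i := by
  obtain ⟨j, h1, h2⟩ | ⟨j, h1 | h1, _⟩ := Loop.pos_eq_cases h
  · rw [h1, h2]
  · cases h1
  · cases h1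

theorem Loop.eq_A_or_B_of_pos_eq {i : Fin g} {Z : Loop n g}
    (h : (Loop.A i : Loop n g).pos = Z.pos) : Z = .A i ∨ Z = .B i := by
  obtain ⟨j, h1, _⟩ | ⟨j, h1 | h1, h2⟩ := Loop.pos_eq_cases h
  · cases h1
  · cases h1; exact h2
  · cases h1

theorem sectBr_genSect_M {v w : VecAlg d G n g} (i : Fin n) (hv : ∀ D, derVec D v = 0)
    (hw : ∀ D, derVec D w = 0) :
    sectBr b (genSect b (.M i) v) (genSect b (.M i) w) = -genSect b (.M i) (lieV b v w) := by
  refine sectBr_genSect_of_tail b rfl rfl hv hw (fun Z hZ => ?_) ?_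
  · rw [Loop.eq_M_of_pos_eq hZ, sectBr_genSect_apply, genCoeff_M_M]
    simp only [LinearMap.id_apply, hv, hw, add_zero, sub_zero]
  · rw [adVDer_genDer_M_M, adVDer_genDer_M_M]
    simp only [map_sub, LinearMap.sub_apply, adV_lieV]
    rw [lieV_skew b w (adV b (hol (.M i)) v),
      lieV_skew b (adV b (hol (.M i)) w) (adV b (hol (.M i)) v)]
    abel

theorem derVec_adV_inv_const {v : VecAlg d G n g} (hv : ∀ D, derVec D v = 0)
    (D : Derivation ℂ (CoeffAlg d G n g) (CoeffAlg d G n g)) (w : Word d G n g) :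
    derVec D (adV b w⁻¹ v) = -adV b w⁻¹ (adVDer b D w (adV b w⁻¹ v)) := by
  rw [derVec_adV_inv b (derVec_adV b D w), hv, map_zero, zero_sub]

theorem sectBr_genSect_A_A {v w : VecAlg d G n g} (i : Fin g) (hv : ∀ D, derVec D v = 0)
    (hw : ∀ D, derVec D w = 0) :
    sectBr b (genSect b (.A i) v) (genSect b (.A i) w) = -genSect b (.A i) (lieV b v w) := by
  refine sectBr_genSect_of_tail b rfl rfl hv hw (fun Z hZ => ?_) ?_
  · obtain rfl | rfl := Loop.eq_A_or_B_of_pos_eq hZ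
    · rw [sectBr_genSect_apply, genCoeff_A_A]
      simp only [LinearMap.sub_apply, LinearMap.id_apply, map_sub, hv, hw,
        derVec_adV_inv_const b hv, derVec_adV_inv_const b hw, adVDer_genDer_A_A, adV_adV_inv,
        adV_inv_adV, adV_lieV]
      rw [lieV_skew b w (adV b _ v), lieV_skew b (adV b _ w) (adV b _ v)]
      abel
    · rw [sectBr_genSect_apply, genCoeff_A_B]
      simp only [LinearMap.id_apply, hv, hw, add_zero, sub_zero]
  · rw [adVDer_genDer_A_A, adVDer_genDer_A_A]
    simp only [map_sub, LinearMap.sub_apply, adV_lieV]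
    rw [lieV_skew b w (adV b (hol (.A i)) v),
      lieV_skew b (adV b (hol (.A i)) w) (adV b (hol (.A i)) v)]
    abel

theorem sectBr_genSect_B_B {v w : VecAlg d G n g} (i : Fin g) (hv : ∀ D, derVec D v = 0)
    (hw : ∀ D, derVec D w = 0) :
    sectBr b (genSect b (.B i) v) (genSect b (.B i) w) = -genSect b (.B i) (lieV b v w) := by
  refine sectBr_genSect_of_tail b rfl rfl hv hw (fun Z hZ => ?_) ?_
  · obtain rfl | rfl := Loop.eq_A_or_B_of_pos_eq (i := i) hZ
    · rw [sectBr_genSect_apply, genCoeff_B_A]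
      simp only [LinearMap.neg_apply, map_neg, derVec_adV_inv_const b hv,
        derVec_adV_inv_const b hw, adVDer_genDer_B_A, adV_adV_inv, adV_lieV]
      rw [lieV_skew b (adV b _ w) (adV b _ v)]
      abel
    · rw [sectBr_genSect_apply, genCoeff_B_B]
      simp only [LinearMap.id_apply, hv, hw, add_zero, sub_zero]
  · rw [adVDer_genDer_B_B, adVDer_genDer_B_B]
    simp only [map_sub, LinearMap.sub_apply, adV_lieV]
    rw [lieV_skew b w (adV b (hol (.B i)) v),
      lieV_skew b (adV b (hol (.B i)) w) (adV b (hol (.B i)) v)]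
    abel

/-- The asymmetry of the handle comes from u_A: the generator of A_i conjugates it, while that of
B_i only translates it on the left. The component of the bracket in the copy A_i is then
Ad(u_A⁻¹)[v, w], as for minus the generator of B_i. -/
theorem sectBr_genSect_A_B {v w : VecAlg d G n g} (i : Fin g) (hv : ∀ D, derVec D v = 0)
    (hw : ∀ D, derVec D w = 0) :
    sectBr b (genSect b (.A i) v) (genSect b (.B i) w) = -genSect b (.B i) (lieV b v w) := by
  refine sectBr_genSect_of_tail b (X := .A i) (Y := .B i) (W := .B i) rfl rfl hv hw
    (fun Z hZ => ?_) ?_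
  · obtain rfl | rfl := Loop.eq_A_or_B_of_pos_eq hZ
    · rw [sectBr_genSect_apply, genCoeff_A_A, genCoeff_B_A]
      simp only [LinearMap.sub_apply, LinearMap.neg_apply, LinearMap.id_apply, map_sub, map_neg,
        hv, derVec_adV_inv_const b hv, derVec_adV_inv_const b hw, adVDer_genDer_A_A,
        adVDer_genDer_B_A, adV_adV_inv, adV_inv_adV, adV_lieV]
      rw [lieV_skew b (adV b _ w) (adV b _ v)]
      abel
    · rw [sectBr_genSect_apply, genCoeff_A_B, genCoeff_B_B]
      simp only [LinearMap.id_apply, hv, hw, add_zero, sub_zero]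
  · rw [adVDer_genDer_A_B, adVDer_genDer_B_A]
    simp only [map_sub, LinearMap.sub_apply, adV_lieV]
    rw [lieV_skew b w (adV b (hol (.A i)) v)]
    abel

theorem sectBr_skew (s s' : Sect d G n g) : sectBr b s s' = -sectBr b s' s := by
  funext Z
  simp only [sectBr, Pi.neg_apply]
  rw [lieV_skew b (s' Z)]
  abel

/-- The bracket of two undecoupled generators attached to the same puncture or handle. -/
theorem sectBr_genSect_of_pos_eq {X Y : Loop n g} (h : X.pos = Y.pos) {v w : VecAlg d G n g}
    (hv : ∀ D, derVec D v = 0) (hw : ∀ D, derVec D w = 0) :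
    sectBr b (genSect b X v) (genSect b Y w) =
      -genSect b (if X = Y then X else X.partner) (lieV b v w) := by
  obtain ⟨i, rfl, rfl⟩ | ⟨i, rfl | rfl, rfl | rfl⟩ := Loop.pos_eq_cases h
  · rw [if_pos rfl, sectBr_genSect_M b i hv hw]
  · rw [if_pos rfl, sectBr_genSect_A_A b i hv hw]
  · rw [if_neg (by simp), sectBr_genSect_A_B b i hv hw]
    rfl
  -- The pair (B_i, A_i) follows from (A_i, B_i) since both brackets are skew; `Loop.partner` fixes
  -- B_i, so the same generator results.
  · rw [if_neg (by simp), sectBr_skew, sectBr_genSect_A_B b i hw hv, lieV_skew b w, map_neg, neg_neg]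
    rfl
  · rw [if_pos rfl, sectBr_genSect_B_B b i hv hw]

end
end FlowerAlgebra

/-! ### The decoupling transformation and the preimages of the generators. -/

namespace FlowerAlgebra
open Function

theorem filter_eq_cons_of_pairwise {α : Type*} [LinearOrder α] {p : α → Bool} {x : α}
    (hx : p x) (hmin : ∀ y, p y → x ≤ y) {L : List α} (hL : L.Pairwise (· < ·)) (hmem : x ∈ L) :
    L.filter p = x :: L.filter fun y => p y && decide (x < y) := by
  induction L with
  | nil => cases hmem
  | cons a t ih =>
    rw [List.pairwise_cons] at hL
    by_cases ha : a = x
    · subst ha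
      rw [List.filter_cons_of_pos hx, List.filter_cons_of_neg (by simp)]
      congr 1
      exact List.filter_congr fun y hy => by simp [hL.1 y hy]
    · have hxt : x ∈ t := (List.mem_cons.1 hmem).resolve_left (Ne.symm ha)
      have hax := hL.1 x hxt
      have hpa : ¬p a := fun h => absurd (hmin a h) (not_le.2 hax)
      rw [List.filter_cons_of_neg hpa, List.filter_cons_of_neg (by simp [hpa]), ih hL.2 hxt]

theorem descProd_of_le {Γ : Type*} [Monoid Γ] {N : ℕ} (w : Fin N → Γ) {k l : ℕ} (h : k ≤ l) :
    descProd w k l = 1 := by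
  have : (List.finRange N).reverse.filter (fun m => l ≤ m.1 ∧ m.1 < k) = [] := by
    rw [List.filter_eq_nil_iff]
    intro m _
    simp only [decide_eq_true_eq]
    omega
  rw [descProd, this, List.map_nil, List.prod_nil]

/-- The smallest index stands at the right end of the product and hence acts first under `adV`; the
recursions for the tails rest on this. -/
theorem descProd_succ {Γ : Type*} [Monoid Γ] {N : ℕ} (w : Fin N → Γ) {k : ℕ} (l : Fin N)
    (h : l.1 < k) : descProd w k l = descProd w k (l + 1) * w l := by
  have h1 := filter_eq_cons_of_pairwise (p := fun m : Fin N => decide (l.1 ≤ m.1 ∧ m.1 < k)) (x := l)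
    (by simp [h]) (fun y hy => by simp only [decide_eq_true_eq] at hy; exact hy.1)
    (List.pairwise_lt_finRange N) (List.mem_finRange l)
  have h2 : (List.finRange N).filter (fun y => decide (l.1 ≤ y.1 ∧ y.1 < k) && decide (l < y)) =
      (List.finRange N).filter fun m => decide (l.1 + 1 ≤ m.1 ∧ m.1 < k) := by
    refine List.filter_congr fun y _ => ?_
    rw [← Bool.decide_and, decide_eq_decide, Fin.lt_def]
    omega
  rw [descProd, descProd, List.filter_reverse, List.filter_reverse, h1, h2, List.reverse_cons,
    List.map_append, List.prod_append, List.map_singleton, List.prod_singleton]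

noncomputable section
variable {d : ℕ} {G : Type*} [TopologicalSpace G]
    [ChartedSpace (EuclideanSpace ℝ (Fin d)) G] [Group G] [LieGroup (𝓡 d) ∞ G] [T2Space G]
    {n g : ℕ} (b : Module.Basis (Fin d) ℝ (GroupLieAlgebra (𝓡 d) G))

/-- The decoupled generators of the copies of the Lie algebra, in the flower algebra. -/
def copyGen : Loop n g → Fin d → Flower01 d G n g
  | .M i => gen (.M i)
  | .A i => gen (.A i) - gen (.B i)
  | .B i => gen (.B i)

/-- The element of the flower algebra with the given coefficients with respect to the generators of
the copies of the Lie algebra. -/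
def embed : Sect d G n g →ₗ[CoeffAlg d G n g] Flower01 d G n g :=
  ∑ X, contract (copyGen X) ∘ₗ LinearMap.proj X

theorem embed_apply (s : Sect d G n g) : embed s = ∑ X, contract (copyGen X) (s X) := by
  simp [embed, LinearMap.sum_apply]

theorem embed_single (X : Loop n g) (v : VecAlg d G n g) :
    embed (Pi.single X v) = contract (copyGen X) v := by
  rw [embed_apply, Finset.sum_eq_single X, Pi.single_eq_same]
  · intro Y _ hY
    rw [Pi.single_eq_of_ne hY, map_zero]
  · simp

/-- The restriction of `K` to degree at most one, as a map linear over the coefficients. -/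
def decoupleC : Flower01 d G n g →ₗ[CoeffAlg d G n g] Flower01 d G n g :=
  (decouple b).toLinearMap.restrict (decouple_mem b)

theorem decoupleC_fn (F : CoeffAlg d G n g) : decoupleC b (fn F) = fn F :=
  Subtype.ext (MvPolynomial.aeval_C _ _)

theorem decoupleC_gen (X : Loop n g) (a : Fin d) : decoupleC b (gen X a) = genPrime b X a :=
  Subtype.ext (MvPolynomial.aeval_X _ _)

theorem decoupleC_contract_gen (X : Loop n g) (v : VecAlg d G n g) :
    decoupleC b (contract (gen X) v) = contract (genPrime b X) v := by
  simp only [contract_apply, map_sum, map_smul, decoupleC_gen]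

theorem contract_ixAct (m : Matrix (Fin d) (Fin d) (CoeffAlg d G n g))
    (p : Fin d → Flower01 d G n g) (v : VecAlg d G n g) :
    contract (ixAct m p) v = contract p (Matrix.vecMul v m) := by
  rw [contract_vecMul]
  rfl

theorem contract_ixAct_adStar (w : Word d G n g)
    (p : Fin d → Flower01 d G n g) (v : VecAlg d G n g) :
    contract (ixAct (adStar b w) p) v = contract p (adV b w v) :=
  contract_ixAct _ _ _

theorem contract_add (p p' : Fin d → Flower01 d G n g) (v : VecAlg d G n g) :
    contract (p + p') v = contract p v + contract p' v := by
  simp only [contract_apply, Pi.add_apply, smul_add, Finset.sum_add_distrib]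

theorem contract_sub (p p' : Fin d → Flower01 d G n g) (v : VecAlg d G n g) :
    contract (p - p') v = contract p v - contract p' v := by
  simp only [contract_apply, Pi.sub_apply, smul_sub, Finset.sum_sub_distrib]

theorem contract_sum {ι : Type*} (s : Finset ι) (p : ι → Fin d → Flower01 d G n g)
    (v : VecAlg d G n g) : contract (∑ i ∈ s, p i) v = ∑ i ∈ s, contract (p i) v := by
  simp only [contract_apply, Finset.sum_apply, Finset.smul_sum]
  exact Finset.sum_comm

theorem contract_genH (i : Fin g) (v : VecAlg d G n g) : contract (genH b i) v =
    contract (gen (.A i : Loop n g)) (v - adV b ((hol (.A i))⁻¹ * (hol (.B i))⁻¹ * hol (.A i)) v) +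
      contract (gen (.B i : Loop n g)) (adV b ((hol (.A i))⁻¹ * (hol (.B i))⁻¹ * hol (.A i)) v -
        adV b ((hol (.B i))⁻¹ * hol (.A i)) v) := by
  rw [genH, contract_add, contract_ixAct, contract_ixAct, Matrix.vecMul_sub, Matrix.vecMul_sub,
    Matrix.vecMul_one]
  rfl

/-- The contributions of the handles from the `i`-th on to the decoupling transformation. -/
def handleTail (i : ℕ) : VecAlg d G n g →ₗ[CoeffAlg d G n g] Flower01 d G n g :=
  ∑ k : Fin g with i ≤ k.1, contract (genH b k) ∘ₗ adV b (descProd holK k i)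

/-- The contributions of the punctures from the `i`-th on and of all handles. -/
def punctureTail (i : ℕ) : VecAlg d G n g →ₗ[CoeffAlg d G n g] Flower01 d G n g :=
  ∑ k : Fin n with i ≤ k.1, contract (gen (.M k)) ∘ₗ adV b (descProd (fun m => hol (.M m)) k i) +
    handleTail b 0 ∘ₗ adV b (descProd (fun m => hol (.M m)) n i)

theorem sum_filter_le_eq {M : Type*} [AddCommMonoid M] {N : ℕ} (i : Fin N) (f : Fin N → M) :
    ∑ k : Fin N with i.1 ≤ k.1, f k = f i + ∑ k : Fin N with i.1 + 1 ≤ k.1, f k := by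
  have : (Finset.univ.filter fun k : Fin N => i.1 ≤ k.1) =
      insert i (Finset.univ.filter fun k : Fin N => i.1 + 1 ≤ k.1) := by
    ext k
    simp only [Finset.mem_filter, Finset.mem_univ, true_and, Finset.mem_insert, Fin.ext_iff]
    omega
  rw [this, Finset.sum_insert (by simp)]

/-- Each later product ends on the right in u_{K_i}, which can therefore be applied to v beforehand.
-/
theorem handleTail_rec (i : Fin g) (v : VecAlg d G n g) :
    handleTail b i v = contract (genH b i) v + handleTail b (i + 1) (adV b (holK i) v) := by
  simp only [handleTail, LinearMap.sum_apply, LinearMap.comp_apply]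
  rw [sum_filter_le_eq, descProd_of_le _ le_rfl, adV_one]
  refine congrArg (_ + ·) (Finset.sum_congr rfl fun k hk => ?_)
  rw [descProd_succ _ _ (Nat.lt_of_succ_le (Finset.mem_filter.1 hk).2), adV_mul]

theorem punctureTail_rec (i : Fin n) (v : VecAlg d G n g) : punctureTail b i v =
    contract (gen (.M i)) v + punctureTail b (i + 1) (adV b (hol (.M i)) v) := by
  simp only [punctureTail, LinearMap.add_apply, LinearMap.sum_apply, LinearMap.comp_apply]
  rw [sum_filter_le_eq, descProd_of_le _ le_rfl, adV_one, descProd_succ _ i i.2, adV_mul, add_assoc]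
  refine congrArg (_ + ·) (congrArg (· + _) (Finset.sum_congr rfl fun k hk => ?_))
  rw [descProd_succ _ _ (Nat.lt_of_succ_le (Finset.mem_filter.1 hk).2), adV_mul]

theorem handleTail_end (v : VecAlg d G n g) : handleTail b g v = 0 := by
  simp only [handleTail, LinearMap.sum_apply]
  refine Finset.sum_eq_zero fun k hk => ?_
  have := (Finset.mem_filter.1 hk).2
  omega

theorem punctureTail_end (v : VecAlg d G n g) : punctureTail b n v = handleTail b 0 v := by
  simp only [punctureTail, LinearMap.add_apply, LinearMap.sum_apply, LinearMap.comp_apply]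
  rw [descProd_of_le _ le_rfl, adV_one, add_eq_right]
  refine Finset.sum_eq_zero fun k hk => ?_
  have := (Finset.mem_filter.1 hk).2
  omega

theorem Ioi_eq_filter {N : ℕ} (i : Fin N) :
    Finset.Ioi i = Finset.univ.filter fun k : Fin N => i.1 + 1 ≤ k.1 := by
  ext k
  simp only [Finset.mem_Ioi, Finset.mem_filter, Finset.mem_univ, true_and, Fin.lt_def]
  omega

theorem contract_tailH (i : Fin g) (v : VecAlg d G n g) :
    contract (tailH b i) v = handleTail b (i + 1) v := by
  simp only [tailH, contract_sum, contract_ixAct_adStar, handleTail, LinearMap.sum_apply,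
    LinearMap.comp_apply, Ioi_eq_filter]

theorem contract_genPrime_M (i : Fin n) (v : VecAlg d G n g) : contract (genPrime b (.M i)) v =
    contract (gen (.M i)) v - punctureTail b (i + 1) (v - adV b (hol (.M i)) v) := by
  rw [genPrime, contract_sub, contract_ixAct, Matrix.vecMul_sub, Matrix.vecMul_one, ← adV_apply]
  congr 1
  simp only [contract_add, contract_sum, contract_ixAct_adStar, punctureTail, handleTail,
    LinearMap.add_apply, LinearMap.sum_apply, LinearMap.comp_apply, Ioi_eq_filter, adV_mul,
    Nat.zero_le, Finset.filter_true]

theorem contract_genPrime_A (i : Fin g) (v : VecAlg d G n g) : contract (genPrime b (.A i)) v =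
    contract (gen (.A i)) v + contract (gen (.A i) - gen (.B i)) (adV b (hol (.A i))⁻¹ v) +
      handleTail b (i + 1) (adV b (hol (.A i)) v - adV b (hol (.B i) * (hol (.A i))⁻¹) v) := by
  rw [genPrime, contract_add, contract_add, contract_ixAct, contract_ixAct, contract_tailH,
    Matrix.vecMul_sub]
  rfl

theorem contract_genPrime_B (i : Fin g) (v : VecAlg d G n g) : contract (genPrime b (.B i)) v =
    contract (gen (.B i)) v + contract (gen (.A i) - gen (.B i)) (adV b (hol (.A i))⁻¹ v) +
      handleTail b (i + 1) (adV b (hol (.B i)) v - adV b (hol (.B i) * (hol (.A i))⁻¹) v) := by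
  rw [genPrime, contract_add, contract_add, contract_ixAct, contract_ixAct, contract_tailH,
    Matrix.vecMul_sub]
  rfl

/-- `K` on the generators of the copies of the Lie algebra labelled by `A_i`. -/
theorem decoupleC_single_A (i : Fin g) (v : VecAlg d G n g) :
    decoupleC b (embed (Pi.single (.A i) v)) =
      contract (gen (.A i)) v - contract (gen (.B i)) v +
        handleTail b (i + 1) (adV b (hol (.A i)) v - adV b (hol (.B i)) v) := by
  rw [embed_single, copyGen, contract_sub, map_sub, decoupleC_contract_gen, decoupleC_contract_gen,
    contract_genPrime_A, contract_genPrime_B]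
  -- The terms with Ad(u_A⁻¹) and Ad(u_B u_A⁻¹) are common to the transformed generators of A_i and
  -- B_i and drop out of the difference.
  simp only [map_sub]
  abel

theorem decoupleC_single_B (i : Fin g) (v : VecAlg d G n g) :
    decoupleC b (embed (Pi.single (.B i) v)) =
      contract (gen (.B i)) v + (contract (gen (.A i)) (adV b (hol (.A i))⁻¹ v) -
        contract (gen (.B i)) (adV b (hol (.A i))⁻¹ v)) +
      handleTail b (i + 1) (adV b (hol (.B i)) v - adV b (hol (.B i)) (adV b (hol (.A i))⁻¹ v)) := by
  rw [embed_single, copyGen, decoupleC_contract_gen, contract_genPrime_B, contract_sub, adV_mul]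

theorem decoupleC_single_M (i : Fin n) (v : VecAlg d G n g) :
    decoupleC b (embed (Pi.single (.M i) v)) =
      contract (gen (.M i)) v - punctureTail b (i + 1) (v - adV b (hol (.M i)) v) := by
  rw [embed_single, copyGen, decoupleC_contract_gen, contract_genPrime_M]

theorem Loop.eq_M_iff_pos {i : Fin n} {Z : Loop n g} : Z = .M i ↔ Z.pos = i := by
  refine ⟨by rintro rfl; rfl, fun h => Loop.eq_M_of_pos_eq h.symm⟩

theorem Loop.pos_eq_iff {i : Fin g} {Z : Loop n g} : Z.pos = n + i ↔ Z = .A i ∨ Z = .B i := by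
  refine ⟨fun h => Loop.eq_A_or_B_of_pos_eq h.symm, by rintro (rfl | rfl) <;> rfl⟩

theorem tailSect_M (i : Fin n) (v : VecAlg d G n g) :
    tailSect b i v = tailSect b (i + 1) v + Pi.single (.M i) v := by
  funext Z
  simp only [tailSect, LinearMap.pi_apply, tailCoeff, Pi.add_apply]
  by_cases hZ : Z = .M i
  · subst hZ
    rw [if_pos (by rfl), if_neg (by simp [Loop.pos]), Pi.single_eq_same]
    simp [psi]
  · have : Z.pos ≠ i := fun h => hZ (Loop.eq_M_iff_pos.2 h)
    rw [Pi.single_eq_of_ne hZ, add_zero]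
    simp only [show (i.1 ≤ Z.pos) = (i.1 + 1 ≤ Z.pos) from propext (by omega)]

theorem tailSect_handle (i : Fin g) (v : VecAlg d G n g) :
    tailSect b (n + i) v = tailSect b (n + i + 1) v +
      (Pi.single (.A i) (v - psi b (.A i) v) + Pi.single (.B i) (v - psi b (.B i) v)) := by
  funext Z
  simp only [tailSect, LinearMap.pi_apply, tailCoeff, Pi.add_apply]
  by_cases hA : Z = .A i
  · subst hA
    rw [if_pos (by rfl), if_neg (by simp [Loop.pos]), Pi.single_eq_same,
      Pi.single_eq_of_ne (by simp)]
    simp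
  · by_cases hB : Z = .B i
    · subst hB
      rw [if_pos (by rfl), if_neg (by simp [Loop.pos]), Pi.single_eq_same,
        Pi.single_eq_of_ne (by simp)]
      simp
    · have : Z.pos ≠ n + i := fun h => (Loop.pos_eq_iff.1 h).elim hA hB
      rw [Pi.single_eq_of_ne hA, Pi.single_eq_of_ne hB, add_zero, add_zero]
      simp only [show (n + i.1 ≤ Z.pos) = (n + i.1 + 1 ≤ Z.pos) from propext (by omega)]

theorem tailSect_end (v : VecAlg d G n g) : tailSect b (n + g) v = 0 := by
  funext Z
  have : ¬n + g ≤ Z.pos := by cases Z <;> simp only [Loop.pos] <;> omega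
  simp only [tailSect, LinearMap.pi_apply, tailCoeff, if_neg this]
  rfl

/-- Induction from the last handle backwards, k being the number of handles included. On the copies
A_i and B_i with coefficients v - psi v, K gives j^{H_i} at v plus the later tail at Ad(u_{K_i})v -
v. The part -v cancels the tail supplied by the induction hypothesis, and the recursion of
`handleTail` remains. -/
theorem decoupleC_tailSect_handle (k : ℕ) (hk : k ≤ g) (v : VecAlg d G n g) :
    decoupleC b (embed (tailSect b (n + (g - k)) v)) = handleTail b (g - k) v := by
  induction k generalizing v with
  | zero => rw [Nat.sub_zero, tailSect_end, handleTail_end, map_zero, map_zero]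
  | succ k ih =>
    have h1 : g - k = g - (k + 1) + 1 := by omega
    obtain ⟨i, hi⟩ : ∃ i : Fin g, i.1 = g - (k + 1) := ⟨⟨g - (k + 1), by omega⟩, rfl⟩
    have ih' := ih (by omega) v
    rw [h1, ← hi, ← add_assoc] at ih'
    rw [← hi, tailSect_handle, handleTail_rec, map_add, map_add, map_add, map_add, ih',
      decoupleC_single_A, decoupleC_single_B, contract_genH, holK]
    simp only [psi, adV_mul, map_sub, adV_adV_inv]
    abel

/-- The same induction over the punctures, started from the tail of all handles: K takes the copy
M_i to j^{M_i} minus the later tail at v - Ad(u_{M_i})v, whose part in v cancels the induction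
hypothesis. -/
theorem decoupleC_tailSect_puncture (k : ℕ) (hk : k ≤ n) (v : VecAlg d G n g) :
    decoupleC b (embed (tailSect b (n - k) v)) = punctureTail b (n - k) v := by
  induction k generalizing v with
  | zero =>
    have := decoupleC_tailSect_handle (n := n) b g le_rfl v
    rw [Nat.sub_self, add_zero] at this
    rw [Nat.sub_zero, punctureTail_end, this]
  | succ k ih =>
    have h1 : n - k = n - (k + 1) + 1 := by omega
    obtain ⟨i, hi⟩ : ∃ i : Fin n, i.1 = n - (k + 1) := ⟨⟨n - (k + 1), by omega⟩, rfl⟩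
    have ih' := ih (by omega) v
    rw [h1, ← hi] at ih'
    rw [← hi, tailSect_M, punctureTail_rec, map_add, map_add, ih', decoupleC_single_M, map_sub]
    abel

theorem localSect_eq (X : Loop n g) (v : VecAlg d G n g) : (fun Z => localCoeff b X Z v) =
    match X with
    | .M i => Pi.single (.M i) v
    | .A i => Pi.single (.A i) (v - adV b (hol (.A i))⁻¹ v) + Pi.single (.B i) v
    | .B i => Pi.single (.B i) v - Pi.single (.A i) (adV b (hol (.A i))⁻¹ v) := by
  funext Z
  cases X with
  | M i => by_cases h : Z = .M i <;> simp [localCoeff, h]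
  | A i =>
    by_cases h : Z = .A i
    · simp [localCoeff, h]
    · by_cases h' : Z = .B i <;> simp [localCoeff, h, h']
  | B i =>
    by_cases h : Z = .A i
    · simp [localCoeff, h]
    · by_cases h' : Z = .B i <;> simp [localCoeff, h, h']

/-- The sections `genSect` are the preimages of the generators under the decoupling
transformation. -/
theorem decoupleC_genSect (X : Loop n g) (v : VecAlg d G n g) :
    decoupleC b (embed (genSect b X v)) = contract (gen X) v := by
  -- The inductions count from the end, so the index i + 1 is written as n - (n - (i + 1)), and
  -- likewise for the handles.
  have hM : ∀ (i : Fin n) (v : VecAlg d G n g), decoupleC b (embed (tailSect b (i + 1) v)) =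
      punctureTail b (i + 1) v := fun i v => by
    have := decoupleC_tailSect_puncture (g := g) b (n - (i + 1)) (by omega) v
    rwa [Nat.sub_sub_self i.2] at this
  have hH : ∀ (i : Fin g) (v : VecAlg d G n g), decoupleC b (embed (tailSect b (n + i + 1) v)) =
      handleTail b (i + 1) v := fun i v => by
    have := decoupleC_tailSect_handle (n := n) (g := g) b (g - (i + 1)) (by omega) v
    rwa [Nat.sub_sub_self i.2] at this
  rw [genSect_eq, localSect_eq]
  cases X with
  | M i =>
    dsimp only [Loop.pos]
    rw [map_add, map_add, hM, decoupleC_single_M]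
    abel
  | A i =>
    dsimp only [Loop.pos]
    rw [map_add, map_add, hH, map_add, map_add, decoupleC_single_A, decoupleC_single_B]
    simp only [map_sub, adV_adV_inv]
    abel
  | B i =>
    dsimp only [Loop.pos]
    rw [map_add, map_add, hH, map_sub, map_sub, decoupleC_single_A, decoupleC_single_B]
    simp only [map_sub, adV_adV_inv]
    abel

/-- Induction on elements of degree at most one. -/
theorem flower01_ind {p : Flower01 d G n g → Prop} (hC : ∀ F, p (fn F))
    (hX : ∀ (F : CoeffAlg d G n g) X a, p (F • gen X a))
    (hadd : ∀ P P', p P → p P' → p (P + P')) (P : Flower01 d G n g) : p P := by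
  obtain ⟨P, hP⟩ := P
  suffices ∃ h, p ⟨P, h⟩ from this.2
  refine flower01_induction (p := fun P => ∃ h, p ⟨P, h⟩) (fun F => ⟨(fn F).2, hC F⟩)
    (fun F x => ⟨(F • gen x.1 x.2 : Flower01 d G n g).2, hX F x.1 x.2⟩) ?_ P hP
  rintro P P' ⟨h, hp⟩ ⟨h', hp'⟩
  exact ⟨_, hadd _ _ hp hp'⟩

theorem fn_eq_smul (F : CoeffAlg d G n g) : fn F = F • (fn 1 : Flower01 d G n g) := by
  refine Subtype.ext ?_
  change MvPolynomial.C F = F • MvPolynomial.C 1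
  rw [MvPolynomial.smul_eq_C_mul, ← map_mul, mul_one]

/-- Finite generation is what allows surjectivity of K to imply bijectivity. -/
instance : Module.Finite (CoeffAlg d G n g) (Flower01 d G n g) := by
  let S : Set (Flower01 d G n g) :=
    insert (fn 1) (Set.range fun x : Loop n g × Fin d => gen x.1 x.2)
  refine ⟨Submodule.fg_def.2 ⟨S, (Set.finite_range _).insert _, top_unique fun P _ => ?_⟩⟩
  refine flower01_ind (p := fun P => P ∈ Submodule.span _ S) (fun F => ?_) (fun F X a => ?_)
    (fun P P' h h' => Submodule.add_mem _ h h') P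
  · rw [fn_eq_smul]
    exact Submodule.smul_mem _ _ (Submodule.subset_span (Set.mem_insert _ _))
  · exact Submodule.smul_mem _ _ (Submodule.subset_span (Set.mem_insert_of_mem _ ⟨(X, a), rfl⟩))

/-- The sections `genSect` supply preimages of all generators. Injectivity is then automatic for a
finitely generated module over a commutative ring, so the explicit formula is checked on one side
only. -/
theorem decoupleC_bijective : Function.Bijective (decoupleC (n := n) (g := g) b) := by
  refine OrzechProperty.bijective_of_surjective_endomorphism _ fun P => ?_
  refine flower01_ind (p := fun P => ∃ P', decoupleC b P' = P) (fun F => ⟨fn F, decoupleC_fn b F⟩)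
    (fun F X a => ⟨F • embed (genSect b X (Pi.single a 1)), ?_⟩) ?_ P
  · rw [map_smul, decoupleC_genSect, contract_single]
  · rintro P P' ⟨R, hR⟩ ⟨R', hR'⟩
    exact ⟨R + R', by rw [map_add, hR, hR']⟩

theorem decouple01_bijective : Function.Bijective (decouple01 (n := n) (g := g) b) :=
  decoupleC_bijective b

end
end FlowerAlgebra

/-! ### Enveloping algebras in degree one and commutators in smash products. -/

namespace FlowerAlgebra
open Function

noncomputable section
variable {R C L : Type*} [CommRing R] [CommRing C] [Algebra R C] [LieRing L] [LieAlgebra R L]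

attribute [local instance 100] LieRing.ofAssociativeRing

/-- The Lie algebra homomorphism from derivations to endomorphisms. -/
def derivationEnd : Derivation R C C →ₗ⁅R⁆ Module.End R C where
  toFun D := (D : C →ₗ[R] C)
  map_add' _ _ := rfl
  map_smul' _ _ := rfl
  map_lie' {D D'} := by
    refine LinearMap.ext fun F => ?_
    rw [LieRing.of_associative_ring_bracket]
    rfl

/-- Every representation extends to the enveloping algebra, so a relation in degree at most one
holds in all of them; a well-chosen one then forces it to be trivial. -/
theorem smul_one_add_ι_apply {V : Type*} [AddCommGroup V] [Module R V]
    (ρ : L →ₗ⁅R⁆ Module.End R V) {c : R} {ξ : L}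
    (h : c • (1 : UniversalEnvelopingAlgebra R L) + UniversalEnvelopingAlgebra.ι R ξ = 0) (v : V) :
    c • v + ρ ξ v = 0 := by
  have := congrArg (fun θ => UniversalEnvelopingAlgebra.lift R ρ θ v) h
  simpa using this

/-- In degree at most one, the universal enveloping algebra of an abelian Lie algebra is what the
Poincaré-Birkhoff-Witt theorem says. -/
theorem smul_one_add_ι_eq_zero_of_abelian (hL : ∀ x y : L, ⁅x, y⁆ = 0) {c : R} {ξ : L}
    (h : c • (1 : UniversalEnvelopingAlgebra R L) + UniversalEnvelopingAlgebra.ι R ξ = 0) :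
    c = 0 ∧ ξ = 0 := by
  -- Here x acts by (r, y) ↦ (0, r x). Any two such maps compose to zero, as the abelian bracket
  -- requires, and applying the relation to (1, 0) returns the pair (c, ξ).
  let ρ : L →ₗ⁅R⁆ Module.End R (R × L) :=
    { toFun := fun x => LinearMap.inr R R L ∘ₗ (LinearMap.fst R R L).smulRight x
      map_add' := fun x y => by
        refine LinearMap.ext fun p => ?_
        simp [smul_add]
      map_smul' := fun r x => by
        refine LinearMap.ext fun p => ?_
        simp [smul_comm r]
      map_lie' := fun {x y} => by
        refine LinearMap.ext fun p => ?_
        rw [hL, LieRing.of_associative_ring_bracket]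
        simp }
  have := smul_one_add_ι_apply ρ h (1, 0)
  simpa [ρ, Prod.ext_iff] using this

variable (δ : L →ₗ⁅R⁆ Derivation R C C)

namespace SmashProduct

theorem mk_one_mul_mk (η : UniversalEnvelopingAlgebra R L) (F K : C) :
    mk δ 1 F * mk δ η K = mk δ η (F * K) := by
  change smashMul δ (1 ⊗ₜ[R] F) (η ⊗ₜ[R] K) = η ⊗ₜ[R] (F * K)
  rw [smashMul_tmul, map_one, mul_one, opFun_tmul]

theorem commutator_mk_one_mk_one (F K : C) :
    mk δ 1 F * mk δ 1 K - mk δ 1 K * mk δ 1 F = 0 := by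
  rw [mk_one_mul_mk, mk_one_mul_mk, mul_comm, sub_self]

theorem commutator_mk_ι_mk_one (ξ : L) (F K : C) :
    mk δ (UniversalEnvelopingAlgebra.ι R ξ) F * mk δ 1 K -
      mk δ 1 K * mk δ (UniversalEnvelopingAlgebra.ι R ξ) F = mk δ 1 (F * δ ξ K) := by
  rw [mk_one_mul_mk, mk_mul_mk, mul_one, mul_comm K, add_sub_cancel_left]

/-- The part of degree two is ξη - ηξ, which is the image of the bracket of `L`, so the commutator
stays in degree one: it is the Lie-Rinehart bracket of the two elements. -/
theorem commutator_mk_ι_mk_ι (ξ η : L) (F K : C) :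
    mk δ (UniversalEnvelopingAlgebra.ι R ξ) F * mk δ (UniversalEnvelopingAlgebra.ι R η) K -
      mk δ (UniversalEnvelopingAlgebra.ι R η) K * mk δ (UniversalEnvelopingAlgebra.ι R ξ) F =
    mk δ (UniversalEnvelopingAlgebra.ι R ⁅ξ, η⁆) (F * K) +
      mk δ (UniversalEnvelopingAlgebra.ι R η) (F * δ ξ K) -
      mk δ (UniversalEnvelopingAlgebra.ι R ξ) (K * δ η F) := by
  rw [mk_mul_mk, mk_mul_mk, LieHom.map_lie, LieRing.of_associative_ring_bracket, map_sub,
    LinearMap.sub_apply, mul_comm K F]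
  abel

variable {I : Type*} [Fintype I] (e : I → L)

/-- The element `Σ_x ι(e_x) ⊗ s_x`. -/
def lin (s : I → C) : SmashProduct δ := ∑ x, mk δ (UniversalEnvelopingAlgebra.ι R (e x)) (s x)

theorem commutator_lin_mk_one (s : I → C) (K : C) :
    lin δ e s * mk δ 1 K - mk δ 1 K * lin δ e s = mk δ 1 (∑ x, s x * δ (e x) K) := by
  rw [lin, Finset.sum_mul, Finset.mul_sum, ← Finset.sum_sub_distrib, map_sum]
  exact Finset.sum_congr rfl fun x _ => commutator_mk_ι_mk_one δ _ _ _

theorem commutator_lin_lin (s t : I → C) :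
    lin δ e s * lin δ e t - lin δ e t * lin δ e s =
      ∑ x, ∑ y, mk δ (UniversalEnvelopingAlgebra.ι R ⁅e x, e y⁆) (s x * t y) +
        lin δ e (fun y => ∑ x, s x * δ (e x) (t y)) -
        lin δ e (fun x => ∑ y, t y * δ (e y) (s x)) := by
  simp only [lin, map_sum]
  rw [Finset.sum_mul_sum, Finset.sum_mul_sum,
    Finset.sum_comm (f := fun i j => mk δ (UniversalEnvelopingAlgebra.ι R (e i)) (t i) *
      mk δ (UniversalEnvelopingAlgebra.ι R (e j)) (s j)),
    Finset.sum_comm (f := fun y x => mk δ (UniversalEnvelopingAlgebra.ι R (e y))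
      (s x * δ (e x) (t y)))]
  simp only [← Finset.sum_sub_distrib, ← Finset.sum_add_distrib]
  exact Finset.sum_congr rfl fun x _ => Finset.sum_congr rfl fun y _ =>
    commutator_mk_ι_mk_ι δ _ _ _ _

end SmashProduct
end

/-! ### Independence of 1 and the copies of the Lie algebra in the enveloping algebra. -/

noncomputable section
variable {d : ℕ} {G : Type*} [TopologicalSpace G]
    [ChartedSpace (EuclideanSpace ℝ (Fin d)) G] [Group G] [LieGroup (𝓡 d) ∞ G] [T2Space G]
    {n g : ℕ} (b : Module.Basis (Fin d) ℝ (GroupLieAlgebra (𝓡 d) G)) (ħ : ℝ)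

attribute [local instance 100] LieRing.ofAssociativeRing

variable (G) in
/-- The left-invariant vector fields, as a right action of each component. -/
def rightDer (X : Loop n g) : GroupLieAlgebra (𝓡 d) G →ₗ[ℝ]
    Derivation ℂ (CoeffAlg d G n g) (CoeffAlg d G n g) :=
  flowDer (fun u h => update u X (u X * h)) (updR_smooth X) (fun u => by simp)

theorem rightDer_lie (X : Loop n g) (ξ η : GroupLieAlgebra (𝓡 d) G) :
    rightDer G X ⁅ξ, η⁆ = ⁅rightDer G X ξ, rightDer G X η⁆ :=
  flowDer_lie _ _ (fun u h k => by simp [mul_assoc]) ξ η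

theorem rightDer_comm {X Y : Loop n g} (hXY : X ≠ Y) (ξ η : GroupLieAlgebra (𝓡 d) G) :
    ⁅rightDer G X ξ, rightDer G Y η⁆ = 0 :=
  flowDer_comm _ _ _ _ (fun u h k => by
    rw [update_of_ne hXY.symm, update_of_ne hXY, update_comm hXY.symm]) ξ η

variable (d G n g) in
/-- The Lie algebra `DecLie` acting by left-invariant vector fields. -/
def rightAction : DecLie d G n g ħ →ₗ⁅ℂ⁆ Derivation ℂ (CoeffAlg d G n g) (CoeffAlg d G n g) :=
  QLie.der ħ (fun X => (rightDer G X).liftBaseChange ℂ)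
    (fun X => baseChange_lie _ (rightDer_lie X))
    (fun _ _ h => baseChange_comm _ _ (rightDer_comm h))

theorem rightAction_apply (ξ : DecLie d G n g ħ) (F : CoeffAlg d G n g) :
    rightAction d G n g ħ ξ F =
      (Complex.I * ħ) • -∑ X, (rightDer G X).liftBaseChange ℂ (ξ X) F := by
  rw [← derivation_sum_apply]
  rfl

/-- The pullback of a function on the group by the projection to one component. -/
def pullback (Y : Loop n g) {f : G → ℂ} (hf : ContMDiff (𝓡 d) 𝓘(ℝ, ℂ) ∞ f) : CoeffAlg d G n g :=
  ⟨fun u => f (u Y), hf.comp (contMDiff_coord Y)⟩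

theorem evalAt_rightDer_pullback (X Y : Loop n g) (ξ : GroupLieAlgebra (𝓡 d) G) {f : G → ℂ}
    (hf : ContMDiff (𝓡 d) 𝓘(ℝ, ℂ) ∞ f) :
    evalAt 1 (rightDer G X ξ (pullback Y hf)) = if X = Y then dOne f ξ else 0 := by
  change dOne (fun h => f (update (1 : Loop n g → G) X ((1 : Loop n g → G) X * h) Y)) ξ = _
  split_ifs with h
  · subst h
    simp only [update_self, Pi.one_apply, one_mul]
  · simp only [update_of_ne (Ne.symm h), dOne_const]

/-- Coordinate functions of the components, separating the left-invariant vector fields. -/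
theorem exists_rightDer_coord : ∃ f : Loop n g → Fin d → CoeffAlg d G n g,
    ∀ X Y c (ξ : ℂ ⊗[ℝ] GroupLieAlgebra (𝓡 d) G),
      evalAt 1 ((rightDer G X).liftBaseChange ℂ ξ (f Y c)) =
        if X = Y then (b.baseChange ℂ).coord c ξ else 0 := by
  obtain ⟨f, hf, hd⟩ := exists_dual_functions b
  refine ⟨fun Y c => pullback Y (hf c), fun X Y c ξ => ?_⟩
  induction ξ with
  | zero => rw [map_zero, map_zero, Derivation.zero_apply, map_zero, ite_self]
  | add ξ η h h' =>
    rw [map_add, Derivation.add_apply, map_add, h, h', map_add]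
    split_ifs <;> simp
  | tmul z ξ =>
    rw [LinearMap.liftBaseChange_tmul, Derivation.smul_apply, map_smul, evalAt_rightDer_pullback,
      hd]
    split_ifs
    · simp [mul_comm]
    · simp

theorem decLie_ext {ξ η : DecLie d G n g ħ}
    (h : ∀ X c, (b.baseChange ℂ).coord c (ξ X) = (b.baseChange ℂ).coord c (η X)) : ξ = η :=
  funext fun X => (b.baseChange ℂ).ext_elem fun c => h X c

/-- The Poincaré-Birkhoff-Witt theorem for `DecLie` in degree at most one. -/
theorem smul_one_add_ι_eq_zero (b : Module.Basis (Fin d) ℝ (GroupLieAlgebra (𝓡 d) G))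
    {c : ℂ} {ξ : DecLie d G n g ħ}
    (h : c • (1 : UniversalEnvelopingAlgebra ℂ (DecLie d G n g ħ)) +
      UniversalEnvelopingAlgebra.ι ℂ ξ = 0) : c = 0 ∧ ξ = 0 := by
  -- Both the bracket of `DecLie` and its action by vector fields carry a factor iħ. At ħ = 0 the
  -- action is zero and detects nothing, but the Lie algebra is abelian.
  by_cases hħ : ħ = 0
  · refine smul_one_add_ι_eq_zero_of_abelian (fun x y => decLie_ext b ħ fun X c => ?_) h
    rw [QLie.lie_apply, hħ, Complex.ofReal_zero, mul_zero, zero_smul]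
    rfl
  -- Left-invariant fields replace the decoupled action because conjugation of a puncture component
  -- can be trivial. They kill the constant 1, which isolates c; evaluating them at the identity on
  -- coordinate functions gives ξ up to the factor -iħ.
  · have key := smul_one_add_ι_apply (derivationEnd.comp (rightAction d G n g ħ)) h
    have hc : c = 0 := by
      have h1 := congrArg (evalAt 1) (key 1)
      have h2 : derivationEnd.comp (rightAction d G n g ħ) ξ 1 = 0 :=
        (rightAction d G n g ħ ξ).map_one_eq_zero
      rw [h2, add_zero, map_smul, map_one, map_zero] at h1
      simpa using h1
    refine ⟨hc, decLie_ext b ħ fun X a => ?_⟩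
    obtain ⟨f, hf⟩ := exists_rightDer_coord (n := n) (g := g) b
    have h1 : rightAction d G n g ħ ξ (f X a) = 0 := by
      have := key (f X a)
      rwa [hc, zero_smul, zero_add] at this
    have h2 := congrArg (evalAt 1) h1
    rw [rightAction_apply, map_smul, map_neg, map_sum, map_zero] at h2
    simp only [hf, Finset.sum_ite_eq', Finset.mem_univ, if_true] at h2
    rw [smul_neg, neg_eq_zero, smul_eq_zero] at h2
    refine (h2.resolve_left (by simp [hħ])).trans ?_
    exact (map_zero _).symm

/-- The generators of the copies of the Lie algebra in `DecLie`. -/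
def decBasis (x : Loop n g × Fin d) : DecLie d G n g ħ :=
  QLie.single ħ x.1 (1 ⊗ₜ[ℝ] b x.2)

/-- The coordinates on `DecLie`. -/
def decCoord (x : Loop n g × Fin d) : DecLie d G n g ħ →ₗ[ℂ] ℂ where
  toFun ξ := (b.baseChange ℂ).coord x.2 (ξ x.1)
  map_add' ξ η := map_add _ (ξ x.1) (η x.1)
  map_smul' c ξ := map_smul _ c (ξ x.1)

theorem decCoord_decBasis (x y : Loop n g × Fin d) :
    decCoord b ħ x (decBasis b ħ y) = if x = y then 1 else 0 := by
  change (b.baseChange ℂ).coord x.2 (if x.1 = y.1 then 1 ⊗ₜ[ℝ] b y.2 else 0) = _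
  rw [← Module.Basis.baseChange_apply]
  obtain ⟨X, a⟩ := x
  obtain ⟨Y, c⟩ := y
  by_cases h : X = Y <;> by_cases h' : a = c <;>
    simp [h, h']

theorem sum_decCoord_smul (ξ : DecLie d G n g ħ) :
    ∑ x, decCoord b ħ x ξ • decBasis b ħ x = ξ := by
  refine decLie_ext b ħ fun X c => ?_
  change decCoord b ħ (X, c) _ = decCoord b ħ (X, c) _
  rw [map_sum]
  simp only [map_smul, decCoord_decBasis, smul_eq_mul, mul_ite, mul_one, mul_zero,
    Finset.sum_ite_eq, Finset.mem_univ, if_true]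

theorem decLie_hom_ext {ξ η : DecLie d G n g ħ} (h : ∀ x, decCoord b ħ x ξ = decCoord b ħ x η) :
    ξ = η := decLie_ext b ħ fun X c => h (X, c)

/-- The element `Σ_{X, a} j_{X, a} ⊗ s_X^a` of the quantum algebra. -/
def qembed (s : Sect d G n g) : QFlower d G n g ħ :=
  SmashProduct.lin (decAction d G n g ħ) (decBasis b ħ) fun x => s x.1 x.2

theorem qembed_apply (s : Sect d G n g) : qembed b ħ s = ∑ x : Loop n g × Fin d,
    qmk ħ (UniversalEnvelopingAlgebra.ι ℂ (decBasis b ħ x)) (s x.1 x.2) := rfl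

/-- Independence of 1 and the Lie algebra makes the map from ℂ × `DecLie` to the enveloping algebra
injective, and an injective linear map over a field has a left inverse. -/
theorem exists_dual_qmk (b : Module.Basis (Fin d) ℝ (GroupLieAlgebra (𝓡 d) G)) :
    ∃ r : UniversalEnvelopingAlgebra ℂ (DecLie d G n g ħ) →ₗ[ℂ]
    ℂ × DecLie d G n g ħ, r 1 = (1, 0) ∧
      ∀ ξ, r (UniversalEnvelopingAlgebra.ι ℂ ξ) = (0, ξ) := by
  let j : ℂ × DecLie d G n g ħ →ₗ[ℂ] UniversalEnvelopingAlgebra ℂ (DecLie d G n g ħ) :=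
    (LinearMap.toSpanSingleton ℂ _ 1).coprod 
      (UniversalEnvelopingAlgebra.ι ℂ (L := DecLie d G n g ħ)).toLinearMap
  have hj : LinearMap.ker j = ⊥ := by
    rw [LinearMap.ker_eq_bot']
    rintro ⟨c, ξ⟩ h
    obtain ⟨rfl, rfl⟩ := smul_one_add_ι_eq_zero ħ b (c := c) (ξ := ξ) (by simpa [j] using h)
    rfl
  obtain ⟨r, hr⟩ := j.exists_leftInverse_of_injective hj
  have h := fun p => LinearMap.congr_fun hr p
  refine ⟨r, ?_, fun ξ => ?_⟩
  · simpa [j] using h (1, 0)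
  · simpa [j] using h (0, ξ)

/-- The map `θ ⊗ F ↦ φ(θ) F`. -/
def slice (φ : UniversalEnvelopingAlgebra ℂ (DecLie d G n g ħ) →ₗ[ℂ] ℂ) :
    QFlower d G n g ħ →ₗ[ℂ] CoeffAlg d G n g :=
  (TensorProduct.lift (LinearMap.lsmul ℂ (CoeffAlg d G n g) ∘ₗ φ) :
    UniversalEnvelopingAlgebra ℂ (DecLie d G n g ħ) ⊗[ℂ] CoeffAlg d G n g →ₗ[ℂ] CoeffAlg d G n g)

theorem slice_qmk (φ : UniversalEnvelopingAlgebra ℂ (DecLie d G n g ħ) →ₗ[ℂ] ℂ)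
    (θ : UniversalEnvelopingAlgebra ℂ (DecLie d G n g ħ)) (F : CoeffAlg d G n g) :
    slice ħ φ (qmk ħ θ F) = φ θ • F := rfl

/-- Coordinates of the retraction from `exists_dual_qmk`, applied in the first tensor factor, read
off F and every coefficient of s. -/
theorem qmk_add_qembed_eq_zero {F : CoeffAlg d G n g} {s : Sect d G n g}
    (h : qmk ħ 1 F + qembed b ħ s = 0) : F = 0 ∧ s = 0 := by
  obtain ⟨r, h1, hι⟩ := exists_dual_qmk (n := n) (g := g) ħ b
  rw [qembed_apply] at h
  constructor
  · have := congrArg (slice ħ (LinearMap.fst _ _ _ ∘ₗ r)) h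
    simpa only [map_add, map_sum, slice_qmk, LinearMap.comp_apply, h1, hι, LinearMap.fst_apply,
      one_smul, zero_smul, Finset.sum_const_zero, add_zero, map_zero] using this
  · funext X a
    have := congrArg (slice ħ (decCoord b ħ (X, a) ∘ₗ LinearMap.snd _ _ _ ∘ₗ r)) h
    simpa only [map_add, map_sum, slice_qmk, LinearMap.comp_apply, h1, hι, LinearMap.snd_apply,
      map_zero, zero_smul, zero_add, decCoord_decBasis, ite_smul, one_smul, Finset.sum_ite_eq,
      Finset.mem_univ, if_true, Pi.zero_apply] using this

theorem qmk_ι (ξ : DecLie d G n g ħ) (F : CoeffAlg d G n g) :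
    qmk ħ (UniversalEnvelopingAlgebra.ι ℂ ξ) F =
      qembed b ħ fun X a => decCoord b ħ (X, a) ξ • F := by
  rw [qembed_apply]
  conv_lhs => rw [← sum_decCoord_smul b ħ ξ]
  rw [map_sum, map_sum, LinearMap.sum_apply]
  exact Finset.sum_congr rfl fun x _ => by rw [map_smul, map_smul, LinearMap.smul_apply, map_smul]

end
end FlowerAlgebra

/-! ### Bijectivity of Q in degree at most one. -/

namespace FlowerAlgebra
open Function

noncomputable section
variable {d : ℕ} {G : Type*} [TopologicalSpace G]
    [ChartedSpace (EuclideanSpace ℝ (Fin d)) G] [Group G] [LieGroup (𝓡 d) ∞ G] [T2Space G]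
    {n g : ℕ} (b : Module.Basis (Fin d) ℝ (GroupLieAlgebra (𝓡 d) G)) (ħ : ℝ)

attribute [local instance 100] LieRing.ofAssociativeRing

theorem quantise01_val (P : Flower01 d G n g) :
    (quantise01 b ħ P).1 = quantise b ħ (P : Flower d G n g) := rfl

theorem QFlower1.add_val (θ χ : QFlower1 d G n g ħ) : (θ + χ).1 = θ.1 + χ.1 := rfl

theorem QFlower1.sub_val (θ χ : QFlower1 d G n g ħ) : (θ - χ).1 = θ.1 - χ.1 := rfl

theorem quantise01_fn (F : CoeffAlg d G n g) : (quantise01 b ħ (fn F)).1 = qmk ħ 1 F := by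
  rw [quantise01_val, show (fn F : Flower01 d G n g).1 = MvPolynomial.C F from rfl,
    MvPolynomial.C_apply, quantise_monomial, ordMonomial_zero]

theorem smul_gen_val (F : CoeffAlg d G n g) (X : Loop n g) (a : Fin d) :
    (F • gen X a : Flower01 d G n g).1 = MvPolynomial.monomial (Finsupp.single (X, a) 1) F := by
  refine (MvPolynomial.smul_monomial _).trans ?_
  rw [smul_eq_mul, mul_one]

theorem quantise01_smul_gen (F : CoeffAlg d G n g) (X : Loop n g) (a : Fin d) :
    (quantise01 b ħ (F • gen X a)).1 =
      qmk ħ (UniversalEnvelopingAlgebra.ι ℂ (decGen b ħ X a)) F := by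
  rw [quantise01_val, smul_gen_val, quantise_monomial, ordMonomial_single]

theorem decBasis_A (i : Fin g) (a : Fin d) : decBasis b ħ ((.A i : Loop n g), a) =
    decGen b ħ (.A i) a - decGen b ħ (.B i) a := by
  simp only [decGen, add_sub_cancel_right]
  rfl

/-- Passing from the generators of the loops to those of the copies matches `decBasis`; only A_i,
where the copy is spanned by differences, uses linearity. -/
theorem quantise01_smul_copyGen (F : CoeffAlg d G n g) (X : Loop n g) (a : Fin d) :
    (quantise01 b ħ (F • copyGen X a)).1 =
      qmk ħ (UniversalEnvelopingAlgebra.ι ℂ (decBasis b ħ (X, a))) F := by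
  cases X with
  | M i => exact quantise01_smul_gen b ħ F _ a
  | B i => exact quantise01_smul_gen b ħ F _ a
  | A i =>
    rw [show copyGen (.A i : Loop n g) a = gen (.A i) a - gen (.B i) a from rfl, smul_sub, map_sub,
      QFlower1.sub_val, quantise01_smul_gen, quantise01_smul_gen, decBasis_A, map_sub, map_sub,
      LinearMap.sub_apply]

theorem quantise01_embed (s : Sect d G n g) :
    (quantise01 b ħ (embed s)).1 = qembed b ħ s := by
  have h : embed s = ∑ x : Loop n g × Fin d, s x.1 x.2 • copyGen x.1 x.2 := by
    rw [embed_apply, Fintype.sum_prod_type]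
    simp only [contract_apply]
  rw [h, map_sum, qembed_apply]
  refine (map_sum (QFlower1 d G n g ħ).subtype _ _).trans ?_
  exact Finset.sum_congr rfl fun x _ => quantise01_smul_copyGen b ħ _ _ _

/-- The elements of degree at most one in terms of the generators of the copies. -/
theorem exists_eq_fn_add_embed (P : Flower01 d G n g) : ∃ F s, P = fn F + embed s := by
  have hfn : ∀ F F' : CoeffAlg d G n g, (fn (F + F') : Flower01 d G n g) = fn F + fn F' :=
    fun F F' => by rw [fn_eq_smul, add_smul, ← fn_eq_smul, ← fn_eq_smul]
  have hgen : ∀ X a, ∃ s : Sect d G n g, gen X a = embed s := fun X a => by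
    cases X with
    | M i => exact ⟨Pi.single (.M i) (Pi.single a 1), by rw [embed_single, contract_single]; rfl⟩
    | B i => exact ⟨Pi.single (.B i) (Pi.single a 1), by rw [embed_single, contract_single]; rfl⟩
    | A i => exact ⟨Pi.single (.A i) (Pi.single a 1) + Pi.single (.B i) (Pi.single a 1), by
        rw [map_add, embed_single, contract_single, embed_single, contract_single]
        exact (sub_add_cancel _ _).symm⟩
  refine flower01_ind (p := fun P => ∃ F s, P = fn F + embed s)
    (fun F => ⟨F, 0, by rw [map_zero, add_zero]⟩) (fun F X a => ?_) ?_ P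
  · obtain ⟨s, hs⟩ := hgen X a
    refine ⟨0, F • s, ?_⟩
    rw [hs, map_smul, fn_eq_smul, zero_smul, zero_add]
  · rintro P P' ⟨F, s, rfl⟩ ⟨F', s', rfl⟩
    refine ⟨F + F', s + s', ?_⟩
    rw [hfn, map_add]
    abel

theorem quantise01_fn_add_embed (F : CoeffAlg d G n g) (s : Sect d G n g) :
    (quantise01 b ħ (fn F + embed s)).1 = qmk ħ 1 F + qembed b ħ s := by
  rw [map_add, QFlower1.add_val, quantise01_fn, quantise01_embed]

theorem quantise01_injective : Function.Injective (quantise01 (n := n) (g := g) b ħ) := by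
  refine (injective_iff_map_eq_zero _).2 fun P hP => ?_
  obtain ⟨F, s, rfl⟩ := exists_eq_fn_add_embed P
  have h := congrArg Subtype.val hP
  rw [quantise01_fn_add_embed] at h
  obtain ⟨rfl, rfl⟩ := qmk_add_qembed_eq_zero b ħ h
  rw [map_zero, fn_eq_smul, zero_smul, add_zero]

theorem quantise01_surjective : Function.Surjective (quantise01 (n := n) (g := g) b ħ) := by
  have key : QFlower1 d G n g ħ ≤
      LinearMap.range ((QFlower1 d G n g ħ).subtype ∘ₗ quantise01 b ħ) := by
    refine Submodule.map₂_le.2 fun θ hθ F _ => ?_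
    obtain ⟨θ₁, h₁, _, ⟨ξ, rfl⟩, rfl⟩ := Submodule.mem_sup.1 hθ
    obtain ⟨c, rfl⟩ := Submodule.mem_span_singleton.1 h₁
    -- The first tensor factor is c·1 + ξ; its complex coordinates are moved into the coefficient
    -- functions.
    refine ⟨fn (c • F) + embed fun X a => decCoord b ħ (X, a) ξ • F, ?_⟩
    refine (quantise01_fn_add_embed b ħ _ _).trans ?_
    rw [← qmk_ι, map_smul, map_add, LinearMap.add_apply, map_smul, LinearMap.smul_apply]
    rfl
  rintro ⟨θ, hθ⟩
  obtain ⟨P, hP⟩ := key hθ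
  exact ⟨P, Subtype.ext hP⟩

theorem quantise01_bijective : Function.Bijective (quantise01 (n := n) (g := g) b ħ) :=
  ⟨quantise01_injective b ħ, quantise01_surjective b ħ⟩

end
end FlowerAlgebra

/-! ### Commutators of quantised elements of degree at most one. -/

namespace FlowerAlgebra
open Function

noncomputable section
variable {d : ℕ} {G : Type*} [TopologicalSpace G]
    [ChartedSpace (EuclideanSpace ℝ (Fin d)) G] [Group G] [LieGroup (𝓡 d) ∞ G] [T2Space G]
    {n g : ℕ} (b : Module.Basis (Fin d) ℝ (GroupLieAlgebra (𝓡 d) G)) (ħ : ℝ)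

attribute [local instance 100] LieRing.ofAssociativeRing

theorem decAction_decBasis (x : Loop n g × Fin d) (F : CoeffAlg d G n g) :
    decAction d G n g ħ (decBasis b ħ x) F = (Complex.I * ħ) • -slotDer x.1 (b x.2) F := by
  have h : decAction d G n g ħ (decBasis b ħ x) =
      (Complex.I * ħ) • -∑ X, (slotDer X).liftBaseChange ℂ (decBasis b ħ x X) := rfl
  rw [h, Finset.sum_eq_single x.1]
  · rw [show decBasis b ħ x x.1 = (1 : ℂ) ⊗ₜ[ℝ] b x.2 from if_pos rfl,
      LinearMap.liftBaseChange_tmul, one_smul]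
    rfl
  · intro Y _ hY
    rw [show decBasis b ħ x Y = (0 : ℂ ⊗[ℝ] GroupLieAlgebra (𝓡 d) G) from if_neg hY, map_zero]
  · exact fun h => absurd (Finset.mem_univ _) h

theorem lie_decBasis_of_ne {X Y : Loop n g} (h : X ≠ Y) (a c : Fin d) :
    ⁅decBasis b ħ (X, a), decBasis b ħ (Y, c)⁆ = 0 := by
  funext Z
  rw [QLie.lie_apply]
  by_cases hZ : Z = X
  · have : decBasis b ħ (Y, c) Z = (0 : ℂ ⊗[ℝ] GroupLieAlgebra (𝓡 d) G) :=
      if_neg fun e => h (hZ.symm.trans e)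
    rw [this]
    have h0 := lie_zero (L := ℂ ⊗[ℝ] GroupLieAlgebra (𝓡 d) G)
      (M := ℂ ⊗[ℝ] GroupLieAlgebra (𝓡 d) G) (decBasis b ħ (X, a) Z)
    refine (congrArg (fun ζ => (Complex.I * ħ) • -ζ) h0).trans ?_
    rw [neg_zero, smul_zero]
    rfl
  · have : decBasis b ħ (X, a) Z = (0 : ℂ ⊗[ℝ] GroupLieAlgebra (𝓡 d) G) := if_neg hZ
    rw [this, zero_lie, neg_zero, smul_zero]
    rfl

theorem lie_decBasis_self (X : Loop n g) (a c : Fin d) :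
    ⁅decBasis b ħ (X, a), decBasis b ħ (X, c)⁆ =
      (Complex.I * ħ) • -∑ e, (structConst b a c e : ℂ) • decBasis b ħ (X, e) := by
  refine decLie_hom_ext b ħ fun x => ?_
  obtain ⟨Z, e⟩ := x
  rw [map_smul, map_neg, map_sum]
  simp only [map_smul, decCoord_decBasis]
  change (b.baseChange ℂ).coord e (⁅decBasis b ħ (X, a), decBasis b ħ (X, c)⁆ Z) = _
  rw [QLie.lie_apply, map_smul, map_neg]
  congr 2
  by_cases hZ : Z = X
  · subst hZ
    rw [show decBasis b ħ (Z, a) Z = (1 : ℂ) ⊗ₜ[ℝ] b a from if_pos rfl,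
      show decBasis b ħ (Z, c) Z = (1 : ℂ) ⊗ₜ[ℝ] b c from if_pos rfl,
      LieAlgebra.ExtendScalars.bracket_tmul]
    simp [structConst]
  · rw [show decBasis b ħ (X, a) Z = (0 : ℂ ⊗[ℝ] GroupLieAlgebra (𝓡 d) G) from if_neg hZ,
      zero_lie, map_zero]
    simp [hZ]

/-- The sign in {ξ, F} is part of both `decAction` and `anchor`, so the two differ only by the
factor iħ. -/
theorem sum_slotDer_eq_anchor (s : Sect d G n g) (F : CoeffAlg d G n g) :
    ∑ x : Loop n g × Fin d, s x.1 x.2 * decAction d G n g ħ (decBasis b ħ x) F =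
      (Complex.I * ħ) • anchor b s F := by
  rw [anchor_apply, Derivation.neg_apply, derivation_sum_apply, Fintype.sum_prod_type,
    ← Finset.sum_neg_distrib, Finset.smul_sum]
  refine Finset.sum_congr rfl fun X _ => ?_
  rw [derSlot, contract_apply, derivation_sum_apply, ← Finset.sum_neg_distrib, Finset.smul_sum]
  refine Finset.sum_congr rfl fun a _ => ?_
  rw [decAction_decBasis, mul_smul_comm, mul_neg]
  rfl

theorem qembed_add (s t : Sect d G n g) : qembed b ħ (s + t) = qembed b ħ s + qembed b ħ t := by
  simp only [qembed_apply, Pi.add_apply, map_add, Finset.sum_add_distrib]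

theorem qembed_smul (c : ℂ) (s : Sect d G n g) : qembed b ħ (c • s) = c • qembed b ħ s := by
  simp only [qembed_apply, Pi.smul_apply, map_smul, Finset.smul_sum]

theorem qembed_sub (s t : Sect d G n g) : qembed b ħ (s - t) = qembed b ħ s - qembed b ħ t := by
  simp only [qembed_apply, Pi.sub_apply, map_sub, Finset.sum_sub_distrib]

/-- Different copies commute, so the double sum reduces to one copy at a time, where the structure
constants give the pointwise bracket. -/
theorem sum_lie_decBasis (s t : Sect d G n g) :
    ∑ x : Loop n g × Fin d, ∑ y : Loop n g × Fin d,
      qmk ħ (UniversalEnvelopingAlgebra.ι ℂ ⁅decBasis b ħ x, decBasis b ħ y⁆)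
        (s x.1 x.2 * t y.1 y.2) =
      (Complex.I * ħ) • qembed b ħ fun Z => -lieV b (s Z) (t Z) := by
  rw [← qembed_smul, qembed_apply, Fintype.sum_prod_type, Fintype.sum_prod_type]
  refine Finset.sum_congr rfl fun X _ => ?_
  have h : ∀ a, ∑ y : Loop n g × Fin d,
      qmk ħ (UniversalEnvelopingAlgebra.ι ℂ ⁅decBasis b ħ (X, a), decBasis b ħ y⁆)
        (s X a * t y.1 y.2) = ∑ c, ∑ e, (Complex.I * ħ) • -((structConst b a c e : ℂ) •
          qmk ħ (UniversalEnvelopingAlgebra.ι ℂ (decBasis b ħ (X, e))) (s X a * t X c)) := by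
    intro a
    rw [Fintype.sum_prod_type, Finset.sum_eq_single X]
    · refine Finset.sum_congr rfl fun c _ => ?_
      rw [lie_decBasis_self]
      simp only [map_smul, map_neg, map_sum, LinearMap.smul_apply, LinearMap.neg_apply,
        LinearMap.sum_apply, Finset.smul_sum, smul_neg, Finset.sum_neg_distrib]
    · intro Y _ hY
      refine Finset.sum_eq_zero fun c _ => ?_
      rw [lie_decBasis_of_ne b ħ hY.symm, map_zero, map_zero, LinearMap.zero_apply]
    · exact fun h => absurd (Finset.mem_univ _) h
  rw [Finset.sum_congr rfl fun a _ => h a]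
  simp only [Pi.smul_apply, Pi.neg_apply, lieV, lieVec_apply, map_smul, map_neg, map_sum,
    Finset.smul_sum, smul_neg, Finset.sum_neg_distrib]
  rw [neg_inj]
  exact (Finset.sum_congr rfl fun a _ => Finset.sum_comm).trans Finset.sum_comm

/-- Commutators in degree at most one. -/
theorem commutator_qembed (F F' : CoeffAlg d G n g) (s s' : Sect d G n g) :
    (qmk ħ 1 F + qembed b ħ s) * (qmk ħ 1 F' + qembed b ħ s') -
        (qmk ħ 1 F' + qembed b ħ s') * (qmk ħ 1 F + qembed b ħ s) =
      (Complex.I * ħ) • (qmk ħ 1 (anchor b s F' - anchor b s' F) + qembed b ħ (sectBr b s s')) := by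
  have h0 : qmk ħ 1 F * qmk ħ 1 F' - qmk ħ 1 F' * qmk ħ 1 F = 0 :=
    SmashProduct.commutator_mk_one_mk_one (decAction d G n g ħ) F F'
  have h1 : ∀ (s : Sect d G n g) F, qembed b ħ s * qmk ħ 1 F - qmk ħ 1 F * qembed b ħ s =
      (Complex.I * ħ) • qmk ħ 1 (anchor b s F) := fun s F => by
    refine (SmashProduct.commutator_lin_mk_one (decAction d G n g ħ) _ _ _).trans ?_
    rw [sum_slotDer_eq_anchor]
    exact map_smul (qmk ħ 1) _ _
  have h2 : qembed b ħ s * qembed b ħ s' - qembed b ħ s' * qembed b ħ s =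
      (Complex.I * ħ) • qembed b ħ (sectBr b s s') := by
    have h : sectBr b s s' = (fun Z => -lieV b (s Z) (s' Z)) +
      (fun Z => derVec (anchor b s) (s' Z)) - fun Z => derVec (anchor b s') (s Z) := rfl
    have h3 : ∀ s s' : Sect d G n g, SmashProduct.lin (decAction d G n g ħ) (decBasis b ħ)
        (fun y => ∑ x : Loop n g × Fin d, s x.1 x.2 *
          decAction d G n g ħ (decBasis b ħ x) (s' y.1 y.2)) =
        (Complex.I * ħ) • qembed b ħ (fun Z => derVec (anchor b s) (s' Z)) := fun s s' => by
      simp only [sum_slotDer_eq_anchor]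
      rw [← qembed_smul]
      rfl
    -- The three terms of `sectBr` correspond one by one to the three sums in the commutator of
    -- linear elements.
    rw [h, qembed_sub, qembed_add, smul_sub, smul_add, ← sum_lie_decBasis, ← h3, ← h3]
    exact SmashProduct.commutator_lin_lin (decAction d G n g ħ) _ _ _
  rw [map_sub, smul_add, smul_sub, ← h1, ← h1, ← h2]
  have e : qmk ħ 1 F * qmk ħ 1 F' = qmk ħ 1 F' * qmk ħ 1 F := sub_eq_zero.1 h0
  simp only [add_mul, mul_add, e]
  abel

/-- The brackets of `Q`-images in terms of the generators of the copies. -/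
theorem qcomm_quantise01 (F F' : CoeffAlg d G n g) (s s' : Sect d G n g) :
    qcomm ħ (quantise01 b ħ (fn F + embed s)) (quantise01 b ħ (fn F' + embed s')) =
      (Complex.I * ħ) •
        (quantise01 b ħ (fn (anchor b s F' - anchor b s' F) + embed (sectBr b s s'))).1 := by
  rw [qcomm, quantise01_fn_add_embed, quantise01_fn_add_embed, quantise01_fn_add_embed,
    commutator_qembed]

end
end FlowerAlgebra

/-! ### Comparison of the flower bracket with the decoupled bracket. -/

namespace FlowerAlgebra
open Function

noncomputable section
variable {d : ℕ} {G : Type*} [TopologicalSpace G]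
    [ChartedSpace (EuclideanSpace ℝ (Fin d)) G] [Group G] [LieGroup (𝓡 d) ∞ G] [T2Space G]
    {n g : ℕ} (b : Module.Basis (Fin d) ℝ (GroupLieAlgebra (𝓡 d) G)) (ħ : ℝ)

theorem fn_val (F : CoeffAlg d G n g) : (fn F : Flower01 d G n g).1 = MvPolynomial.C F := rfl

theorem coeffDer_fn (D : Derivation ℂ (CoeffAlg d G n g) (CoeffAlg d G n g))
    (F : CoeffAlg d G n g) :
    coeffDer D (fn F : Flower01 d G n g).1 = (fn (D F) : Flower01 d G n g).1 := by
  rw [fn_val, fn_val, MvPolynomial.C_apply, coeffDer_monomial, MvPolynomial.C_apply]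

theorem coeffDer_smul_gen (D : Derivation ℂ (CoeffAlg d G n g) (CoeffAlg d G n g))
    (F : CoeffAlg d G n g) (X : Loop n g) (a : Fin d) :
    coeffDer D (F • gen X a : Flower01 d G n g).1 = (D F • gen X a : Flower01 d G n g).1 := by
  rw [smul_gen_val, smul_gen_val, coeffDer_monomial]

theorem pderiv_fn (x : Loop n g × Fin d) (F : CoeffAlg d G n g) :
    MvPolynomial.pderiv x (fn F : Flower01 d G n g).1 = 0 := by
  rw [fn_val, MvPolynomial.pderiv_C]

theorem pderiv_smul_gen (x : Loop n g × Fin d) (F : CoeffAlg d G n g) (X : Loop n g) (a : Fin d) :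
    MvPolynomial.pderiv x (F • gen X a : Flower01 d G n g).1 =
      if x = (X, a) then MvPolynomial.C F else 0 := by
  rw [smul_gen_val]
  split_ifs with h
  · subst h
    rw [MvPolynomial.pderiv_monomial_single, Nat.sub_self, Finsupp.single_zero, Nat.cast_one,
      mul_one, MvPolynomial.C_apply]
  · rw [MvPolynomial.pderiv_monomial, Finsupp.single_eq_of_ne h, Nat.cast_zero, mul_zero, map_zero]

theorem flowerBracket_add_left (W W' Z : Flower d G n g) :
    flowerBracket b (W + W') Z = flowerBracket b W Z + flowerBracket b W' Z := by
  simp only [flowerBracket, map_add, add_mul, mul_add, Finset.sum_add_distrib,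
    Finset.sum_sub_distrib]
  abel

theorem flowerBracket_add_right (W Z Z' : Flower d G n g) :
    flowerBracket b W (Z + Z') = flowerBracket b W Z + flowerBracket b W Z' := by
  simp only [flowerBracket, map_add, add_mul, mul_add, Finset.sum_add_distrib,
    Finset.sum_sub_distrib]
  abel

theorem Flower01.add_val (P P' : Flower01 d G n g) : (P + P').1 = P.1 + P'.1 := rfl

theorem Flower01.sub_val (P P' : Flower01 d G n g) : (P - P').1 = P.1 - P'.1 := rfl

theorem Flower01.smul_val (F : CoeffAlg d G n g) (P : Flower01 d G n g) :
    (F • P).1 = MvPolynomial.C F * P.1 :=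
  MvPolynomial.smul_eq_C_mul _ _

theorem flowerBracket01_val (W Z : Flower01 d G n g) :
    (flowerBracket01 b W Z).1 = flowerBracket b W.1 Z.1 := rfl

theorem flowerBracket01_add_left (W W' Z : Flower01 d G n g) :
    flowerBracket01 b (W + W') Z = flowerBracket01 b W Z + flowerBracket01 b W' Z := by
  refine Subtype.ext ?_
  rw [flowerBracket01_val, Flower01.add_val, Flower01.add_val, flowerBracket_add_left,
    flowerBracket01_val, flowerBracket01_val]

theorem flowerBracket01_add_right (W Z Z' : Flower01 d G n g) :
    flowerBracket01 b W (Z + Z') = flowerBracket01 b W Z + flowerBracket01 b W Z' := by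
  refine Subtype.ext ?_
  rw [flowerBracket01_val, Flower01.add_val, Flower01.add_val, flowerBracket_add_right,
    flowerBracket01_val, flowerBracket01_val]

theorem flowerBracket01_fn_fn (F F' : CoeffAlg d G n g) :
    flowerBracket01 b (fn F) (fn F') = 0 := by
  refine Subtype.ext ?_
  rw [flowerBracket01_val]
  simp only [flowerBracket, pderiv_fn, zero_mul, sub_zero, Finset.sum_const_zero, add_zero]
  rfl

theorem flowerBracket01_gen_fn (F F' : CoeffAlg d G n g) (X : Loop n g) (a : Fin d) :
    flowerBracket01 b (F • gen X a) (fn F') = fn (F * brGenFn b X a F') := by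
  refine Subtype.ext ?_
  rw [flowerBracket01_val]
  simp only [flowerBracket, pderiv_fn, pderiv_smul_gen, coeffDer_fn, mul_zero, zero_mul,
    Finset.sum_const_zero, zero_add, sub_zero, ite_mul, Finset.sum_ite_eq', Finset.mem_univ,
    if_true]
  rw [fn_val, fn_val, map_mul]

theorem flowerBracket01_fn_gen (F F' : CoeffAlg d G n g) (X : Loop n g) (a : Fin d) :
    flowerBracket01 b (fn F) (F' • gen X a) = fn (-(F' * brGenFn b X a F)) := by
  refine Subtype.ext ?_
  rw [flowerBracket01_val]
  simp only [flowerBracket, pderiv_fn, pderiv_smul_gen, coeffDer_fn, zero_mul,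
    Finset.sum_const_zero, zero_add, zero_sub, ite_mul, Finset.sum_neg_distrib, Finset.sum_ite_eq',
    Finset.mem_univ, if_true]
  rw [fn_val, fn_val, map_neg, map_mul]

theorem sum_sum_ite_mul_ite_mul {I A : Type*} [Fintype I] [DecidableEq I] [CommRing A] (p q : I)
    (c c' : A) (f : I → I → A) : ∑ x, ∑ y, (if x = p then c else 0) * (if y = q then c' else 0) *
      f x y = c * c' * f p q := by
  rw [Finset.sum_eq_single p, Finset.sum_eq_single q, if_pos rfl, if_pos rfl]
  · intro y _ hy
    rw [if_neg hy, mul_zero, zero_mul]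
  · exact fun h => absurd (Finset.mem_univ _) h
  · intro x _ hx
    simp only [if_neg hx, zero_mul, Finset.sum_const_zero]
  · exact fun h => absurd (Finset.mem_univ _) h

theorem flowerBracket01_gen_gen (F F' : CoeffAlg d G n g) (X Y : Loop n g) (a c : Fin d) :
    flowerBracket01 b (F • gen X a) (F' • gen Y c) = (F * F') • brGenGen b X a Y c +
      (F * brGenFn b X a F') • gen Y c - (F' * brGenFn b Y c F) • gen X a := by
  refine Subtype.ext ?_
  rw [flowerBracket01_val, Flower01.sub_val, Flower01.add_val]
  simp only [flowerBracket, pderiv_smul_gen, coeffDer_smul_gen, sum_sum_ite_mul_ite_mul]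
  simp only [ite_mul, zero_mul, Finset.sum_sub_distrib, Finset.sum_ite_eq', Finset.mem_univ,
    if_true, Flower01.smul_val]
  simp only [map_mul, mul_assoc, add_sub_assoc]

theorem derVec_zero_left {C : Type*} [CommRing C] [Algebra ℂ C] (v : Fin d → C) :
    derVec (0 : Derivation ℂ C C) v = 0 := rfl

theorem sectBr_zero_right (s : Sect d G n g) : sectBr b s 0 = 0 := by
  funext Z
  simp only [sectBr, Pi.zero_apply, map_zero, derVec_zero_left, neg_zero, sub_zero, add_zero]

theorem sectBr_zero_left (s : Sect d G n g) : sectBr b 0 s = 0 := by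
  rw [sectBr_skew, sectBr_zero_right, neg_zero]

/-- The Leibniz rule of the Lie algebroid. Its shape is that of `flowerBracket01_gen_gen`, so the
two brackets need comparing only on generators with constant coefficients. -/
theorem sectBr_smul_smul (F F' : CoeffAlg d G n g) (s s' : Sect d G n g) :
    sectBr b (F • s) (F' • s') = (F * F') • sectBr b s s' + (F * anchor b s F') • s' -
      (F' * anchor b s' F) • s := by
  have h : ∀ (F : CoeffAlg d G n g) (D : Derivation ℂ (CoeffAlg d G n g) (CoeffAlg d G n g))
      (v : VecAlg d G n g), derVec (F • D) v = F • derVec D v :=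
    fun _ _ _ => funext fun _ => rfl
  funext Z
  simp only [sectBr, Pi.smul_apply, Pi.add_apply, Pi.sub_apply, map_smul, LinearMap.smul_apply,
    h, derVec_smul, smul_add, smul_sub, smul_neg, smul_smul]
  rw [mul_comm F' F]
  abel

theorem lieV_single_right (v : VecAlg d G n g) (a c : Fin d) :
    lieV b v (Pi.single a 1) c = ∑ e, (structConst b e a c : ℂ) • v e := by
  rw [lieV, lieVec_apply]
  refine Finset.sum_congr rfl fun e _ => ?_
  rw [Finset.sum_eq_single a]
  · rw [Pi.single_eq_same, mul_one]
  · intro y _ hy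
    rw [Pi.single_eq_of_ne hy, mul_zero, smul_zero]
  · simp

theorem single_sub_adV_single (w : Word d G n g) (a e : Fin d) :
    (Pi.single a 1 - adV b w (Pi.single a 1) : VecAlg d G n g) e = (1 - adStar b w) a e := by
  rw [adV_apply, Pi.sub_apply, Matrix.single_one_vecMul, Matrix.sub_apply, Matrix.one_apply,
    Pi.single_apply]
  simp only [Matrix.row_apply, eq_comm]

/-- The brackets of the generators of the flower algebra, in terms of the generators of the
copies. -/
theorem brGenGen_eq (X Y : Loop n g) (a c : Fin d) : brGenGen b X a Y c =
    decoupleC b (embed (sectBr b (genSect b X (Pi.single a 1)) (genSect b Y (Pi.single c 1)))) := by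
  have hlt : ∀ (X Y : Loop n g) (a c : Fin d),
      contract (gen Y) (lieV b (Pi.single a 1 - adV b (hol X) (Pi.single a 1)) (Pi.single c 1)) =
      (∑ e, ∑ e', ((structConst b e' c e : ℂ) • (1 - adStar b (hol X)) a e') • gen Y e :
        Flower01 d G n g) := fun X Y a c => by
    rw [contract_apply]
    refine Finset.sum_congr rfl fun e _ => ?_
    rw [lieV_single_right, Finset.sum_smul]
    exact Finset.sum_congr rfl fun e' _ => by rw [single_sub_adV_single]
  rw [brGenGen]
  by_cases h1 : X.pos < Y.pos
  · rw [if_pos h1, sectBr_genSect_of_pos_lt b h1 (fun D => derVec_single D a)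
      (fun D => derVec_single D c), map_neg, map_neg, decoupleC_genSect, hlt]
  by_cases h2 : Y.pos < X.pos
  -- With Y in front of X, skewness of `sectBr` exchanges the two loops, and its sign cancels the
  -- one in the formula for the ordered pair.
  · rw [if_neg h1, if_pos h2, sectBr_skew, sectBr_genSect_of_pos_lt b h2
      (fun D => derVec_single D c) (fun D => derVec_single D a), neg_neg, decoupleC_genSect, hlt]
  · rw [if_neg h1, if_neg h2, sectBr_genSect_of_pos_eq b (le_antisymm (not_lt.1 h2) (not_lt.1 h1))
      (fun D => derVec_single D a) (fun D => derVec_single D c), map_neg, map_neg,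
      decoupleC_genSect, contract_apply]
    refine congrArg Neg.neg (Finset.sum_congr rfl fun e _ => ?_)
    rw [lieV_single_right, Finset.sum_eq_single a, Pi.single_eq_same]
    · exact (smul_one_smul (CoeffAlg d G n g) _ _).symm
    · intro y _ hy
      rw [Pi.single_eq_of_ne hy, smul_zero]
    · exact fun h => absurd (Finset.mem_univ _) h

/-- The decoupling transformation. -/
def decoupleEquiv : Flower01 d G n g ≃ₗ[CoeffAlg d G n g] Flower01 d G n g :=
  LinearEquiv.ofBijective (decoupleC b) (decoupleC_bijective b)

theorem decoupleEquiv_symm_fn (F : CoeffAlg d G n g) :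
    (decoupleEquiv b).symm (fn F : Flower01 d G n g) = fn F :=
  (LinearEquiv.symm_apply_eq _).2 (decoupleC_fn b F).symm

theorem decoupleEquiv_symm_gen (F : CoeffAlg d G n g) (X : Loop n g) (a : Fin d) :
    (decoupleEquiv b).symm (F • gen X a) = embed (F • genSect b X (Pi.single a 1)) := by
  refine (LinearEquiv.symm_apply_eq _).2 ?_
  change _ = decoupleC b _
  rw [map_smul, map_smul, decoupleC_genSect, contract_single]

theorem decoupleEquiv_symm_brGenGen (X Y : Loop n g) (a c : Fin d) :
    (decoupleEquiv b).symm (brGenGen b X a Y c) =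
      embed (sectBr b (genSect b X (Pi.single a 1)) (genSect b Y (Pi.single c 1))) :=
  (LinearEquiv.symm_apply_eq _).2 (brGenGen_eq b X Y a c)

theorem anchor_genSect_single (X : Loop n g) (a : Fin d) :
    anchor b (genSect b X (Pi.single a 1)) = brGenFn b X a := by
  rw [anchor_genSect, genDer, contract_single]

theorem qcomm_add_left (θ θ' χ : QFlower1 d G n g ħ) :
    qcomm ħ (θ + θ') χ = qcomm ħ θ χ + qcomm ħ θ' χ := by
  rw [qcomm, qcomm, qcomm, QFlower1.add_val, add_mul, mul_add]
  abel

theorem qcomm_add_right (θ χ χ' : QFlower1 d G n g ħ) :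
    qcomm ħ θ (χ + χ') = qcomm ħ θ χ + qcomm ħ θ χ' := by
  rw [qcomm, qcomm, qcomm, QFlower1.add_val, add_mul, mul_add]
  abel

theorem fn_zero : (fn 0 : Flower01 d G n g) = 0 := by
  rw [fn_eq_smul, zero_smul]

theorem qcomm_fn_fn (F F' : CoeffAlg d G n g) :
    qcomm ħ (quantise01 b ħ (fn F)) (quantise01 b ħ (fn F')) = 0 := by
  have h := qcomm_quantise01 b ħ F F' 0 0
  simp only [map_zero, add_zero, Derivation.zero_apply, sub_zero, sectBr_zero_left, fn_zero] at h
  exact h.trans (smul_zero _)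

theorem qcomm_embed_fn (F : CoeffAlg d G n g) (s : Sect d G n g) :
    qcomm ħ (quantise01 b ħ (embed s)) (quantise01 b ħ (fn F)) =
      (Complex.I * ħ) • (quantise01 b ħ (fn (anchor b s F))).1 := by
  have h := qcomm_quantise01 b ħ 0 F s 0
  simpa only [map_zero, add_zero, zero_add, sub_zero, sectBr_zero_right, fn_zero] using h

theorem qcomm_fn_embed (F : CoeffAlg d G n g) (s : Sect d G n g) :
    qcomm ħ (quantise01 b ħ (fn F)) (quantise01 b ħ (embed s)) =
      (Complex.I * ħ) • (quantise01 b ħ (fn (-anchor b s F))).1 := by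
  have h := qcomm_quantise01 b ħ F 0 0 s
  simpa only [map_zero, add_zero, zero_add, zero_sub, sectBr_zero_left, fn_zero] using h

theorem qcomm_embed_embed (s s' : Sect d G n g) :
    qcomm ħ (quantise01 b ħ (embed s)) (quantise01 b ħ (embed s')) =
      (Complex.I * ħ) • (quantise01 b ħ (embed (sectBr b s s'))).1 := by
  have h := qcomm_quantise01 b ħ 0 0 s s'
  simpa only [map_zero, zero_add, sub_zero, fn_zero] using h

/-- The commutators of the transformed elements are given by the bracket of the flower algebra. -/
theorem qcomm_decoupleEquiv_symm (W Z : Flower01 d G n g) :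
    qcomm ħ (quantise01 b ħ ((decoupleEquiv b).symm W))
        (quantise01 b ħ ((decoupleEquiv b).symm Z)) =
      (Complex.I * ħ) •
        (quantise01 b ħ ((decoupleEquiv b).symm (flowerBracket01 b W Z))).1 := by
  -- Both sides are additive in each argument, so W and Z can be taken to be a function or a
  -- function times a generator.
  have hfn : ∀ (F : CoeffAlg d G n g) (Z : Flower01 d G n g),
      qcomm ħ (quantise01 b ħ (fn F)) (quantise01 b ħ ((decoupleEquiv b).symm Z)) =
        (Complex.I * ħ) •
          (quantise01 b ħ ((decoupleEquiv b).symm (flowerBracket01 b (fn F) Z))).1 := by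
    intro F Z
    induction Z using flower01_ind with
    | hC F' =>
      rw [decoupleEquiv_symm_fn, qcomm_fn_fn, flowerBracket01_fn_fn, map_zero, map_zero]
      exact (smul_zero _).symm
    | hX F' Y c =>
      rw [decoupleEquiv_symm_gen, qcomm_fn_embed, flowerBracket01_fn_gen, decoupleEquiv_symm_fn,
        map_smul, anchor_genSect_single]
      rfl
    | hadd Z Z' h h' =>
      rw [flowerBracket01_add_right, map_add, map_add, map_add, map_add, qcomm_add_right, h, h',
        QFlower1.add_val, smul_add]
  have hgen : ∀ (F : CoeffAlg d G n g) (X : Loop n g) (a : Fin d) (Z : Flower01 d G n g),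
      qcomm ħ (quantise01 b ħ ((decoupleEquiv b).symm (F • gen X a)))
          (quantise01 b ħ ((decoupleEquiv b).symm Z)) =
        (Complex.I * ħ) •
          (quantise01 b ħ ((decoupleEquiv b).symm (flowerBracket01 b (F • gen X a) Z))).1 := by
    intro F X a Z
    induction Z using flower01_ind with
    | hC F' =>
      rw [decoupleEquiv_symm_gen, decoupleEquiv_symm_fn, qcomm_embed_fn, flowerBracket01_gen_fn,
        decoupleEquiv_symm_fn, map_smul, anchor_genSect_single]
      rfl
    | hX F' Y c =>
      -- For two generators with coefficients, the Leibniz rules on the two sides agree term by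
      -- term.
      rw [decoupleEquiv_symm_gen, decoupleEquiv_symm_gen, qcomm_embed_embed,
        flowerBracket01_gen_gen, map_sub, map_add, map_smul, decoupleEquiv_symm_brGenGen,
        decoupleEquiv_symm_gen, decoupleEquiv_symm_gen, sectBr_smul_smul, anchor_genSect_single,
        anchor_genSect_single, map_sub, map_add, map_smul]
    | hadd Z Z' h h' =>
      rw [flowerBracket01_add_right, map_add, map_add, map_add, map_add, qcomm_add_right, h, h',
        QFlower1.add_val, smul_add]
  induction W using flower01_ind with
  | hC F => rw [decoupleEquiv_symm_fn, hfn]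
  | hX F X a => exact hgen F X a Z
  | hadd W W' h h' =>
    rw [flowerBracket01_add_left, map_add, map_add, map_add, map_add, qcomm_add_left, h, h',
      QFlower1.add_val, smul_add]

theorem flowerBracket01_generators (X Y : Loop n g) (a c : Fin d) :
    flowerBracket01 b (gen X a) (gen Y c) = brGenGen b X a Y c := by
  have h := flowerBracket01_gen_gen b 1 1 X Y a c
  simpa only [one_smul, one_mul, Derivation.map_one_eq_zero, zero_smul, add_zero, sub_zero] using h

theorem flowerBracket01_generator_fn (X : Loop n g) (a : Fin d) (F : CoeffAlg d G n g) :
    flowerBracket01 b (gen X a) (fn F) = fn (brGenFn b X a F) := by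
  have h := flowerBracket01_gen_fn b 1 F X a
  simpa only [one_smul, one_mul] using h

end
end FlowerAlgebra

theorem mainTheorem6 {d : ℕ} {G : Type*} [TopologicalSpace G]
    [ChartedSpace (EuclideanSpace ℝ (Fin d)) G] [Group G] [LieGroup (𝓡 d) ∞ G] [T2Space G]
    (b : Module.Basis (Fin d) ℝ (GroupLieAlgebra (𝓡 d) G)) (n g : ℕ) (ħ : ℝ) :
    ∃ (hQ : Function.Bijective (quantise01 (n := n) (g := g) b ħ))
      (hK : Function.Bijective (decouple01 (n := n) (g := g) b)),
      let Q : Flower01 d G n g ≃ₗ[ℂ] QFlower1 d G n g ħ := LinearEquiv.ofBijective _ hQ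
      let K : Flower01 d G n g ≃ₗ[ℂ] Flower01 d G n g := LinearEquiv.ofBijective _ hK
      let Khat : QFlower1 d G n g ħ ≃ₗ[ℂ] QFlower1 d G n g ħ := Q.symm ≪≫ₗ K ≪≫ₗ Q
      (∀ θ, Khat.symm θ = Q (K.symm (Q.symm θ))) ∧
      (∀ (X : Loop n g) (a : Fin d) (Y : Loop n g) (a' : Fin d),
        qcomm ħ (Khat.symm (Q (gen X a))) (Khat.symm (Q (gen Y a'))) =
          (Complex.I * ħ) • (Q (K.symm (brGenGen b X a Y a'))).1) ∧
      (∀ (X : Loop n g) (a : Fin d) (F : CoeffAlg d G n g),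
        qcomm ħ (Khat.symm (Q (gen X a))) (Khat.symm (Q (fn F))) =
          (Complex.I * ħ) • (Q (K.symm (fn (brGenFn b X a F)))).1) ∧
      (∀ F F' : CoeffAlg d G n g,
        qcomm ħ (Khat.symm (Q (fn F))) (Khat.symm (Q (fn F'))) = 0) ∧
      ∀ W Z : Flower01 d G n g,
        qcomm ħ (Khat.symm (Q W)) (Khat.symm (Q Z)) =
          (Complex.I * ħ) • (Q (K.symm (flowerBracket01 b W Z))).1 := by
  refine ⟨quantise01_bijective b ħ, decouple01_bijective b, ?_⟩
  intro Q K Khat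
  -- K is here linear over ℂ and `decoupleEquiv` over the functions; the underlying maps coincide,
  -- hence so do the inverses.
  have hK : ∀ W, K.symm W = (decoupleEquiv b).symm W := fun W =>
    (LinearEquiv.symm_apply_eq K).2 ((decoupleEquiv b).apply_symm_apply W).symm
  have hKhat : ∀ W, Khat.symm (Q W) = quantise01 b ħ ((decoupleEquiv b).symm W) := fun W => by
    rw [← hK]
    exact congrArg (fun P => Q (K.symm P)) (Q.symm_apply_apply W)
  have key : ∀ W Z : Flower01 d G n g, qcomm ħ (Khat.symm (Q W)) (Khat.symm (Q Z)) =
      (Complex.I * ħ) • (Q (K.symm (flowerBracket01 b W Z))).1 := fun W Z => by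
    rw [hKhat, hKhat, hK]
    exact qcomm_decoupleEquiv_symm b ħ W Z
  refine ⟨fun θ => rfl, fun X a Y a' => ?_, fun X a F => ?_, fun F F' => ?_, key⟩
  · rw [key, flowerBracket01_generators]
  · rw [key, flowerBracket01_generator_fn]
  · rw [hKhat, hKhat, decoupleEquiv_symm_fn, decoupleEquiv_symm_fn, qcomm_fn_fn]
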